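/- Let $L=\mathbb{Z}/2((x))$ be the field of Laurent series over $\mathbb{Z}/2$. For a power $q$ of $2$ let $L^{[q]}\subset L$ be the subfield of $q$th powers, so that $L=\bigoplus_{0\le j<q}x^{j}L^{[q]}$, and let $p_{q,j}\colon L\to x^{j}L^{[q]}$ be the projection attached to this decomposition; that is, $p_{q,j}$ keeps exactly the terms $c_nx^n$ with $n\equiv j\pmod q$. For an odd integer $l>1$ and $i\in\mathbb{Z}$ put $$[i]=\sum_{n\in\mathbb{Z},\ n\equiv i\ (\mathrm{mod}\ l)}x^{n^{2}}\in\mathbb{Z}/2[[x]]\subset L,$$ and let $S\subset L$ be the subring generated over $\mathbb{Z}/2$ by all the $[i]$ (both depend on $l$). **Theorem 7.2.** Let $a=[r]$ with $r\in\mathbb{Z}$ prime to $l$. 1. If $l=11$, then $p_{8,1}$, $p_{8,3}$, $p_{8,6}$, $p_{16,4}$, $p_{16,8}$, $p_{16,10}$, $p_{32,0}$, $p_{32,12}$ and $p_{64,16}$ all take $1/a$ to an element of $S$. 2. If $l=13$, then $p_{8,2}$, $p_{8,3}$, $p_{8,5}$, $p_{16,4}$, $p_{16,8}$, $p_{16,14}$,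 $p_{32,0}$, $p_{32,12}$ and $p_{64,16}$ all take $1/a$ to an element of $S$. 3. If $l=15$, then $p_{8,1}$, $p_{8,2}$, $p_{8,3}$, $p_{16,4}$, $p_{16,6}$, $p_{16,8}$, $p_{32,0}$, $p_{32,12}$ and $p_{64,16}$ all take $1/a$ to an element of $S$. -/

import Mathlib

namespace ThetaTwo

open PowerSeries

noncomputable section

/-- The field `L` of Laurent series over `ℤ/2`, i.e. the field of fractions of `ℤ/2[[x]]`. -/
abbrev L : Type := LaurentSeries (ZMod 2)

/-- The theta series `[i] = ∑ x ^ (n ^ 2)`, the sum running over all `n : ℤ` with `n ≡ i (mod l)`: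
its coefficient at `x ^ k` is the number of such `n` with `n ^ 2 = k`, reduced modulo `2`. -/
def theta (l : ℕ) (i : ℤ) : (ZMod 2)⟦X⟧ :=
  PowerSeries.mk fun k => (({n : ℤ | n ≡ i [ZMOD l] ∧ n ^ 2 = (k : ℤ)}.ncard : ℕ) : ZMod 2)

/-- The theta series `[i]` viewed in the field `L`. -/
def thetaL (l : ℕ) (i : ℤ) : L := (theta l i : L)

/-- The subring `S` of `L` generated over `ℤ/2` by all the `[i]`. -/
def S (l : ℕ) : Subalgebra (ZMod 2) L := Algebra.adjoin (ZMod 2) (Set.range (thetaL l))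

/-- The operator `p_{q,j} : L → L`, keeping the terms of a Laurent series whose exponent is
`≡ j (mod q)`. For `q` a power of `2` and `0 ≤ j < q` it is the projection onto `x ^ j L^{[q]}`
attached to the decomposition `L = ⨁_{0 ≤ j < q} x ^ j L^{[q]}`, where `L^{[q]}` is the subfield of
`q`-th powers: see `proj_mem_powerPart`, `sum_proj` and `eq_proj_of_sum_eq` below. -/
def proj (q j : ℕ) (F : L) : L where
  coeff n := if n ≡ j [ZMOD q] then F.coeff n else 0
  isPWO_support' := F.isPWO_support'.mono fun n hn => by
    rw [Function.mem_support] at hn ⊢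
    exact fun h => hn (by simp [h])

/-- The set `x ^ j L^{[q]}`. -/
def powerPart (q j : ℕ) : Set L :=
  {F | ∃ G : L, F = ((PowerSeries.X : (ZMod 2)⟦X⟧) : L) ^ j * G ^ q}

theorem proj_coeff (q j : ℕ) (F : L) (n : ℤ) :
    (proj q j F).coeff n = if n ≡ j [ZMOD q] then F.coeff n else 0 := rfl

theorem coeff_sq (G : L) (n : ℤ) :
    (G ^ 2).coeff n = if 2 ∣ n then G.coeff (n / 2) else 0 := by
  classical
  have key : ∀ a : ZMod 2, a + a = 0 ∧ a * a = a := by decide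
  rw [pow_two, HahnSeries.coeff_mul, ← Finset.sum_filter_add_sum_filter_not _ (fun p => p.1 = p.2)]
  have h2 : ∑ p ∈ (Finset.antidiagonal G.isPWO_support G.isPWO_support n).filter
      (fun p => ¬ p.1 = p.2), G.coeff p.1 * G.coeff p.2 = 0 := by
    refine Finset.sum_involution (fun p _ => p.swap) ?_ ?_ ?_ ?_
    · intro p _
      simp only [Prod.fst_swap, Prod.snd_swap]
      rw [mul_comm (G.coeff p.2)]
      exact (key _).1
    · intro p hp _ h
      exact (Finset.mem_filter.1 hp).2 (by simpa using (congrArg Prod.snd h))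
    · intro p hp
      simp only [Finset.mem_filter, Finset.mem_antidiagonal, Prod.fst_swap,
        Prod.snd_swap] at hp ⊢
      exact ⟨⟨hp.1.2.1, hp.1.1, by rw [add_comm]; exact hp.1.2.2⟩, fun h => hp.2 h.symm⟩
    · intro p _
      exact Prod.swap_swap p
  rw [h2, add_zero]
  split_ifs with h
  · obtain ⟨m, rfl⟩ := h
    have hm : 2 * m / 2 = m := by omega
    rw [hm]
    by_cases h0 : G.coeff m = 0
    · rw [h0]
      refine Finset.sum_eq_zero fun p hp => ?_
      simp only [Finset.mem_filter, Finset.mem_antidiagonal] at hp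
      have : p.1 = m := by omega
      rw [this, h0, zero_mul]
    · rw [Finset.sum_eq_single (m, m)]
      · exact (key _).2
      · intro p hp hne
        simp only [Finset.mem_filter, Finset.mem_antidiagonal] at hp
        exact absurd (Prod.ext (by show p.1 = m; omega) (by show p.2 = m; omega)) hne
      · intro hn
        refine absurd ?_ hn
        simp only [Finset.mem_filter, Finset.mem_antidiagonal, HahnSeries.mem_support]
        exact ⟨⟨h0, h0, by ring⟩, trivial⟩
  · refine Finset.sum_eq_zero fun p hp => ?_
    simp only [Finset.mem_filter, Finset.mem_antidiagonal] at hp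
    exact absurd ⟨p.1, by omega⟩ h

theorem coeff_pow_two_pow (k : ℕ) (G : L) (n : ℤ) :
    (G ^ 2 ^ k).coeff n = if (2 ^ k : ℤ) ∣ n then G.coeff (n / 2 ^ k) else 0 := by
  induction k generalizing n with
  | zero => simp
  | succ k ih =>
    rw [pow_succ, pow_mul, coeff_sq]
    by_cases h : (2 : ℤ) ∣ n
    · obtain ⟨m, rfl⟩ := h
      have hm : 2 * m / 2 = m := by omega
      rw [if_pos (dvd_mul_right _ _), hm, ih, pow_succ, mul_comm ((2 : ℤ) ^ k) 2,
        Int.mul_ediv_mul_of_pos _ _ two_pos]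
      simp only [mul_dvd_mul_iff_left (two_ne_zero (α := ℤ))]
    · rw [if_neg h, if_neg fun h' => h ((dvd_pow_self 2 k.succ_ne_zero).trans h')]

theorem coeff_X_pow_mul (j : ℕ) (F : L) (n : ℤ) :
    (((PowerSeries.X : (ZMod 2)⟦X⟧) : L) ^ j * F).coeff n = F.coeff (n - j) := by
  have h : ((PowerSeries.X : (ZMod 2)⟦X⟧) : L) ^ j = HahnSeries.single (j : ℤ) 1 := by
    rw [PowerSeries.coe_X, HahnSeries.single_pow]
    simp
  have h' := HahnSeries.coeff_single_mul_add (r := (1 : ZMod 2)) (x := F) (a := n - j) (b := (j : ℤ))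
  rw [sub_add_cancel, one_mul] at h'
  rw [h, h']

/-- A Laurent series lies in `x ^ j L^{[q]}` exactly if its exponents are all `≡ j (mod q)`. -/
theorem mem_powerPart_iff (k j : ℕ) (F : L) :
    F ∈ powerPart (2 ^ k) j ↔ ∀ n, F.coeff n ≠ 0 → n ≡ j [ZMOD (2 ^ k : ℕ)] := by
  constructor
  · rintro ⟨G, rfl⟩ n hn
    rw [coeff_X_pow_mul, coeff_pow_two_pow] at hn
    refine (Int.modEq_iff_dvd.2 ?_).symm
    by_contra h
    exact hn (if_neg (by simpa using h))
  · intro hF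
    have hq : (0 : ℤ) < 2 ^ k := by positivity
    refine ⟨⟨fun n => F.coeff (j + 2 ^ k * n), ?_⟩, ?_⟩
    · have hmono : ∀ a b : ℤ, (j : ℤ) + 2 ^ k * a ≤ j + 2 ^ k * b → a ≤ b := fun a b h =>
        le_of_mul_le_mul_left (by linarith) hq
      intro f
      obtain ⟨m, n, hmn, h⟩ := F.isPWO_support'
        (fun i => ⟨(j : ℤ) + 2 ^ k * (f i : ℤ), (f i).2⟩)
      exact ⟨m, n, hmn, hmono _ _ h⟩
    · ext n
      rw [coeff_X_pow_mul, coeff_pow_two_pow]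
      split_ifs with h
      · show F.coeff n = F.coeff (j + 2 ^ k * ((n - j) / 2 ^ k))
        rw [Int.mul_ediv_cancel' h, add_sub_cancel]
      · by_contra h0
        exact h (by simpa using (Int.modEq_iff_dvd.1 (hF n h0).symm))

/-- `p_{q,j}` takes values in `x ^ j L^{[q]}`. -/
theorem proj_mem_powerPart (k j : ℕ) (F : L) : proj (2 ^ k) j F ∈ powerPart (2 ^ k) j := by
  rw [mem_powerPart_iff]
  intro n hn
  by_contra h
  exact hn (by rw [proj_coeff, if_neg h])

theorem proj_of_mem (k i j : ℕ) (hi : i < 2 ^ k) (hj : j < 2 ^ k) (F : L)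
    (hF : F ∈ powerPart (2 ^ k) i) : proj (2 ^ k) j F = if i = j then F else 0 := by
  rw [mem_powerPart_iff] at hF
  ext n
  rw [proj_coeff]
  by_cases h0 : F.coeff n = 0
  · split_ifs <;> simp [h0]
  have hni := hF n h0
  by_cases hij : i = j
  · subst hij
    rw [if_pos hni, if_pos rfl]
  · have : ¬ n ≡ j [ZMOD (2 ^ k : ℕ)] := fun h => hij
      ((Int.natCast_modEq_iff.1 (hni.symm.trans h)).eq_of_lt_of_lt hi hj)
    rw [if_neg this, if_neg hij, HahnSeries.coeff_zero]

theorem proj_sum (q j : ℕ) (s : Finset ℕ) (f : ℕ → L) :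
    proj q j (∑ i ∈ s, f i) = ∑ i ∈ s, proj q j (f i) := by
  ext n
  simp only [proj_coeff, HahnSeries.coeff_sum]
  split_ifs <;> simp

/-- Every `F` is the sum of its components `p_{q,j}(F)`, `0 ≤ j < q`. -/
theorem sum_proj (k : ℕ) (F : L) : ∑ j ∈ Finset.range (2 ^ k), proj (2 ^ k) j F = F := by
  ext n
  have hq : (0 : ℤ) < ((2 ^ k : ℕ) : ℤ) := by positivity
  have h0 := Int.emod_nonneg n hq.ne'
  have h1 := Int.emod_lt_of_pos n hq
  obtain ⟨m, hm⟩ := Int.eq_ofNat_of_zero_le h0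
  have hmlt : m < 2 ^ k := by rw [hm] at h1; exact_mod_cast h1
  have hnm : n ≡ m [ZMOD (2 ^ k : ℕ)] := by rw [← hm]; exact (Int.mod_modEq n _).symm
  simp only [HahnSeries.coeff_sum, proj_coeff]
  rw [Finset.sum_eq_single m, if_pos hnm]
  · intro b hb hbm
    refine if_neg fun h => hbm ?_
    exact (Int.natCast_modEq_iff.1 (h.symm.trans hnm)).eq_of_lt_of_lt (Finset.mem_range.1 hb) hmlt
  · intro h
    exact absurd (Finset.mem_range.2 hmlt) h

/-- The components are unique: `p_{q,j}(F)` is the `x ^ j L^{[q]}`-component of `F`. -/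
theorem eq_proj_of_sum_eq (k : ℕ) (F : L) (f : ℕ → L)
    (hf : ∀ i < 2 ^ k, f i ∈ powerPart (2 ^ k) i)
    (hsum : ∑ i ∈ Finset.range (2 ^ k), f i = F) (j : ℕ) (hj : j < 2 ^ k) :
    f j = proj (2 ^ k) j F := by
  rw [← hsum, proj_sum, Finset.sum_eq_single j]
  · rw [proj_of_mem k j j hj hj _ (hf j hj), if_pos rfl]
  · intro b hb hbj
    have hb' := Finset.mem_range.1 hb
    rw [proj_of_mem k b j hb' hj _ (hf b hb'), if_neg hbj]
  · intro h
    exact absurd (Finset.mem_range.2 hj) h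

end

end ThetaTwo

namespace ThetaTwo

open PowerSeries

/-! ### Generating series modulo 2 and the theta series as counts of integers. -/

noncomputable section

/-! Two symmetries of the theta series in characteristic 2 carry the argument. The sign change n ↦
-n pairs off terms, so [-i] = [i] and [0] = 1. The rotation (n, m) ↦ (n + m, n - m) doubles n² + m²,
so the even part of [i+j][i-j] is ([i][j])² (`coeff_theta_mul_theta`, `even_part_thetaL_mul`). For i
= j this says that the even part of [2i] is [i]⁴; the odd part has odd squares as exponents, so it
lives in degree 1 modulo 8 (`homog_thetaL_add`). Computing the even part of [2i][2j] in two ways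
gives the relation `thetaL_rotation`.

Choose s with 8s ≡ r and put a = [8s], b = [4s], c = [2s], d = [6s], t = b⁴/a. In 1/a = a³/a⁴ the
denominator does not move residue classes modulo 4, and a = b⁴ + (a + b⁴) is a splitting into
degrees 0 and 1. Hence the components modulo 4, and after one more factor a⁴ those modulo 8, are
explicit: the class of 1 modulo 8, for instance, contributes t⁶(1+t)/a. Components of even index
come from root extraction: if the even part of Fa is G², then the even part of F/a is (G/a)². This
produces the chain 1/a, b²/a, b³/a, bcd/a, `numer`/a. Each projection in the theorem thereby becomes
a 2-power of a projection, with smaller modulus, of one member of the chain (`Tower`).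

It remains to see that the resulting quotients lie in S. The element t is not shown to lie in S, but
the ideal I of S generated by the theta series of suitable indices satisfies tI ⊆ I, so powers of t
are harmless once one factor is known to lie in I (`mul_mem_idealSpan_of_stable`). For the deepest
projections S is also used to be stable under all p_{4,j} (`proj_four_mem`), and `mem_of_root`
removes from `numer`/a everything that already lies in S.

What is left are divisibility statements a · P = (polynomial in theta series) with P explicit. They
follow formally from the rotation relations, from combinations of three of them without fourth
powers, and, for l = 15, from relations given by the reflections in (1,1,1) and (1,1,2,2), which
preserve sums of squares. Each is checked by computation: monomials are coded as products of primes,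
a sum over ℤ/2 is a list of codes in which equal pairs cancel, and a certificate lists multiples of
known relations whose total cancels to nothing (`evalSum_eq_zero`). -/

/-- The generating series modulo `2` of the set `A` with respect to the weight `w`. -/
def genSeries {α : Type*} (w : α → ℕ) (A : Set α) : (ZMod 2)⟦X⟧ :=
  PowerSeries.mk fun k => (({a | a ∈ A ∧ w a = k}.ncard : ℕ) : ZMod 2)

theorem coeff_genSeries {α : Type*} (w : α → ℕ) (A : Set α) (k : ℕ) :
    PowerSeries.coeff k (genSeries w A) = (({a | a ∈ A ∧ w a = k}.ncard : ℕ) : ZMod 2) :=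
  PowerSeries.coeff_mk _ _

/-- The pairs of total weight k split into disjoint blocks indexed by the antidiagonal of k.
Finiteness of the weight fibres is essential, since `ncard` of an infinite set is 0. -/
theorem genSeries_mul {α β : Type*} (w : α → ℕ) (w' : β → ℕ) (A : Set α) (B : Set β)
    (hw : ∀ k, {a | w a = k}.Finite) (hw' : ∀ k, {b | w' b = k}.Finite) :
    genSeries w A * genSeries w' B = genSeries (fun p : α × β => w p.1 + w' p.2) (A ×ˢ B) := by
  classical
  have hA : ∀ k, {a | a ∈ A ∧ w a = k}.Finite := fun k => (hw k).subset fun _ h => h.2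
  have hB : ∀ k, {b | b ∈ B ∧ w' b = k}.Finite := fun k => (hw' k).subset fun _ h => h.2
  ext k
  rw [PowerSeries.coeff_mul, coeff_genSeries]
  have key : {p : α × β | p ∈ A ×ˢ B ∧ w p.1 + w' p.2 = k} =
      ((Finset.HasAntidiagonal.antidiagonal k).biUnion fun q => (hA q.1).toFinset ×ˢ (hB q.2).toFinset :
        Finset (α × β)) := by
    ext p
    simp only [Set.mem_ofPred_eq, Set.mem_prod, Finset.coe_biUnion, Finset.mem_coe,
      Finset.HasAntidiagonal.mem_antidiagonal, Finset.coe_product, Set.Finite.coe_toFinset, Set.mem_iUnion,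
      exists_prop, Prod.exists]
    constructor
    · rintro ⟨⟨h1, h2⟩, h3⟩
      exact ⟨_, _, h3, ⟨h1, rfl⟩, h2, rfl⟩
    · rintro ⟨x, y, h3, ⟨h1, rfl⟩, h2, rfl⟩
      exact ⟨⟨h1, h2⟩, h3⟩
  rw [key, Set.ncard_coe_finset, Finset.card_biUnion, Nat.cast_sum]
  · refine Finset.sum_congr rfl fun q _ => ?_
    rw [Finset.card_product, Nat.cast_mul, coeff_genSeries, coeff_genSeries,
      Set.ncard_eq_toFinset_card _ (hA q.1), Set.ncard_eq_toFinset_card _ (hB q.2)]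
  · intro q _ q' _ hne
    rw [Function.onFun, Finset.disjoint_left]
    intro p hp hp'
    simp only [Finset.mem_product, Set.Finite.mem_toFinset, Set.mem_ofPred_eq] at hp hp'
    exact hne (Prod.ext (hp.1.2.symm.trans hp'.1.2) (hp.2.2.symm.trans hp'.2.2))

/-- The form in which symmetries enter: negation of integers and the two lattice reflections are
weight-preserving bijections with an explicit inverse. -/
theorem genSeries_congr {α β : Type*} {w : α → ℕ} {w' : β → ℕ} {A : Set α} {B : Set β}
    (f : α → β) (g : β → α) (hf : ∀ a ∈ A, f a ∈ B ∧ w' (f a) = w a ∧ g (f a) = a)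
    (hg : ∀ b ∈ B, g b ∈ A ∧ f (g b) = b) : genSeries w A = genSeries w' B := by
  ext k
  rw [coeff_genSeries, coeff_genSeries]
  congr 1
  refine Set.ncard_congr (fun a _ => f a) ?_ ?_ ?_
  · rintro a ⟨ha, hk⟩
    exact ⟨(hf a ha).1, (hf a ha).2.1.trans hk⟩
  · rintro a b ⟨ha, _⟩ ⟨hb, _⟩ h
    rw [← (hf a ha).2.2, h, (hf b hb).2.2]
  · rintro b ⟨hb, hk⟩
    refine ⟨g b, ⟨(hg b hb).1, ?_⟩, (hg b hb).2⟩
    rw [← (hf _ (hg b hb).1).2.1, (hg b hb).2, hk]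

theorem sum_genSeries {α ι : Type*} (w : α → ℕ) (hw : ∀ k, {a | w a = k}.Finite)
    (s : Finset ι) (A : ι → Set α)
    (hA : ∀ i ∈ s, ∀ j ∈ s, ∀ a, a ∈ A i → a ∈ A j → i = j) :
    ∑ i ∈ s, genSeries w (A i) = genSeries w {a | ∃ i ∈ s, a ∈ A i} := by
  classical
  ext k
  have hf : ∀ i, {a | a ∈ A i ∧ w a = k}.Finite := fun i => (hw k).subset fun _ h => h.2
  have key : {a | a ∈ {a | ∃ i ∈ s, a ∈ A i} ∧ w a = k} =
      (s.biUnion fun i => (hf i).toFinset : Finset α) := by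
    ext a
    simp only [Set.mem_ofPred_eq, Finset.coe_biUnion, Finset.mem_coe, Set.Finite.coe_toFinset,
      Set.mem_iUnion, exists_prop]
    constructor
    · rintro ⟨⟨i, hi, ha⟩, hk⟩
      exact ⟨i, hi, ha, hk⟩
    · rintro ⟨i, hi, ha, hk⟩
      exact ⟨⟨i, hi, ha⟩, hk⟩
  rw [map_sum, coeff_genSeries, key, Set.ncard_coe_finset, Finset.card_biUnion, Nat.cast_sum]
  · refine Finset.sum_congr rfl fun i _ => ?_
    rw [coeff_genSeries, Set.ncard_eq_toFinset_card _ (hf i)]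
  · intro i hi j hj hne
    rw [Function.onFun, Finset.disjoint_left]
    intro a ha ha'
    simp only [Set.Finite.mem_toFinset, Set.mem_ofPred_eq] at ha ha'
    exact hne (hA i hi j hj a ha.1 ha'.1)

theorem finite_natAbs_sq (k : ℕ) : {n : ℤ | n.natAbs ^ 2 = k}.Finite := by
  refine (Set.finite_Icc (-(k : ℤ)) k).subset fun n hn => ?_
  have h : n.natAbs ≤ k := by
    have : n.natAbs ^ 2 = k := hn
    nlinarith [Nat.zero_le n.natAbs]
  exact ⟨by omega, by omega⟩

theorem finite_weight_le {α : Type*} {w : α → ℕ} (hw : ∀ k, {a | w a = k}.Finite) (k : ℕ) :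
    {a | w a ≤ k}.Finite := by
  refine ((Set.finite_Iic k).biUnion fun i _ => hw i).subset fun a ha => ?_
  simpa using ha

theorem finite_weight_add {α β : Type*} {w : α → ℕ} {w' : β → ℕ}
    (hw : ∀ k, {a | w a = k}.Finite) (hw' : ∀ k, {b | w' b = k}.Finite) (k : ℕ) :
    {p : α × β | w p.1 + w' p.2 = k}.Finite := by
  refine ((finite_weight_le hw k).prod (finite_weight_le hw' k)).subset fun p hp => ?_
  have hp' : w p.1 + w' p.2 = k := hp
  exact ⟨by show w p.1 ≤ k; omega, by show w' p.2 ≤ k; omega⟩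

/-- The residue class of `i` modulo `l`. -/
def residue (l : ℕ) (i : ℤ) : Set ℤ := {n | n ≡ i [ZMOD l]}

theorem theta_eq_genSeries (l : ℕ) (i : ℤ) :
    theta l i = genSeries (fun n : ℤ => n.natAbs ^ 2) (residue l i) := by
  ext k
  rw [theta, PowerSeries.coeff_mk, coeff_genSeries]
  congr 3
  ext n
  simp only [residue, Set.mem_ofPred_eq, and_congr_right_iff]
  intro _
  rw [← Int.natAbs_sq]
  norm_cast

theorem theta_congr {l : ℕ} {i j : ℤ} (h : i ≡ j [ZMOD l]) : theta l i = theta l j := by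
  rw [theta_eq_genSeries, theta_eq_genSeries]
  congr 1
  ext n
  exact ⟨fun hn => Int.ModEq.trans hn h, fun hn => Int.ModEq.trans hn h.symm⟩

theorem theta_neg (l : ℕ) (i : ℤ) : theta l (-i) = theta l i := by
  rw [theta_eq_genSeries, theta_eq_genSeries]
  refine genSeries_congr (fun n => -n) (fun n => -n) (fun n hn => ⟨?_, by simp, by simp⟩)
    (fun n hn => ⟨Int.ModEq.neg hn, by simp⟩)
  simpa [residue] using Int.ModEq.neg hn

/-- The class of 0 is stable under n ↦ -n, whose only fixed point is 0, so all other terms cancel in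
pairs modulo 2. -/
theorem coeff_theta_zero (l : ℕ) (k : ℕ) :
    PowerSeries.coeff k (theta l 0) = if k = 0 then 1 else 0 := by
  classical
  rw [theta_eq_genSeries, coeff_genSeries]
  have hfin : {a : ℤ | a ∈ residue l 0 ∧ a.natAbs ^ 2 = k}.Finite :=
    (finite_natAbs_sq k).subset fun _ h => h.2
  split_ifs with hk
  · subst hk
    have : {a : ℤ | a ∈ residue l 0 ∧ a.natAbs ^ 2 = 0} = {0} := by
      ext a
      simp only [Set.mem_ofPred_eq, Set.mem_singleton_iff, residue]
      constructor
      · rintro ⟨_, h⟩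
        simpa using h
      · rintro rfl
        exact ⟨Int.ModEq.refl _, by simp⟩
    rw [this, Set.ncard_singleton, Nat.cast_one]
  · rw [Set.ncard_eq_toFinset_card _ hfin]
    rw [Finset.cast_card]
    refine Finset.sum_involution (fun a _ => -a) (fun _ _ => by decide) ?_ ?_ (fun _ _ => neg_neg _)
    · intro a ha _ h
      have ha' := (hfin.mem_toFinset.1 ha).2
      have : a = 0 := by omega
      subst this
      exact hk (by simpa using ha'.symm)
    · intro a ha
      have ha' := hfin.mem_toFinset.1 ha
      refine hfin.mem_toFinset.2 ⟨?_, by simpa using ha'.2⟩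
      simpa [residue] using Int.ModEq.neg ha'.1

theorem theta_zero (l : ℕ) : theta l 0 = 1 := by
  ext k
  rw [coeff_theta_zero, PowerSeries.coeff_one]

/-- The exponents of a theta series are squares. -/
theorem exists_sq_of_coeff_theta_ne_zero {l : ℕ} {i : ℤ} {k : ℕ}
    (h : PowerSeries.coeff k (theta l i) ≠ 0) : ∃ n : ℤ, n ^ 2 = k := by
  by_contra hne
  push Not at hne
  refine h ?_
  rw [theta, PowerSeries.coeff_mk]
  have : {n : ℤ | n ≡ i [ZMOD l] ∧ n ^ 2 = (k : ℤ)} = ∅ := by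
    ext n
    simpa using fun _ => hne n
  rw [this]
  simp

/-- If i is not 0 modulo l, the exponent i² is attained exactly once: the other root -i lies in
another class, because l is odd. -/
theorem theta_ne_zero {l : ℕ} (hl : Odd l) (i : ℤ) : theta l i ≠ 0 := by
  by_cases hi : i ≡ 0 [ZMOD l]
  · rw [theta_congr hi, theta_zero]
    exact one_ne_zero
  · intro h
    have h' := congrArg (PowerSeries.coeff (i.natAbs ^ 2)) h
    rw [theta_eq_genSeries, coeff_genSeries, map_zero] at h'
    have : {a : ℤ | a ∈ residue l i ∧ a.natAbs ^ 2 = i.natAbs ^ 2} = {i} := by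
      ext a
      simp only [Set.mem_ofPred_eq, Set.mem_singleton_iff]
      constructor
      · rintro ⟨h1, h2⟩
        have h3 : a.natAbs = i.natAbs := Nat.pow_left_injective two_ne_zero h2
        rcases Int.natAbs_eq_natAbs_iff.1 h3 with h4 | h4
        · exact h4
        · exfalso
          subst h4
          refine hi ?_
          have h5 : (l : ℤ) ∣ i - (-i) := Int.modEq_iff_dvd.1 h1
          have h6 : (l : ℤ) ∣ 2 * i := by
            have : i - (-i) = 2 * i := by ring
            rwa [this] at h5
          have h7 : IsCoprime (l : ℤ) 2 := by
            rw [Int.isCoprime_iff_gcd_eq_one]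
            exact_mod_cast (Nat.coprime_two_right.2 hl)
          exact (Int.modEq_zero_iff_dvd).2 (h7.dvd_of_dvd_mul_left h6)
      · rintro rfl
        exact ⟨Int.ModEq.refl _, rfl⟩
    rw [this, Set.ncard_singleton] at h'
    simp at h'

/-- Rotation by `45` degrees: `(n, m) ↦ (n + m, n - m)`. -/
theorem coeff_theta_mul_theta {l : ℕ} (hl : Odd l) (i j : ℤ) (k : ℕ) :
    PowerSeries.coeff (2 * k) (theta l (i + j) * theta l (i - j)) =
      PowerSeries.coeff k (theta l i * theta l j) := by
  simp only [theta_eq_genSeries]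
  rw [genSeries_mul _ _ _ _ finite_natAbs_sq finite_natAbs_sq,
    genSeries_mul _ _ _ _ finite_natAbs_sq finite_natAbs_sq, coeff_genSeries, coeff_genSeries]
  congr 1
  symm
  have sq : ∀ n m : ℤ, ∀ k : ℕ, n.natAbs ^ 2 + m.natAbs ^ 2 = k ↔ n ^ 2 + m ^ 2 = k := by
    intro n m k
    rw [← Int.natAbs_sq n, ← Int.natAbs_sq m]
    norm_cast
  refine Set.ncard_congr (fun p _ => (p.1 + p.2, p.1 - p.2)) ?_ ?_ ?_
  · rintro ⟨n, m⟩ ⟨⟨h1, h2⟩, h3⟩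
    refine ⟨⟨Int.ModEq.add h1 h2, Int.ModEq.sub h1 h2⟩, ?_⟩
    rw [sq] at h3 ⊢
    push_cast
    linear_combination 2 * h3
  · rintro ⟨n, m⟩ ⟨n', m'⟩ _ _ h
    simp only [Prod.mk.injEq] at h ⊢
    omega
  · rintro ⟨s, t⟩ ⟨⟨h1, h2⟩, h3⟩
    rw [sq] at h3
    dsimp only at h3
    -- Surjectivity of the rotation: s² + t² = 2k is even, so s and t have the same parity and (s +
    -- t)/2, (s - t)/2 are integers.
    have hev : (2 : ℤ) ∣ s + t := by
      have h4 : (s + t) ^ 2 = 2 * (k + s * t) := by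
        push_cast at h3
        linear_combination h3
      exact Int.prime_two.dvd_of_dvd_pow ⟨_, h4⟩
    obtain ⟨n, hn⟩ := hev
    obtain ⟨c, hc⟩ := hl
    have hst : t = n - (s - n) := by omega
    -- Oddness of l enters here: the congruences for s and t determine those of their half sum and
    -- half difference.
    have hdiv : ∀ z w : ℤ, 2 * z ≡ 2 * w [ZMOD l] → z ≡ w [ZMOD l] := by
      intro z w h
      have hc2 : IsCoprime (l : ℤ) 2 := ⟨1, -c, by rw [hc]; push_cast; ring⟩
      have h5 := Int.modEq_iff_dvd.1 h
      rw [← mul_sub] at h5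
      exact Int.modEq_iff_dvd.2 (hc2.dvd_of_dvd_mul_left h5)
    refine ⟨(n, s - n), ⟨⟨?_, ?_⟩, ?_⟩, ?_⟩
    · refine hdiv _ _ ?_
      have := Int.ModEq.add h1 h2
      have e1 : s + t = 2 * n := hn
      have e2 : i + j + (i - j) = 2 * i := by ring
      dsimp only at this
      rwa [e1, e2] at this
    · refine hdiv _ _ ?_
      have := Int.ModEq.sub h1 h2
      have e1 : s - t = 2 * (s - n) := by omega
      have e2 : i + j - (i - j) = 2 * j := by ring
      dsimp only at this
      rwa [e1, e2] at this
    · rw [sq]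
      subst hst
      push_cast at h3
      dsimp only
      linarith [h3]
    · simp only [Prod.mk.injEq]
      omega

end

/-! ### Reflections in (1,1,1) and (1,1,2,2) acting on unions of residue classes. -/

noncomputable section

theorem modEq_add_mul_iff {q m : ℕ} (x i : ℤ) (c d : ℤ) :
    x ≡ i + c * m + d * (q * m : ℕ) [ZMOD (q * m : ℕ)] ↔ x ≡ i + c * m [ZMOD (q * m : ℕ)] := by
  have h : i + c * m + d * (q * m : ℕ) ≡ i + c * m [ZMOD (q * m : ℕ)] :=
    Int.modEq_iff_dvd.2 ⟨-d, by ring⟩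
  exact ⟨fun h' => h'.trans h, fun h' => h'.trans h.symm⟩

/-- The difference (d' - d)m is a multiple of qm, so q divides d' - d, which is smaller than q in
absolute value. This gives the disjointness of the classes summed over d below. -/
theorem eq_of_shift_modEq {q m : ℕ} (hm : m ≠ 0) {x i : ℤ} {d d' : ℕ} (hd : d < q) (hd' : d' < q)
    (h : x ≡ i + d * m [ZMOD (q * m : ℕ)]) (h' : x ≡ i + d' * m [ZMOD (q * m : ℕ)]) : d = d' := by
  obtain ⟨c, hc⟩ := Int.modEq_iff_dvd.1 (h.symm.trans h')
  have hm' : (m : ℤ) ≠ 0 := by exact_mod_cast hm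
  have h1 : (d' : ℤ) - d = q * c := by
    refine mul_right_cancel₀ hm' ?_
    push_cast at hc
    linear_combination hc
  have hq : (d : ℤ) < q := by exact_mod_cast hd
  have hq' : (d' : ℤ) < q := by exact_mod_cast hd'
  have h2 : c = 0 := by
    by_contra hne
    rcases lt_or_gt_of_ne hne with h3 | h3 <;> nlinarith
  subst h2
  omega

/-- The union of the residue classes of `v + d m (1, 1, 1)` modulo `3 m`. -/
def tripleClass (m : ℕ) (i j k : ℤ) : Set (ℤ × ℤ × ℤ) :=
  {p | ∃ d : ℤ, p.1 ≡ i + d * m [ZMOD (3 * m : ℕ)] ∧ p.2.1 ≡ j + d * m [ZMOD (3 * m : ℕ)] ∧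
    p.2.2 ≡ k + d * m [ZMOD (3 * m : ℕ)]}

/-- A single product of residue classes is not stable under the reflection, which may change d;
summing over d gives a set on which it acts. -/
theorem sum_theta_triple (m : ℕ) (hm : m ≠ 0) (i j k : ℤ) :
    ∑ d ∈ Finset.range 3, theta (3 * m) (i + d * m) *
      (theta (3 * m) (j + d * m) * theta (3 * m) (k + d * m)) =
    genSeries (fun p : ℤ × ℤ × ℤ => p.1.natAbs ^ 2 + (p.2.1.natAbs ^ 2 + p.2.2.natAbs ^ 2))
      (tripleClass m i j k) := by
  have hf := finite_weight_add finite_natAbs_sq finite_natAbs_sq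
  simp only [theta_eq_genSeries]
  simp only [genSeries_mul _ _ _ _ finite_natAbs_sq finite_natAbs_sq,
    genSeries_mul _ _ _ _ finite_natAbs_sq hf]
  rw [sum_genSeries _ (finite_weight_add finite_natAbs_sq hf)]
  · congr 1
    ext ⟨x, y, z⟩
    simp only [Set.mem_ofPred_eq, Set.mem_prod, residue, tripleClass, Finset.mem_range]
    constructor
    · rintro ⟨d, _, h1, h2, h3⟩
      exact ⟨d, h1, h2, h3⟩
    · rintro ⟨d, h1, h2, h3⟩
      -- The class depends only on d modulo 3, so an arbitrary integer d may be replaced by its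
      -- remainder.
      have h4 := Int.emod_add_mul_ediv d 3
      have h5 : ((d % 3).toNat : ℤ) = d % 3 := Int.toNat_of_nonneg (by omega)
      have key : ∀ t : ℤ, t + d * m = t + (d % 3) * m + (d / 3) * (3 * m : ℕ) := by
        intro t
        push_cast
        linear_combination (-(m : ℤ)) * h4
      rw [key, modEq_add_mul_iff] at h1 h2 h3
      exact ⟨(d % 3).toNat, by omega, by rw [h5]; exact h1, by rw [h5]; exact h2,
        by rw [h5]; exact h3⟩
  · intro d hd d' hd' p hp hp'
    exact eq_of_shift_modEq hm (Finset.mem_range.1 hd) (Finset.mem_range.1 hd') hp.1 hp'.1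

/-- On the class the coordinate sum is 3s + 3dm up to a multiple of 3m, so it equals 3t with t ≡ s
modulo m. Subtracting 2t from every coordinate therefore moves the base point by -2s and only alters
the multiple d of m(1,1,1). -/
theorem reflect_tripleClass {m : ℕ} {i j k s : ℤ} (hs : i + j + k = 3 * s) {p : ℤ × ℤ × ℤ}
    (hp : p ∈ tripleClass m i j k) : ∃ t : ℤ, p.1 + p.2.1 + p.2.2 = 3 * t ∧
      (p.1 - 2 * t, p.2.1 - 2 * t, p.2.2 - 2 * t) ∈
        tripleClass m (i - 2 * s) (j - 2 * s) (k - 2 * s) := by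
  obtain ⟨x, y, z⟩ := p
  obtain ⟨d, h1, h2, h3⟩ := hp
  obtain ⟨u, hu⟩ := Int.modEq_iff_dvd.1 h1
  obtain ⟨v, hv⟩ := Int.modEq_iff_dvd.1 h2
  obtain ⟨w, hw⟩ := Int.modEq_iff_dvd.1 h3
  push_cast at hu hv hw
  -- With x = i + dm - 3mu and likewise for y and z, a third of the coordinate sum is the first
  -- witness; the second collects the coefficient of m in x - 2t, apart from the multiple of 3m.
  refine ⟨s + d * m - m * (u + v + w), ?_, d - 2 * d + 2 * (u + v + w), ?_, ?_, ?_⟩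
  · dsimp only
    linear_combination hs - hu - hv - hw
  all_goals
    refine Int.modEq_iff_dvd.2 ?_
    push_cast
  · exact ⟨u, by linear_combination hu⟩
  · exact ⟨v, by linear_combination hv⟩
  · exact ⟨w, by linear_combination hw⟩

/-- The reflection in `(1, 1, 1)`. -/
theorem sum_theta_triple_reflect (m : ℕ) (hm : m ≠ 0) (i j k s : ℤ) (hs : i + j + k = 3 * s) :
    ∑ d ∈ Finset.range 3, theta (3 * m) (i + d * m) *
      (theta (3 * m) (j + d * m) * theta (3 * m) (k + d * m)) =
    ∑ d ∈ Finset.range 3, theta (3 * m) (i - 2 * s + d * m) *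
      (theta (3 * m) (j - 2 * s + d * m) * theta (3 * m) (k - 2 * s + d * m)) := by
  rw [sum_theta_triple m hm, sum_theta_triple m hm]
  have hs' : i - 2 * s + (j - 2 * s) + (k - 2 * s) = 3 * -s := by linear_combination hs
  -- The integer division is exact on the two classes involved; elsewhere the value of the map is
  -- irrelevant.
  let f : ℤ × ℤ × ℤ → ℤ × ℤ × ℤ := fun p =>
    (p.1 - 2 * ((p.1 + p.2.1 + p.2.2) / 3), p.2.1 - 2 * ((p.1 + p.2.1 + p.2.2) / 3),
      p.2.2 - 2 * ((p.1 + p.2.1 + p.2.2) / 3))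
  have hval : ∀ p : ℤ × ℤ × ℤ, ∀ t, p.1 + p.2.1 + p.2.2 = 3 * t →
      f p = (p.1 - 2 * t, p.2.1 - 2 * t, p.2.2 - 2 * t) := by
    intro p t ht
    have : (p.1 + p.2.1 + p.2.2) / 3 = t := by omega
    simp only [f, this]
  have hinv : ∀ p : ℤ × ℤ × ℤ, ∀ t, p.1 + p.2.1 + p.2.2 = 3 * t → f (f p) = p := by
    intro p t ht
    rw [hval p t ht, hval _ (-t) (by dsimp only; linear_combination ht)]
    ext <;> dsimp only <;> ring
  refine genSeries_congr f f ?_ ?_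
  · intro p hp
    obtain ⟨t, ht, hmem⟩ := reflect_tripleClass hs hp
    refine ⟨by rw [hval p t ht]; exact hmem, ?_, hinv p t ht⟩
    rw [hval p t ht]
    zify
    simp only [sq_abs]
    -- The squared norm changes by -4t(x + y + z) + 12t², which vanishes when the coordinate sum is
    -- 3t.
    linear_combination (-4 * t) * ht
  · intro p hp
    obtain ⟨t, ht, hmem⟩ := reflect_tripleClass hs' hp
    refine ⟨?_, hinv p t ht⟩
    rw [hval p t ht]
    have e : ∀ z : ℤ, z - 2 * s - 2 * -s = z := fun z => by ring
    rwa [e, e, e] at hmem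

/-- The union of the residue classes of `v + d m (1, 1, 2, 2)` modulo `5 m`. -/
def quadrupleClass (m : ℕ) (i j k l : ℤ) : Set (ℤ × ℤ × ℤ × ℤ) :=
  {p | ∃ d : ℤ, p.1 ≡ i + d * m [ZMOD (5 * m : ℕ)] ∧ p.2.1 ≡ j + d * m [ZMOD (5 * m : ℕ)] ∧
    p.2.2.1 ≡ k + 2 * d * m [ZMOD (5 * m : ℕ)] ∧ p.2.2.2 ≡ l + 2 * d * m [ZMOD (5 * m : ℕ)]}

theorem sum_theta_quadruple (m : ℕ) (hm : m ≠ 0) (i j k l : ℤ) :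
    ∑ d ∈ Finset.range 5, theta (5 * m) (i + d * m) * (theta (5 * m) (j + d * m) *
      (theta (5 * m) (k + 2 * d * m) * theta (5 * m) (l + 2 * d * m))) =
    genSeries (fun p : ℤ × ℤ × ℤ × ℤ =>
      p.1.natAbs ^ 2 + (p.2.1.natAbs ^ 2 + (p.2.2.1.natAbs ^ 2 + p.2.2.2.natAbs ^ 2)))
      (quadrupleClass m i j k l) := by
  have hf := finite_weight_add finite_natAbs_sq finite_natAbs_sq
  have hf' := finite_weight_add finite_natAbs_sq hf
  simp only [theta_eq_genSeries]
  simp only [genSeries_mul _ _ _ _ finite_natAbs_sq finite_natAbs_sq,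
    genSeries_mul _ _ _ _ finite_natAbs_sq hf, genSeries_mul _ _ _ _ finite_natAbs_sq hf']
  rw [sum_genSeries _ (finite_weight_add finite_natAbs_sq hf')]
  · congr 1
    ext ⟨x, y, z, w⟩
    simp only [Set.mem_ofPred_eq, Set.mem_prod, residue, quadrupleClass, Finset.mem_range]
    constructor
    · rintro ⟨d, _, h1, h2, h3, h4⟩
      exact ⟨d, h1, h2, h3, h4⟩
    · rintro ⟨d, h1, h2, h3, h4⟩
      have h5 := Int.emod_add_mul_ediv d 5
      have h6 : ((d % 5).toNat : ℤ) = d % 5 := Int.toNat_of_nonneg (by omega)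
      have key : ∀ t : ℤ, t + d * m = t + (d % 5) * m + (d / 5) * (5 * m : ℕ) := by
        intro t
        push_cast
        linear_combination (-(m : ℤ)) * h5
      have key' : ∀ t : ℤ, t + 2 * d * m =
          t + (2 * (d % 5)) * m + (2 * (d / 5)) * (5 * m : ℕ) := by
        intro t
        push_cast
        linear_combination (-2 * (m : ℤ)) * h5
      rw [key, modEq_add_mul_iff] at h1 h2
      rw [key', modEq_add_mul_iff] at h3 h4
      exact ⟨(d % 5).toNat, by omega, by rw [h6]; exact h1, by rw [h6]; exact h2,
        by rw [h6]; exact h3, by rw [h6]; exact h4⟩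
  · intro d hd d' hd' p hp hp'
    exact eq_of_shift_modEq hm (Finset.mem_range.1 hd) (Finset.mem_range.1 hd') hp.1 hp'.1

/-- The vector v = (1,1,2,2) has squared length 10, so the reflection is p ↦ p - tv with ⟨p,v⟩ = 5t.
On the class ⟨p,v⟩ is 5s + 10dm modulo 5m; hence t is an integer congruent to s modulo m, and the
image again has the form base point plus a multiple of mv. -/
theorem reflect_quadrupleClass {m : ℕ} {i j k l s : ℤ} (hs : i + j + 2 * k + 2 * l = 5 * s)
    {p : ℤ × ℤ × ℤ × ℤ} (hp : p ∈ quadrupleClass m i j k l) :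
    ∃ t : ℤ, p.1 + p.2.1 + 2 * p.2.2.1 + 2 * p.2.2.2 = 5 * t ∧
      (p.1 - t, p.2.1 - t, p.2.2.1 - 2 * t, p.2.2.2 - 2 * t) ∈
        quadrupleClass m (i - s) (j - s) (k - 2 * s) (l - 2 * s) := by
  obtain ⟨x, y, z, w⟩ := p
  obtain ⟨d, h1, h2, h3, h4⟩ := hp
  obtain ⟨a, ha⟩ := Int.modEq_iff_dvd.1 h1
  obtain ⟨b, hb⟩ := Int.modEq_iff_dvd.1 h2
  obtain ⟨c, hc⟩ := Int.modEq_iff_dvd.1 h3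
  obtain ⟨e, he⟩ := Int.modEq_iff_dvd.1 h4
  push_cast at ha hb hc he
  refine ⟨s + 2 * d * m - m * (a + b + 2 * c + 2 * e), ?_,
    d - 2 * d + (a + b + 2 * c + 2 * e), ?_, ?_, ?_, ?_⟩
  · dsimp only
    linear_combination hs - ha - hb - 2 * hc - 2 * he
  all_goals
    refine Int.modEq_iff_dvd.2 ?_
    push_cast
  · exact ⟨a, by linear_combination ha⟩
  · exact ⟨b, by linear_combination hb⟩
  · exact ⟨c, by linear_combination hc⟩
  · exact ⟨e, by linear_combination he⟩

/-- The reflection in `(1, 1, 2, 2)`. -/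
theorem sum_theta_quadruple_reflect (m : ℕ) (hm : m ≠ 0) (i j k l s : ℤ)
    (hs : i + j + 2 * k + 2 * l = 5 * s) :
    ∑ d ∈ Finset.range 5, theta (5 * m) (i + d * m) * (theta (5 * m) (j + d * m) *
      (theta (5 * m) (k + 2 * d * m) * theta (5 * m) (l + 2 * d * m))) =
    ∑ d ∈ Finset.range 5, theta (5 * m) (i - s + d * m) * (theta (5 * m) (j - s + d * m) *
      (theta (5 * m) (k - 2 * s + 2 * d * m) * theta (5 * m) (l - 2 * s + 2 * d * m))) := by
  rw [sum_theta_quadruple m hm, sum_theta_quadruple m hm]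
  have hs' : i - s + (j - s) + 2 * (k - 2 * s) + 2 * (l - 2 * s) = 5 * -s := by
    linear_combination hs
  let g : ℤ × ℤ × ℤ × ℤ → ℤ := fun p => (p.1 + p.2.1 + 2 * p.2.2.1 + 2 * p.2.2.2) / 5
  let f : ℤ × ℤ × ℤ × ℤ → ℤ × ℤ × ℤ × ℤ := fun p =>
    (p.1 - g p, p.2.1 - g p, p.2.2.1 - 2 * g p, p.2.2.2 - 2 * g p)
  have hval : ∀ p : ℤ × ℤ × ℤ × ℤ, ∀ t, p.1 + p.2.1 + 2 * p.2.2.1 + 2 * p.2.2.2 = 5 * t →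
      f p = (p.1 - t, p.2.1 - t, p.2.2.1 - 2 * t, p.2.2.2 - 2 * t) := by
    intro p t ht
    have : g p = t := by simp only [g]; omega
    simp only [f, this]
  have hinv : ∀ p : ℤ × ℤ × ℤ × ℤ, ∀ t, p.1 + p.2.1 + 2 * p.2.2.1 + 2 * p.2.2.2 = 5 * t →
      f (f p) = p := by
    intro p t ht
    rw [hval p t ht, hval _ (-t) (by dsimp only; linear_combination ht)]
    ext <;> dsimp only <;> ring
  refine genSeries_congr f f ?_ ?_
  · intro p hp
    obtain ⟨t, ht, hmem⟩ := reflect_quadrupleClass hs hp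
    refine ⟨by rw [hval p t ht]; exact hmem, ?_, hinv p t ht⟩
    rw [hval p t ht]
    zify
    simp only [sq_abs]
    -- The squared norm changes by -2t⟨p,v⟩ + 10t² = 0.
    linear_combination (-2 * t) * ht
  · intro p hp
    obtain ⟨t, ht, hmem⟩ := reflect_quadrupleClass hs' hp
    refine ⟨?_, hinv p t ht⟩
    rw [hval p t ht]
    have e : ∀ z : ℤ, z - s - -s = z := fun z => by ring
    have e' : ∀ z : ℤ, z - 2 * s - 2 * -s = z := fun z => by ring
    rwa [e, e, e', e'] at hmem

end

/-! ### Formal sums of monomials over ℤ/2 and the verification of certificates. -/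

noncomputable section

theorem add_self (x : L) : x + x = 0 := by
  ext n
  simp only [HahnSeries.coeff_add, HahnSeries.coeff_zero]
  exact (by decide : ∀ z : ZMod 2, z + z = 0) _

theorem thetaL_congr {l : ℕ} {i j : ℤ} (h : i ≡ j [ZMOD l]) : thetaL l i = thetaL l j := by
  rw [thetaL, thetaL, theta_congr h]

theorem thetaL_neg (l : ℕ) (i : ℤ) : thetaL l (-i) = thetaL l i := by
  rw [thetaL, thetaL, theta_neg]

theorem thetaL_zero (l : ℕ) : thetaL l 0 = 1 := by
  rw [thetaL, theta_zero, PowerSeries.coe_one]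

/-! ### Formal polynomials in the theta series -/

end

/-- A formal sum of monomials: the list of indices `[i₁, …, iₙ]` stands for `[i₁] ⋯ [iₙ]`. -/
abbrev Poly : Type := List (List ℕ)

/-- Multiplication of all indices by `k`. -/
def Poly.scale (k : ℕ) (p : Poly) : Poly := p.map fun m => m.map fun i => k * i

/-- The decimal digits of `n`, at most `fuel` of them. -/
def digs : ℕ → ℕ → List ℕ
  | 0, _ => []
  | fuel + 1, n => if n = 0 then [] else n % 10 :: digs fuel (n / 10)

/-- A sum of monomials whose indices are written as decimal digits. -/
def lit (p : List ℕ) : Poly := p.map (digs 60)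

/-- The prime standing for the index `i` in the code of a monomial. -/
def indexPrime (l i : ℕ) : ℕ :=
  [1, 2, 3, 5, 7, 11, 13, 17].getD (min (i % l) (l - i % l)) 0

/-- A code of a monomial. -/
def code (l : ℕ) : List ℕ → ℕ
  | [] => 1
  | i :: m => indexPrime l i * code l m

/-- Insertion of `x` into the merge of `xs` (given through `f`) with a second list. -/
def mergeIns (x : ℕ) (xs : List ℕ) (f : List ℕ → List ℕ) : List ℕ → List ℕ
  | [] => x :: xs
  | y :: ys =>
    if x = y then f ys else if x < y then x :: f (y :: ys) else y :: mergeIns x xs f ys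

/-- The merge of two ordered lists, where pairs of equal elements are dropped. -/
def xmerge : List ℕ → List ℕ → List ℕ
  | [] => fun ys => ys
  | x :: xs => mergeIns x xs (xmerge xs)

/-- One round of merging neighbours. -/
def mergePairs : List (List ℕ) → List (List ℕ)
  | x :: y :: zs => xmerge x y :: mergePairs zs
  | zs => zs

/-- The merge of a list of ordered lists. -/
def mergeAll : ℕ → List (List ℕ) → List ℕ
  | 0, zs => zs.foldr xmerge []
  | n + 1, zs => mergeAll n (mergePairs zs)

/-- The ordered list of the codes of the monomials of `p`. -/
def codes (l : ℕ) (p : Poly) : List ℕ := mergeAll 20 (p.map fun m => [code l m])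

/-- Multiplication of a sum of codes by a formal sum. -/
def mulCodes (l : ℕ) (p : Poly) (xs : List ℕ) : List ℕ :=
  mergeAll 20 (p.map fun m => xs.map fun x => code l m * x)

/-- The codes of a product of formal sums. -/
def prodCodes (l : ℕ) : List Poly → List ℕ
  | [] => [1]
  | p :: ps => mulCodes l p (prodCodes l ps)

/-- The codes of a sum of products of formal sums. -/
def sumCodes (l : ℕ) (t : List (List Poly)) : List ℕ := mergeAll 20 (t.map (prodCodes l))

noncomputable section

/-- The value of a monomial at the parameter `r`. -/
def evalMon (l : ℕ) (r : ℤ) (m : List ℕ) : L := (m.map fun i : ℕ => thetaL l (i * r)).prod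

/-- The value of a formal sum at the parameter `r`. -/
def eval (l : ℕ) (r : ℤ) (p : Poly) : L := (p.map (evalMon l r)).sum

/-- The value of a sum of products. -/
def evalSum (l : ℕ) (r : ℤ) (t : List (List Poly)) : L :=
  (t.map fun ps => (ps.map (eval l r)).prod).sum

/-- Scaling indices amounts to replacing r by kr, so a relation valid at all parameters prime to l
yields a new relation for every k prime to l. -/
theorem eval_scale (l : ℕ) (r : ℤ) (k : ℕ) (p : Poly) :
    eval l r (p.scale k) = eval l (k * r) p := by
  simp only [eval, Poly.scale, List.map_map, evalMon, Function.comp_def]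
  congr 2
  ext m
  congr 3
  ext i
  rw [Nat.cast_mul]
  congr 2
  ring

theorem eval_mem (l : ℕ) (r : ℤ) (p : Poly) : eval l r p ∈ S l := by
  refine list_sum_mem fun x hx => ?_
  obtain ⟨m, _, rfl⟩ := List.mem_map.1 hx
  refine list_prod_mem fun y hy => ?_
  obtain ⟨i, _, rfl⟩ := List.mem_map.1 hy
  exact Algebra.subset_adjoin ⟨_, rfl⟩

/-- The formal sum `p` vanishes at all parameters prime to `l`. -/
def Vanishes (l : ℕ) (p : Poly) : Prop := ∀ r : ℤ, IsCoprime r l → eval l r p = 0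

/-- The index encoded by a prime. -/
def primeIndex (p : ℕ) : ℕ :=
  if p = 2 then 1 else if p = 3 then 2 else if p = 5 then 3 else if p = 7 then 4
  else if p = 11 then 5 else if p = 13 then 6 else if p = 17 then 7 else 0

/-- The value of a code. -/
def codeVal (l : ℕ) (r : ℤ) (n : ℕ) : L :=
  if n = 0 then 0 else (n.primeFactorsList.map fun p => thetaL l (primeIndex p * r)).prod

/-- Unique factorization: the prime factors of a product are those of the factors, up to order. The
value 0 assigned to the code 0 makes multiplicativity unconditional. -/
theorem codeVal_mul (l : ℕ) (r : ℤ) (m n : ℕ) :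
    codeVal l r (m * n) = codeVal l r m * codeVal l r n := by
  by_cases hm : m = 0
  · simp [codeVal, hm]
  by_cases hn : n = 0
  · simp [codeVal, hn]
  rw [codeVal, codeVal, codeVal, if_neg hm, if_neg hn, if_neg (mul_ne_zero hm hn),
    ((Nat.perm_primeFactorsList_mul hm hn).map _).prod_eq, List.map_append, List.prod_append]

theorem codeVal_one (l : ℕ) (r : ℤ) : codeVal l r 1 = 1 := by simp [codeVal]

theorem codeVal_prime (l : ℕ) (r : ℤ) {p : ℕ} (hp : p.Prime) :
    codeVal l r p = thetaL l (primeIndex p * r) := by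
  simp [codeVal, hp.ne_zero, Nat.primeFactorsList_prime hp]

/-- Periodicity and [-j] = [j] fold the index into the range from 0 to l/2, hence to at most 7 for l
≤ 15. The folded index 0 has code 1 because [0] = 1. -/
theorem codeVal_indexPrime {l : ℕ} (hl : Odd l) (hl' : l ≤ 15) (r : ℤ) (i : ℕ) :
    codeVal l r (indexPrime l i) = thetaL l (i * r) := by
  have hpos : 0 < l := hl.pos
  have h : thetaL l (i * r) = thetaL l ((min (i % l) (l - i % l) : ℕ) * r) := by
    have h1 : (i : ℤ) ≡ (i % l : ℕ) [ZMOD l] := by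
      rw [Int.natCast_mod]
      exact (Int.mod_modEq _ _).symm
    rcases min_choice (i % l) (l - i % l) with h2 | h2
    · rw [h2]
      exact thetaL_congr (h1.mul_right r)
    · rw [h2, ← thetaL_neg]
      refine thetaL_congr ?_
      rw [← neg_mul]
      refine Int.ModEq.mul_right r ?_
      rw [Nat.cast_sub (Nat.mod_lt i hpos).le]
      refine Int.ModEq.trans (h1.neg) (Int.modEq_iff_dvd.2 ⟨1, by ring⟩)
  rw [h, indexPrime]
  have hlt : min (i % l) (l - i % l) < 8 := by
    have := Nat.mod_lt i hpos
    omega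
  generalize min (i % l) (l - i % l) = m at hlt
  interval_cases m
  · simp [codeVal_one, thetaL_zero]
  all_goals
    rw [List.getD_eq_getElem _ _ (by decide)]
    exact codeVal_prime l r (by norm_num)

theorem codeVal_code {l : ℕ} (hl : Odd l) (hl' : l ≤ 15) (r : ℤ) (m : List ℕ) :
    codeVal l r (code l m) = evalMon l r m := by
  induction m with
  | nil => simp [code, codeVal_one, evalMon]
  | cons i m ih =>
    rw [code, codeVal_mul, codeVal_indexPrime hl hl', ih, evalMon, evalMon, List.map_cons,
      List.prod_cons]

/-- The value of a sum of codes. -/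
def codesVal (l : ℕ) (r : ℤ) (xs : List ℕ) : L := (xs.map (codeVal l r)).sum

@[simp]
theorem codesVal_nil (l : ℕ) (r : ℤ) : codesVal l r [] = 0 := rfl

@[simp]
theorem codesVal_cons (l : ℕ) (r : ℤ) (x : ℕ) (xs : List ℕ) :
    codesVal l r (x :: xs) = codeVal l r x + codesVal l r xs := by
  simp [codesVal]

/-- Dropping two equal codes is sound because x + x = 0. No sortedness is required: order only
affects whether all cancellations are found. -/
theorem codesVal_mergeIns (l : ℕ) (r : ℤ) (x : ℕ) (xs : List ℕ) (f : List ℕ → List ℕ)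
    (hf : ∀ ys, codesVal l r (f ys) = codesVal l r xs + codesVal l r ys) (ys : List ℕ) :
    codesVal l r (mergeIns x xs f ys) = codesVal l r (x :: xs) + codesVal l r ys := by
  induction ys with
  | nil => simp [mergeIns]
  | cons y ys ih =>
    rw [mergeIns]
    split_ifs with h1 h2
    · subst h1
      rw [hf, codesVal_cons, codesVal_cons]
      linear_combination -add_self (codeVal l r x)
    · rw [codesVal_cons, hf, codesVal_cons l r x]
      ring
    · rw [codesVal_cons, ih, codesVal_cons, codesVal_cons]
      ring

theorem codesVal_xmerge (l : ℕ) (r : ℤ) (xs ys : List ℕ) :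
    codesVal l r (xmerge xs ys) = codesVal l r xs + codesVal l r ys := by
  induction xs generalizing ys with
  | nil => simp [xmerge]
  | cons x xs ih => exact codesVal_mergeIns l r x xs _ ih ys

theorem sum_codesVal_mergePairs (l : ℕ) (r : ℤ) (zs : List (List ℕ)) :
    ((mergePairs zs).map (codesVal l r)).sum = (zs.map (codesVal l r)).sum := by
  induction zs using mergePairs.induct with
  | case1 x y zs ih =>
    rw [mergePairs, List.map_cons, List.sum_cons, ih, codesVal_xmerge]
    simp [add_assoc]
  | case2 zs h =>
    rw [mergePairs]
    exact h

/-- The number of rounds is immaterial for the value, as the lists left over after the last round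
are folded together; merging neighbours only keeps the computation balanced. -/
theorem codesVal_mergeAll (l : ℕ) (r : ℤ) (n : ℕ) (zs : List (List ℕ)) :
    codesVal l r (mergeAll n zs) = (zs.map (codesVal l r)).sum := by
  induction n generalizing zs with
  | zero =>
    rw [mergeAll]
    induction zs with
    | nil => rfl
    | cons x xs ih => rw [List.foldr_cons, codesVal_xmerge, ih, List.map_cons, List.sum_cons]
  | succ n ih => rw [mergeAll, ih, sum_codesVal_mergePairs]

theorem codesVal_map_mul (l : ℕ) (r : ℤ) (c : ℕ) (xs : List ℕ) :
    codesVal l r (xs.map fun x => c * x) = codeVal l r c * codesVal l r xs := by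
  induction xs with
  | nil => simp
  | cons x xs ih => rw [List.map_cons, codesVal_cons, ih, codesVal_cons, codeVal_mul, mul_add]

theorem codesVal_codes {l : ℕ} (hl : Odd l) (hl' : l ≤ 15) (r : ℤ) (p : Poly) :
    codesVal l r (codes l p) = eval l r p := by
  rw [codes, codesVal_mergeAll, List.map_map, eval]
  congr 2
  ext m
  simp [codeVal_code hl hl']

theorem codesVal_mulCodes {l : ℕ} (hl : Odd l) (hl' : l ≤ 15) (r : ℤ) (p : Poly) (xs : List ℕ) :
    codesVal l r (mulCodes l p xs) = eval l r p * codesVal l r xs := by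
  rw [mulCodes, codesVal_mergeAll, List.map_map, eval, ← List.sum_map_mul_right]
  congr 2
  ext m
  simp [codesVal_map_mul, codeVal_code hl hl']

theorem codesVal_prodCodes {l : ℕ} (hl : Odd l) (hl' : l ≤ 15) (r : ℤ) (ps : List Poly) :
    codesVal l r (prodCodes l ps) = (ps.map (eval l r)).prod := by
  induction ps with
  | nil => simp [prodCodes, codeVal_one]
  | cons p ps ih => rw [prodCodes, codesVal_mulCodes hl hl', ih, List.map_cons, List.prod_cons]

theorem codesVal_sumCodes {l : ℕ} (hl : Odd l) (hl' : l ≤ 15) (r : ℤ) (t : List (List Poly)) :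
    codesVal l r (sumCodes l t) = evalSum l r t := by
  rw [sumCodes, codesVal_mergeAll, List.map_map, evalSum]
  congr 2
  ext ps
  simp [codesVal_prodCodes hl hl']

/-- A formal sum that vanishes at all parameters prime to `l`. -/
structure Relation (l : ℕ) where
  /-- The formal sum. -/
  poly : Poly
  /-- Its vanishing. -/
  vanishes : Vanishes l poly

/-- A multiple of a relation. -/
structure Multiple (l : ℕ) where
  /-- The relation. -/
  rel : Relation l
  /-- The factor by which the parameter is scaled. -/
  scale : ℕ
  /-- The multiplier. -/
  mult : List ℕ

/-- The sum of `t` and of the given multiples of relations is formally zero. -/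
def check (l : ℕ) (t : List (List Poly)) (c : List (Multiple l)) : Bool :=
  (c.all fun e => Nat.gcd e.scale l == 1) && decide (xmerge (sumCodes l t) (mergeAll 20 (c.map fun e =>
    mulCodes l (lit e.mult) (codes l (e.rel.poly.scale e.scale)))) = [])

/-- Soundness of certificates. Every listed multiple is zero at r, since its relation vanishes at kr
for the scale k prime to l; as the codes of the target and of all the multiples cancel completely,
the target is zero too. -/
theorem evalSum_eq_zero {l : ℕ} (hl : Odd l) (hl' : l ≤ 15) (t : List (List Poly))
    (c : List (Multiple l)) (h : check l t c = true) (r : ℤ) (hr : IsCoprime r l) :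
    evalSum l r t = 0 := by
  rw [check, Bool.and_eq_true, List.all_eq_true] at h
  have h1 := congrArg (codesVal l r) (of_decide_eq_true h.2)
  rw [codesVal_xmerge, codesVal_sumCodes hl hl', codesVal_mergeAll, List.map_map,
    List.sum_eq_zero (l := List.map _ c), add_zero] at h1
  · exact h1
  · intro x hx
    obtain ⟨e, he, rfl⟩ := List.mem_map.1 hx
    have hk : IsCoprime (e.scale : ℤ) l :=
      Nat.isCoprime_iff_coprime.2 (beq_iff_eq.1 (h.1 e he))
    rw [Function.comp_apply, codesVal_mulCodes hl hl', codesVal_codes hl hl', eval_scale,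
      e.rel.vanishes _ (hk.mul_left hr), mul_zero]

end

/-! ### Series supported in one residue class, and projections of quotients. -/

noncomputable section

instance charP_two : CharP L 2 :=
  CharTwo.of_one_ne_zero_of_two_eq_zero one_ne_zero (by rw [← one_add_one_eq_two, add_self])

/-! ### Homogeneous series and projections -/

/-- All exponents of `F` are `≡ j (mod q)`. -/
def Homog (q : ℕ) (j : ℤ) (F : L) : Prop := ∀ n, F.coeff n ≠ 0 → n ≡ j [ZMOD q]

namespace Homog

variable {q : ℕ} {i j : ℤ} {F G : L}

theorem congr (hF : Homog q i F) (h : i ≡ j [ZMOD q]) : Homog q j F :=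
  fun n hn => (hF n hn).trans h

theorem mono {q' : ℕ} (hF : Homog q j F) (h : q' ∣ q) : Homog q' j F :=
  fun n hn => (hF n hn).of_dvd (by exact_mod_cast h)

theorem add (hF : Homog q j F) (hG : Homog q j G) : Homog q j (F + G) := by
  intro n hn
  by_cases h : F.coeff n = 0
  · refine hG n fun h' => hn ?_
    rw [HahnSeries.coeff_add, h, h', add_zero]
  · exact hF n h

theorem mul (hF : Homog q i F) (hG : Homog q j G) : Homog q (i + j) (F * G) := by
  intro n hn
  rw [HahnSeries.coeff_mul] at hn
  obtain ⟨p, hp, hp'⟩ := Finset.exists_ne_zero_of_sum_ne_zero hn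
  rw [← (Finset.mem_antidiagonal.1 hp).2.2]
  exact (hF _ (left_ne_zero_of_mul hp')).add (hG _ (right_ne_zero_of_mul hp'))

theorem one : Homog q 0 (1 : L) := by
  intro n hn
  rw [HahnSeries.coeff_one] at hn
  split_ifs at hn with h
  · rw [h]
  · exact absurd rfl hn

theorem pow (hF : Homog q j F) (n : ℕ) : Homog q (n * j) (F ^ n) := by
  induction n with
  | zero => simpa using one
  | succ n ih =>
    rw [pow_succ]
    exact (ih.mul hF).congr (by rw [Nat.cast_succ, add_mul, one_mul])

/-- Squaring in characteristic 2 doubles every exponent, so it doubles the modulus as well as the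
degree. -/
theorem sq (hF : Homog q j F) : Homog (2 * q) (2 * j) (F ^ 2) := by
  intro n hn
  rw [coeff_sq] at hn
  split_ifs at hn with h
  · obtain ⟨m, rfl⟩ := h
    rw [Int.mul_ediv_cancel_left _ two_ne_zero] at hn
    rw [Nat.cast_mul]
    exact (hF m hn).mul_left'
  · exact absurd rfl hn

theorem proj_self (hF : Homog q i F) {k : ℕ} (h : i ≡ k [ZMOD q]) : proj q k F = F := by
  ext n
  rw [proj_coeff]
  split_ifs with h'
  · rfl
  · by_contra hne
    exact h' ((hF n (Ne.symm hne)).trans h)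

theorem proj_eq_zero (hF : Homog q i F) {k : ℕ} (h : ¬ i ≡ k [ZMOD q]) : proj q k F = 0 := by
  ext n
  rw [proj_coeff]
  split_ifs with h'
  · by_contra hne
    exact h ((hF n hne).symm.trans h')
  · rfl

end Homog

theorem homog_proj (q j : ℕ) (F : L) : Homog q j (proj q j F) := by
  intro n hn
  rw [proj_coeff] at hn
  by_contra h
  exact hn (if_neg h)

theorem homog_one (F : L) : Homog 1 0 F := fun n _ => by
  rw [Nat.cast_one]
  exact Int.modEq_one

theorem proj_add (q j : ℕ) (F G : L) : proj q j (F + G) = proj q j F + proj q j G := by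
  ext n
  simp only [proj_coeff, HahnSeries.coeff_add]
  split_ifs <;> simp

theorem proj_proj {q q' : ℕ} (h : q ∣ q') {i j : ℕ} (hij : j ≡ i [ZMOD q]) (F : L) :
    proj q' j (proj q i F) = proj q' j F := by
  ext n
  simp only [proj_coeff]
  by_cases hn : n ≡ j [ZMOD q']
  · rw [if_pos hn, if_pos hn, if_pos ((hn.of_dvd (by exact_mod_cast h)).trans hij)]
  · rw [if_neg hn, if_neg hn]

/-- Multiplication by a series with exponents divisible by q preserves residue classes modulo q, so
the projection is linear over such series. -/
theorem proj_mul_homog {q : ℕ} (j : ℕ) (F : L) {H : L} (hH : Homog q 0 H) :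
    proj q j (F * H) = proj q j F * H := by
  have h1 : F = proj q j F + (F - proj q j F) := by ring
  have h2 : proj q j ((F - proj q j F) * H) = 0 := by
    ext n
    rw [proj_coeff]
    split_ifs with hn
    · rw [HahnSeries.coeff_zero, HahnSeries.coeff_mul]
      refine Finset.sum_eq_zero fun p hp => ?_
      by_contra hne
      have h3 := hH _ (right_ne_zero_of_mul hne)
      have h4 := left_ne_zero_of_mul hne
      have h5 : p.1 ≡ j [ZMOD q] := by
        rw [← (Finset.mem_antidiagonal.1 hp).2.2] at hn
        exact Int.ModEq.trans (by simpa using ((Int.ModEq.refl p.1).add h3).symm) hn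
      rw [HahnSeries.coeff_sub, proj_coeff, if_pos h5, sub_self] at h4
      exact h4 rfl
    · rfl
  conv_lhs => rw [h1, add_mul, proj_add, h2, add_zero]
  exact ((homog_proj q j F).mul hH).proj_self (by rw [add_zero])

/-- This is how quotients are projected: the denominator is first enlarged to a second, fourth or
eighth power, which then passes through the projection. -/
theorem proj_div_homog {q : ℕ} (j : ℕ) (F : L) {H : L} (hH : Homog q 0 H) :
    proj q j (F / H) = proj q j F / H := by
  by_cases h0 : H = 0
  · subst h0
    rw [div_zero, div_zero]
    ext n
    simp [proj_coeff]
  · rw [eq_div_iff h0, ← proj_mul_homog j _ hH, div_mul_cancel₀ _ h0]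

theorem homog_sq (F : L) : Homog 2 0 (F ^ 2) := by
  simpa using (homog_one F).sq

theorem homog_pow_four (F : L) : Homog 4 0 (F ^ 4) := by
  simpa [← pow_mul] using (homog_one F).sq.sq

theorem homog_pow_eight (F : L) : Homog 8 0 (F ^ 8) := by
  simpa [← pow_mul] using (homog_one F).sq.sq.sq

/-- Root extraction: the even part of `F` being `G ^ 2` relates the projections of `F` and `G`. -/
theorem proj_of_even_part {F G : L} (h : proj 2 0 F = G ^ 2) (q j : ℕ) :
    proj (2 * q) (2 * j) F = (proj q j G) ^ 2 := by
  rw [← proj_proj (dvd_mul_right 2 q) (i := 0) (j := 2 * j)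
    ((Int.modEq_zero_iff_dvd).2 (by push_cast; exact dvd_mul_right _ _)), h]
  ext n
  rw [proj_coeff, coeff_sq, coeff_sq]
  by_cases hn : (2 : ℤ) ∣ n
  · obtain ⟨m, rfl⟩ := hn
    rw [if_pos (dvd_mul_right _ _), if_pos (dvd_mul_right _ _),
      Int.mul_ediv_cancel_left _ two_ne_zero, proj_coeff]
    have : 2 * m ≡ (2 * j : ℕ) [ZMOD (2 * q : ℕ)] ↔ m ≡ j [ZMOD q] := by
      push_cast
      exact ⟨fun h => Int.ModEq.mul_left_cancel' two_ne_zero h, fun h => h.mul_left'⟩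
    simp only [this]
  · rw [if_neg hn, if_neg hn, ite_self]

/-! ### Projections of quotients -/

/-- The components modulo `4` of a sum of homogeneous series. -/
theorem proj_four_sum {N₀ N₁ N₂ N₃ : L} (h0 : Homog 4 0 N₀) (h1 : Homog 4 1 N₁)
    (h2 : Homog 4 2 N₂) (h3 : Homog 4 3 N₃) :
    proj 4 1 (N₀ + N₁ + N₂ + N₃) = N₁ ∧ proj 4 3 (N₀ + N₁ + N₂ + N₃) = N₃ := by
  constructor
  · rw [proj_add, proj_add, proj_add, h0.proj_eq_zero (by decide), h1.proj_self (by decide),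
      h2.proj_eq_zero (by decide), h3.proj_eq_zero (by decide)]
    ring
  · rw [proj_add, proj_add, proj_add, h0.proj_eq_zero (by decide), h1.proj_eq_zero (by decide),
      h2.proj_eq_zero (by decide), h3.proj_self (by decide)]
    ring

/-- Write the quotient as yz²a³/a⁴. Here a³ = u³ + u²v + uv² + v³ has terms of degrees 0, 1, 2, 3,
while y and z² split into degrees 0, 1 and 0, 2. Sorting the sixteen products by degree modulo 4
leaves numerators that factor once u is written as at. -/
theorem proj_four_mul_sq_div {a u v t y ε z ζ : L} (ha : a ≠ 0) (hu : Homog 4 0 u)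
    (hv : Homog 4 1 v) (hε : Homog 4 0 ε) (hy : Homog 4 1 (y + ε)) (hζ : Homog 2 0 ζ)
    (hz : Homog 2 1 (z + ζ)) (hav : a = u + v) (ht : a * t = u) :
    proj 4 1 (y * z ^ 2 / a) = (ε + t * y) * (ζ + t * z + z) ^ 2 / a ∧
      proj 4 3 (y * z ^ 2 / a) = (ε + t * y) * (ζ + t * z) ^ 2 / a := by
  have hG : Homog 4 0 (ζ ^ 2) := by simpa using hζ.sq
  have hZ : Homog 4 2 ((z + ζ) ^ 2) := by simpa using hz.sq
  have h4 : a ^ 4 ≠ 0 := pow_ne_zero _ ha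
  -- The four brackets have degrees 0, 1, 2 and 3 modulo 4, in this order.
  have key : y * z ^ 2 / a =
      ((ε * ζ ^ 2 * u ^ 3 + ε * (z + ζ) ^ 2 * u * v ^ 2 + (y + ε) * ζ ^ 2 * v ^ 3 +
          (y + ε) * (z + ζ) ^ 2 * u ^ 2 * v) +
        (ε * ζ ^ 2 * u ^ 2 * v + ε * (z + ζ) ^ 2 * v ^ 3 + (y + ε) * ζ ^ 2 * u ^ 3 +
          (y + ε) * (z + ζ) ^ 2 * u * v ^ 2) +
        (ε * ζ ^ 2 * u * v ^ 2 + ε * (z + ζ) ^ 2 * u ^ 3 + (y + ε) * ζ ^ 2 * u ^ 2 * v +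
          (y + ε) * (z + ζ) ^ 2 * v ^ 3) +
        (ε * ζ ^ 2 * v ^ 3 + ε * (z + ζ) ^ 2 * u ^ 2 * v + (y + ε) * ζ ^ 2 * u * v ^ 2 +
          (y + ε) * (z + ζ) ^ 2 * u ^ 3)) / a ^ 4 := by
    rw [div_eq_div_iff ha h4, hav]
    grind
  have hu0 : ∀ n : ℕ, Homog 4 0 (u ^ n) := fun n => by simpa using hu.pow n
  have hv' : ∀ n : ℕ, Homog 4 n (v ^ n) := fun n => by simpa using hv.pow n
  have hu1 := hu0 1
  have hv1 := hv' 1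
  rw [pow_one] at hu1 hv1
  rw [key, proj_div_homog _ _ (homog_pow_four a), proj_div_homog _ _ (homog_pow_four a),
    (proj_four_sum _ _ _ _).1, (proj_four_sum _ _ _ _).2]
  · have hv3 : v = a + u := by rw [hav]; grind
    subst hv3
    constructor
    · rw [div_eq_div_iff h4 ha, ← ht]
      grind
    · rw [div_eq_div_iff h4 ha, ← ht]
      grind
  all_goals
    refine Homog.add (Homog.add (Homog.add ?_ ?_) ?_) ?_
    all_goals
      refine Homog.congr (by
        with_reducible repeat first
          | exact hG | exact hZ | exact hε | exact hy | exact hu0 _ | exact hv' _ | exact hu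
          | exact hv | apply Homog.mul) (by decide)

/-- Refinement of a projection modulo `8`. -/
theorem proj_eight_of_homog {a u v X : L} {i : ℤ} (ha : a ≠ 0) (hu : Homog 8 0 (u ^ 4))
    (hv : Homog 8 4 (v ^ 4)) (hav : a = u + v) (hX : Homog 8 i (a ^ 4 * X)) {j : ℕ} :
    (i ≡ j [ZMOD 8] → proj 8 j X = (u / a) ^ 4 * X) ∧
      (i + 4 ≡ j [ZMOD 8] → proj 8 j X = (v / a) ^ 4 * X) := by
  have h8 : a ^ 8 ≠ 0 := pow_ne_zero _ ha
  -- By Frobenius a⁴ = u⁴ + v⁴, with summands of degrees 0 and 4 modulo 8, so a⁴X · a⁴ splits into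
  -- two homogeneous pieces; division by a⁸ does not move classes.
  have key : X = (a ^ 4 * X * u ^ 4 + a ^ 4 * X * v ^ 4) / a ^ 8 := by
    rw [eq_div_iff h8, hav]
    grind
  have h1 := hX.mul hu
  have h2 := hX.mul hv
  rw [add_zero] at h1
  constructor
  · intro h
    have h' : ¬ i + 4 ≡ j [ZMOD 8] := fun h'' => by
      have := Int.modEq_iff_dvd.1 (h.trans h''.symm)
      omega
    conv_lhs => rw [key]
    rw [proj_div_homog j _ (homog_pow_eight a), proj_add, h1.proj_self h, h2.proj_eq_zero h']
    field_simp
    ring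
  · intro h
    have h' : ¬ i ≡ j [ZMOD 8] := fun h'' => by
      have := Int.modEq_iff_dvd.1 (h''.trans h.symm)
      omega
    conv_lhs => rw [key]
    rw [proj_div_homog j _ (homog_pow_eight a), proj_add, h1.proj_eq_zero h', h2.proj_self h]
    field_simp
    ring

end

/-! ### Even parts of products of theta series and the components of 1/[8s]. -/

noncomputable section

/-! ### Parity of exponents of theta series -/

theorem thetaL_ne_zero {l : ℕ} (hl : Odd l) (i : ℤ) : thetaL l i ≠ 0 := fun h =>
  theta_ne_zero hl i (HahnSeries.ofPowerSeries_injective (Γ := ℤ)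
    (by rw [map_zero (HahnSeries.ofPowerSeries ℤ (ZMod 2))]; exact h))

theorem even_part_thetaL_mul {l : ℕ} (hl : Odd l) (i j : ℤ) :
    proj 2 0 (thetaL l (i + j) * thetaL l (i - j)) = (thetaL l i * thetaL l j) ^ 2 := by
  ext n
  simp only [thetaL, ← PowerSeries.coe_mul]
  rw [proj_coeff, coeff_sq]
  by_cases hn : (2 : ℤ) ∣ n
  · obtain ⟨m, rfl⟩ := hn
    have h2 : 2 * m ≡ (0 : ℕ) [ZMOD (2 : ℕ)] := Int.modEq_zero_iff_dvd.2 (dvd_mul_right _ _)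
    rw [if_pos h2, if_pos (dvd_mul_right _ _),
      Int.mul_ediv_cancel_left _ two_ne_zero, PowerSeries.coeff_coe, PowerSeries.coeff_coe]
    by_cases hm : m < 0
    · rw [if_pos hm, if_pos (by omega)]
    · rw [if_neg hm, if_neg (by omega), Int.natAbs_mul]
      exact coeff_theta_mul_theta hl i j _
  · rw [if_neg hn, if_neg fun h => hn ((Int.modEq_zero_iff_dvd).1 (by simpa using h))]

/-- The rotation with i = j, where the second factor is [0] = 1. -/
theorem even_part_thetaL {l : ℕ} (hl : Odd l) (i : ℤ) :
    proj 2 0 (thetaL l (2 * i)) = thetaL l i ^ 4 := by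
  have h := even_part_thetaL_mul hl i i
  rw [sub_self, thetaL_zero, mul_one, ← two_mul] at h
  rw [h]
  ring

/-- Adding [i]⁴ removes the even part of [2i]. The remaining exponents are squares of odd numbers,
and these are 1 modulo 8. -/
theorem homog_thetaL_add {l : ℕ} (hl : Odd l) (i : ℤ) :
    Homog 8 1 (thetaL l (2 * i) + thetaL l i ^ 4) := by
  intro n hn
  rw [← even_part_thetaL hl i, HahnSeries.coeff_add, proj_coeff] at hn
  split_ifs at hn with h
  · rw [(by decide : ∀ z : ZMod 2, z + z = 0)] at hn
    exact absurd rfl hn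
  · rw [add_zero, thetaL, PowerSeries.coeff_coe] at hn
    split_ifs at hn with h'
    · exact absurd rfl hn
    · obtain ⟨m, hm⟩ := exists_sq_of_coeff_theta_ne_zero hn
      have hn' : n = m ^ 2 := by omega
      subst hn'
      have hm2 : ¬ 2 ∣ m := fun h2 => h
        ((Int.modEq_zero_iff_dvd).2 (dvd_pow h2 two_ne_zero))
      have h8 : m % 8 = 1 ∨ m % 8 = 3 ∨ m % 8 = 5 ∨ m % 8 = 7 := by omega
      rw [Nat.cast_ofNat]
      have key : ∀ z : ℤ, m ≡ z [ZMOD 8] → z ^ 2 ≡ 1 [ZMOD 8] → m ^ 2 ≡ 1 [ZMOD 8] :=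
        fun z hz hz' => (hz.pow 2).trans hz'
      rcases h8 with h8 | h8 | h8 | h8
      · exact key 1 h8 (by decide)
      · exact key 3 h8 (by decide)
      · exact key 5 h8 (by decide)
      · exact key 7 h8 (by decide)

/-- Here e and f are the even parts of x and y; only even times even and odd times odd contribute.
-/
theorem even_part_mul {x y e f : L} (he : Homog 2 0 e) (hx : Homog 2 1 (x + e))
    (hf : Homog 2 0 f) (hy : Homog 2 1 (y + f)) :
    proj 2 0 (x * y) = e * f + (x + e) * (y + f) := by
  have key : x * y = (e * f + (x + e) * (y + f)) + (e * (y + f) + f * (x + e)) := by grind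
  rw [key, proj_add, ((he.mul hf).add ((hx.mul hy).congr (by decide))).proj_self (by decide),
    ((he.mul hy).congr (by decide) |>.add ((hf.mul hx).congr (j := 0 + 1)
      (by decide))).proj_eq_zero (by decide), add_zero]

/-- The even part of a product of two series, in terms of even parts. -/
theorem even_part_mul_mul {x y z w e₁ e₂ e₃ e₄ m₁₂ m₃₄ m₁₃ m₁₄ m₂₃ m₂₄ : L}
    (h1 : Homog 2 1 (x + e₁ ^ 2)) (h2 : Homog 2 1 (y + e₂ ^ 2)) (h3 : Homog 2 1 (z + e₃ ^ 2))
    (h4 : Homog 2 1 (w + e₄ ^ 2)) (h12 : proj 2 0 (x * y) = m₁₂ ^ 2)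
    (h34 : proj 2 0 (z * w) = m₃₄ ^ 2) (h13 : proj 2 0 (x * z) = m₁₃ ^ 2)
    (h14 : proj 2 0 (x * w) = m₁₄ ^ 2) (h23 : proj 2 0 (y * z) = m₂₃ ^ 2)
    (h24 : proj 2 0 (y * w) = m₂₄ ^ 2) :
    proj 2 0 (x * y * (z * w)) = (m₁₂ * m₃₄ + e₁ * e₃ * m₂₄ + e₁ * e₄ * m₂₃ + e₂ * e₃ * m₁₄ +
      e₂ * e₄ * m₁₃) ^ 2 := by
  have hs := homog_sq
  rw [even_part_mul (hs _) h1 (hs _) h2] at h12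
  rw [even_part_mul (hs _) h3 (hs _) h4] at h34
  rw [even_part_mul (hs _) h1 (hs _) h3] at h13
  rw [even_part_mul (hs _) h1 (hs _) h4] at h14
  rw [even_part_mul (hs _) h2 (hs _) h3] at h23
  rw [even_part_mul (hs _) h2 (hs _) h4] at h24
  -- The even parts of xy and zw are m₁₂² and m₃₄²; their odd parts are the mixed sums. The first
  -- group is even (even times even plus odd times odd), the second odd.
  have key : x * y * (z * w) =
      (m₁₂ ^ 2 * m₃₄ ^ 2 + (e₁ ^ 2 * (y + e₂ ^ 2) + e₂ ^ 2 * (x + e₁ ^ 2)) *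
        (e₃ ^ 2 * (w + e₄ ^ 2) + e₄ ^ 2 * (z + e₃ ^ 2))) +
      (m₁₂ ^ 2 * (e₃ ^ 2 * (w + e₄ ^ 2) + e₄ ^ 2 * (z + e₃ ^ 2)) +
        m₃₄ ^ 2 * (e₁ ^ 2 * (y + e₂ ^ 2) + e₂ ^ 2 * (x + e₁ ^ 2))) := by
    rw [← h12, ← h34]
    grind
  have ho1 : Homog 2 1 (e₁ ^ 2 * (y + e₂ ^ 2) + e₂ ^ 2 * (x + e₁ ^ 2)) := by
    simpa using ((hs e₁).mul h2).add ((hs e₂).mul h1)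
  have ho2 : Homog 2 1 (e₃ ^ 2 * (w + e₄ ^ 2) + e₄ ^ 2 * (z + e₃ ^ 2)) := by
    simpa using ((hs e₃).mul h4).add ((hs e₄).mul h3)
  rw [key, proj_add, (((hs m₁₂).mul (hs m₃₄)).add ((ho1.mul ho2).congr (by decide))).proj_self
    (by decide), (((hs m₁₂).mul ho2).add ((hs m₃₄).mul ho1)).proj_eq_zero (by decide), add_zero]
  have e1 : (x + e₁ ^ 2) * (z + e₃ ^ 2) = m₁₃ ^ 2 + e₁ ^ 2 * e₃ ^ 2 := by rw [← h13]; grind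
  have e2 : (x + e₁ ^ 2) * (w + e₄ ^ 2) = m₁₄ ^ 2 + e₁ ^ 2 * e₄ ^ 2 := by rw [← h14]; grind
  have e3 : (y + e₂ ^ 2) * (z + e₃ ^ 2) = m₂₃ ^ 2 + e₂ ^ 2 * e₃ ^ 2 := by rw [← h23]; grind
  have e4 : (y + e₂ ^ 2) * (w + e₄ ^ 2) = m₂₄ ^ 2 + e₂ ^ 2 * e₄ ^ 2 := by rw [← h24]; grind
  generalize x + e₁ ^ 2 = X at *
  generalize y + e₂ ^ 2 = Y at *
  generalize z + e₃ ^ 2 = Z at *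
  generalize w + e₄ ^ 2 = W at *
  -- The product of the odd parts involves only the products YW, YZ, XW, XZ, which the even parts of
  -- the corresponding pairs determine. The term e₁²e₂²e₃²e₄² then occurs four times and cancels.
  have e5 : (e₁ ^ 2 * Y + e₂ ^ 2 * X) * (e₃ ^ 2 * W + e₄ ^ 2 * Z) =
      e₁ ^ 2 * e₃ ^ 2 * (Y * W) + e₁ ^ 2 * e₄ ^ 2 * (Y * Z) + e₂ ^ 2 * e₃ ^ 2 * (X * W) +
        e₂ ^ 2 * e₄ ^ 2 * (X * Z) := by ring
  rw [e5, e1, e2, e3, e4]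
  grind

/-- The quadratic relation between theta series coming from rotation by `45` degrees. -/
theorem thetaL_rotation {l : ℕ} (hl : Odd l) (i j : ℤ) :
    thetaL l (2 * i) * thetaL l (2 * j) + thetaL l i ^ 4 * thetaL l (2 * j) +
      thetaL l j ^ 4 * thetaL l (2 * i) + thetaL l (i + j) ^ 2 * thetaL l (i - j) ^ 2 = 0 := by
  -- Rotating the pair (i + j, i - j) once more gives (2i, 2j), so the even part of [2i][2j] is
  -- known; computing it also from the parts of the two factors yields the relation.
  have h := even_part_thetaL_mul hl (i + j) (i - j)
  have e1 : i + j + (i - j) = 2 * i := by ring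
  have e2 : i + j - (i - j) = 2 * j := by ring
  have hd : ∀ k, Homog 2 1 (thetaL l (2 * k) + thetaL l k ^ 4) := fun k =>
    (homog_thetaL_add hl k).mono (by decide)
  have h4 : ∀ k, Homog 2 0 (thetaL l k ^ 4) := fun k => (homog_pow_four _).mono (by decide)
  rw [e1, e2, even_part_mul (h4 i) (hd i) (h4 j) (hd j)] at h
  rw [mul_pow] at h
  rw [← h]
  grind

/-! ### Projections of the inverse of a theta series -/

/-- The properties of the theta series `[8s], [4s], [2s], [6s], [s], [3s], [5s], [7s]` that determine
the projections of `1 / [8s]`. -/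
structure Tower (a b c d e g₃ g₅ g₇ : L) : Prop where
  ne_zero : a ≠ 0
  homog_a : Homog 8 1 (a + b ^ 4)
  homog_b : Homog 8 1 (b + c ^ 4)
  homog_c : Homog 8 1 (c + e ^ 4)
  homog_d : Homog 8 1 (d + g₃ ^ 4)
  even_ab : proj 2 0 (a * b) = (c * d) ^ 2
  even_da : proj 2 0 (d * a) = (g₇ * e) ^ 2
  rotation : a * c + b ^ 4 * c + e ^ 4 * a + g₅ ^ 2 * g₃ ^ 2 = 0
  even_prod : proj 2 0 (b * c * (d * a)) = (g₃ * e * (g₇ * e) + c ^ 2 * g₃ ^ 2 * (g₅ * g₃) +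
    c ^ 2 * b ^ 2 * (b * c) + e ^ 2 * g₃ ^ 2 * (d * c) + e ^ 2 * b ^ 2 * (g₅ * e)) ^ 2

/-- Every field is a rotation identity: an even part of [x][y] is read off from the half sum and
half difference of x and y, which are integer multiples of s for all pairs occurring. -/
theorem tower {l : ℕ} (hl : Odd l) (s : ℤ) :
    Tower (thetaL l (8 * s)) (thetaL l (4 * s)) (thetaL l (2 * s)) (thetaL l (6 * s)) (thetaL l s)
      (thetaL l (3 * s)) (thetaL l (5 * s)) (thetaL l (7 * s)) := by
  have hd : ∀ k k' : ℤ, k = 2 * k' → Homog 8 1 (thetaL l k + thetaL l k' ^ 4) := by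
    rintro k k' rfl
    exact homog_thetaL_add hl k'
  have hm : ∀ x y i j : ℤ, x = i + j → y = i - j →
      proj 2 0 (thetaL l x * thetaL l y) = (thetaL l i * thetaL l j) ^ 2 := by
    rintro _ _ i j rfl rfl
    exact even_part_thetaL_mul hl i j
  have hd2 : ∀ k k' : ℤ, k = 2 * k' → Homog 2 1 (thetaL l k + (thetaL l k' ^ 2) ^ 2) := by
    intro k k' h
    rw [← pow_mul]
    exact (hd k k' h).mono (by decide)
  have e1 : thetaL l (-(3 * s)) = thetaL l (3 * s) := thetaL_neg _ _
  have e2 : thetaL l (-s) = thetaL l s := thetaL_neg _ _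
  have e3 : thetaL l (-(2 * s)) = thetaL l (2 * s) := thetaL_neg _ _
  refine ⟨thetaL_ne_zero hl _, hd _ _ (by ring), hd _ _ (by ring), hd _ _ (by ring),
    hd _ _ (by ring), ?_, ?_, ?_, ?_⟩
  · rw [hm _ _ (6 * s) (2 * s) (by ring) (by ring), mul_comm (thetaL l (2 * s))]
  · rw [hm _ _ (7 * s) (-s) (by ring) (by ring), e2]
  · have h := thetaL_rotation hl (4 * s) s
    rwa [show 2 * (4 * s) = 8 * s by ring, show 4 * s + s = 5 * s by ring,
      show 4 * s - s = 3 * s by ring] at h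
  -- The factors are [4s], [2s], [6s], [8s], with even parts the squares of [2s]², [s]², [3s]²,
  -- [4s]²; the six goals are the six pairs among them.
  · refine even_part_mul_mul (hd2 (4 * s) (2 * s) (by ring)) (hd2 (2 * s) s (by ring))
      (hd2 (6 * s) (3 * s) (by ring)) (hd2 (8 * s) (4 * s) (by ring)) ?_ ?_ ?_ ?_ ?_ ?_
    · exact hm _ _ _ _ (by ring) (by ring)
    · rw [hm _ _ (7 * s) (-s) (by ring) (by ring), e2]
    · rw [hm _ _ (5 * s) (-s) (by ring) (by ring), e2]
    · rw [hm _ _ (6 * s) (-(2 * s)) (by ring) (by ring), e3]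
    · rw [hm _ _ (4 * s) (-(2 * s)) (by ring) (by ring), e3]
    · rw [hm _ _ (5 * s) (-(3 * s)) (by ring) (by ring), e1]

namespace Tower

variable {a b c d e g₃ g₅ g₇ t : L}

theorem div_eq (h : Tower a b c d e g₃ g₅ g₇) (ht : a * t = b ^ 4) : b ^ 4 / a = t := by
  rw [div_eq_iff h.ne_zero, ← ht, mul_comm]

theorem add_div_eq (h : Tower a b c d e g₃ g₅ g₇) (ht : a * t = b ^ 4) :
    (a + b ^ 4) / a = 1 + t := by
  rw [add_div, h.div_eq ht, div_self h.ne_zero]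

theorem proj_four_div (h : Tower a b c d e g₃ g₅ g₇) (ht : a * t = b ^ 4) {y ε z ζ : L}
    (hε : Homog 4 0 ε) (hy : Homog 4 1 (y + ε)) (hζ : Homog 2 0 ζ) (hz : Homog 2 1 (z + ζ)) :
    proj 4 1 (y * z ^ 2 / a) = (ε + t * y) * (ζ + t * z + z) ^ 2 / a ∧
      proj 4 3 (y * z ^ 2 / a) = (ε + t * y) * (ζ + t * z) ^ 2 / a :=
  proj_four_mul_sq_div h.ne_zero (homog_pow_four b) (h.homog_a.mono (by decide)) hε hy hζ hz
    (by grind) ht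

theorem proj_eight (h : Tower a b c d e g₃ g₅ g₇) (ht : a * t = b ^ 4) {X : L} {i : ℤ}
    (hX : Homog 8 i (a ^ 4 * X)) {j : ℕ} :
    (i ≡ j [ZMOD 8] → proj 8 j X = t ^ 4 * X) ∧
      (i + 4 ≡ j [ZMOD 8] → proj 8 j X = (1 + t) ^ 4 * X) := by
  have h1 : Homog 8 0 ((b ^ 4) ^ 4) := by
    rw [← pow_mul]
    simpa [← pow_mul] using ((homog_one b).sq.sq.sq.sq).mono (by decide : 8 ∣ _)
  have h2 : Homog 8 4 ((a + b ^ 4) ^ 4) := (h.homog_a.pow 4).congr (by decide)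
  have := proj_eight_of_homog (j := j) h.ne_zero h1 h2 (by grind) hX
  rwa [h.div_eq ht, h.add_div_eq ht] at this

/-- The components of `1 / a`, `b ^ 2 / a` and `b ^ 3 / a` modulo `4`. -/
theorem proj_four_inv (h : Tower a b c d e g₃ g₅ g₇) (ht : a * t = b ^ 4) :
    proj 4 1 (1 / a) = (1 + t) * t ^ 2 / a ∧ proj 4 3 (1 / a) = (1 + t) ^ 3 / a := by
  -- The series y = z = 1 equal their own even parts, so the odd parts are 1 + 1 = 0, which is
  -- homogeneous of every degree.
  have h1 : Homog 4 1 (1 + 1 : L) := by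
    rw [add_self]
    exact fun n hn => absurd rfl hn
  have h2 : Homog 2 1 (1 + 1 : L) := h1.mono (by decide)
  have := h.proj_four_div ht Homog.one h1 Homog.one h2
  rw [one_pow, one_mul] at this
  rw [this.1, this.2]
  constructor <;> congr 1 <;> grind

theorem proj_four_sq (h : Tower a b c d e g₃ g₅ g₇) (ht : a * t = b ^ 4) :
    proj 4 1 (b ^ 2 / a) = (1 + t) * (c ^ 4 + t * b + b) ^ 2 / a ∧
      proj 4 3 (b ^ 2 / a) = (1 + t) * (c ^ 4 + t * b) ^ 2 / a := by
  have h1 : Homog 4 1 (1 + 1 : L) := by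
    rw [add_self]
    exact fun n hn => absurd rfl hn
  have := h.proj_four_div ht Homog.one h1 ((homog_pow_four c).mono (by decide))
    (h.homog_b.mono (by decide))
  rwa [one_mul, mul_one] at this

theorem proj_four_cube (h : Tower a b c d e g₃ g₅ g₇) (ht : a * t = b ^ 4) :
    proj 4 1 (b ^ 3 / a) = (c ^ 4 + t * b) * (c ^ 4 + t * b + b) ^ 2 / a ∧
      proj 4 3 (b ^ 3 / a) = (c ^ 4 + t * b) * (c ^ 4 + t * b) ^ 2 / a := by
  have := h.proj_four_div ht (homog_pow_four c) (h.homog_b.mono (by decide))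
    ((homog_pow_four c).mono (by decide)) (h.homog_b.mono (by decide))
  rwa [← pow_succ'] at this

/-! Even parts of the successive roots -/

/-- F/a = Fa/a², and a square in the denominator does not affect parity. -/
theorem even_part_div {F G : L} (hF : proj 2 0 (F * a) = G ^ 2) (ha : a ≠ 0) :
    proj 2 0 (F / a) = (G / a) ^ 2 := by
  rw [div_pow, ← hF, ← proj_div_homog _ _ (homog_sq a)]
  congr 1
  field_simp

theorem even_part_a (h : Tower a b c d e g₃ g₅ g₇) : proj 2 0 a = b ^ 4 := by
  have e1 : a = (a + b ^ 4) + b ^ 4 := by grind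
  conv_lhs => rw [e1]
  rw [proj_add, (h.homog_a.mono (by decide : 2 ∣ 8)).proj_eq_zero (by decide),
    ((homog_pow_four b).mono (by decide : 2 ∣ 4)).proj_self (by decide), zero_add]

/-- First link of the chain 1/a, b²/a, b³/a, bcd/a, `numer`/a. The numerators come from the even
parts b⁴ of a, b²·b⁴ of b²a, b²(cd)² of b²·ab, and from `even_prod` for bcda. -/
theorem even_part_inv (h : Tower a b c d e g₃ g₅ g₇) : proj 2 0 (1 / a) = (b ^ 2 / a) ^ 2 :=
  even_part_div (by rw [one_mul, h.even_part_a]; ring) h.ne_zero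

theorem even_part_sq (h : Tower a b c d e g₃ g₅ g₇) :
    proj 2 0 (b ^ 2 / a) = (b ^ 3 / a) ^ 2 :=
  even_part_div (by
    rw [mul_comm, proj_mul_homog _ _ (homog_sq b), h.even_part_a]
    ring) h.ne_zero

theorem even_part_cube (h : Tower a b c d e g₃ g₅ g₇) :
    proj 2 0 (b ^ 3 / a) = (b * c * d / a) ^ 2 :=
  even_part_div (by
    rw [show b ^ 3 * a = a * b * b ^ 2 by ring, proj_mul_homog _ _ (homog_sq b), h.even_ab]
    ring) h.ne_zero

/-- The quotient dc⁶/a is what remains of `numer`/a after elements of S are removed; see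
`mem_of_root`. -/
theorem even_part_mul_div (h : Tower a b c d e g₃ g₅ g₇) :
    proj 2 0 (d * c ^ 6 / a) = (c ^ 3 * g₇ * e / a) ^ 2 :=
  even_part_div (by
    rw [show d * c ^ 6 * a = d * a * (c ^ 3) ^ 2 by ring, proj_mul_homog _ _ (homog_sq _),
      h.even_da]
    ring) h.ne_zero

theorem proj_four_mul_div (h : Tower a b c d e g₃ g₅ g₇) (ht : a * t = b ^ 4) :
    proj 4 1 (d * c ^ 6 / a) = c ^ 4 * ((g₃ ^ 4 + t * d) * (c + e ^ 4 + t * c) ^ 2 / a) := by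
  rw [show d * c ^ 6 / a = d * c ^ 2 / a * c ^ 4 by ring,
    proj_mul_homog _ _ (homog_pow_four c),
    (h.proj_four_div ht (homog_pow_four g₃) (h.homog_d.mono (by decide))
      ((homog_pow_four e).mono (by decide)) (h.homog_c.mono (by decide))).1]
  ring

/-- The numerator of the square root of the even part of `b * c * d / a`. -/
def numer (b c d e g₃ g₅ g₇ : L) : L :=
  g₃ * e * (g₇ * e) + c ^ 2 * g₃ ^ 2 * (g₅ * g₃) + c ^ 2 * b ^ 2 * (b * c) +
    e ^ 2 * g₃ ^ 2 * (d * c) + e ^ 2 * b ^ 2 * (g₅ * e)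

theorem even_part_prod (h : Tower a b c d e g₃ g₅ g₇) :
    proj 2 0 (b * c * d / a) = (numer b c d e g₃ g₅ g₇ / a) ^ 2 :=
  even_part_div (by rw [mul_assoc _ d a]; exact h.even_prod) h.ne_zero

/-! The projections -/

/-- Multiplied by a⁴, the components modulo 4 become (a + b⁴)b⁸ and (a + b⁴)³, which are homogeneous
of degrees 1 and 3 modulo 8. Refinement then multiplies by t⁴ or by (1 + t)⁴. -/
theorem proj_eight_inv (h : Tower a b c d e g₃ g₅ g₇) (ht : a * t = b ^ 4) :
    proj 8 1 (1 / a) = t ^ 6 * (1 + t) / a ∧ proj 8 5 (1 / a) = t ^ 2 * (1 + t) ^ 5 / a ∧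
      proj 8 3 (1 / a) = t ^ 4 * (1 + t) ^ 3 / a := by
  have ha := h.ne_zero
  have h4 := (homog_pow_eight b)
  have e1 : 1 + t = (a + b ^ 4) / a := (h.add_div_eq ht).symm
  have e2 : t = b ^ 4 / a := (h.div_eq ht).symm
  have h1 : Homog 8 1 (a ^ 4 * ((1 + t) * t ^ 2 / a)) := by
    have : a ^ 4 * ((1 + t) * t ^ 2 / a) = (a + b ^ 4) * b ^ 8 := by
      rw [e1, e2]; field_simp
    rw [this]
    exact (h.homog_a.mul h4).congr (by decide)
  have h3 : Homog 8 3 (a ^ 4 * ((1 + t) ^ 3 / a)) := by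
    have : a ^ 4 * ((1 + t) ^ 3 / a) = (a + b ^ 4) ^ 3 := by
      rw [e1]; field_simp
    rw [this]
    exact (h.homog_a.pow 3).congr (by decide)
  have p1 := h.proj_eight ht h1 (j := 1)
  have p5 := h.proj_eight ht h1 (j := 5)
  have p3 := h.proj_eight ht h3 (j := 3)
  rw [← (h.proj_four_inv ht).1, proj_proj (by decide) (by decide)] at p1 p5
  rw [← (h.proj_four_inv ht).2, proj_proj (by decide) (by decide)] at p3
  refine ⟨?_, ?_, ?_⟩
  · rw [p1.1 (by decide), (h.proj_four_inv ht).1]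
    ring
  · rw [p5.2 (by decide), (h.proj_four_inv ht).1]
    ring
  · rw [p3.1 (by decide), (h.proj_four_inv ht).2]
    ring

theorem proj_inv_even (h : Tower a b c d e g₃ g₅ g₇) (q j : ℕ) :
    proj (2 * q) (2 * j) (1 / a) = (proj q j (b ^ 2 / a)) ^ 2 :=
  proj_of_even_part h.even_part_inv q j

theorem proj_inv_four (h : Tower a b c d e g₃ g₅ g₇) (q j : ℕ) :
    proj (2 * (2 * q)) (2 * (2 * j)) (1 / a) = (proj q j (b ^ 3 / a)) ^ 4 := by
  rw [h.proj_inv_even, proj_of_even_part h.even_part_sq, ← pow_mul]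

theorem proj_inv_eight (h : Tower a b c d e g₃ g₅ g₇) (q j : ℕ) :
    proj (2 * (2 * (2 * q))) (2 * (2 * (2 * j))) (1 / a) = (proj q j (b * c * d / a)) ^ 8 := by
  rw [h.proj_inv_four, proj_of_even_part h.even_part_cube, ← pow_mul]

theorem proj_inv_sixteen (h : Tower a b c d e g₃ g₅ g₇) (q j : ℕ) :
    proj (2 * (2 * (2 * (2 * q)))) (2 * (2 * (2 * (2 * j)))) (1 / a) =
      (proj q j (numer b c d e g₃ g₅ g₇ / a)) ^ 16 := by
  rw [h.proj_inv_eight, proj_of_even_part h.even_part_prod, ← pow_mul]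

theorem proj_prod_odd (h : Tower a b c d e g₃ g₅ g₇) :
    proj 2 1 (b * c * d / a) = b * c * d / a + (numer b c d e g₃ g₅ g₇ / a) ^ 2 := by
  have := sum_proj 1 (b * c * d / a)
  rw [pow_one, Finset.sum_range_succ, Finset.sum_range_one, h.even_part_prod] at this
  grind

/-- From c⁴ + tb + b = tc⁴ + (1+t)(b + c⁴), the component of b²/a in class 1 modulo 4 is a sum of
two terms which, times a⁴, have degrees 1 and 5 modulo 8. Projection to class 5 multiplies the first
by (1+t)⁴ and the second by t⁴. -/
theorem proj_sq_five (h : Tower a b c d e g₃ g₅ g₇) (ht : a * t = b ^ 4) :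
    proj 8 5 (b ^ 2 / a) = (1 + t) ^ 3 * t ^ 2 * (c ^ 4 + t * b) ^ 2 / a := by
  have ha := h.ne_zero
  have e1 : 1 + t = (a + b ^ 4) / a := (h.add_div_eq ht).symm
  have e2 : t = b ^ 4 / a := (h.div_eq ht).symm
  have h1 : Homog 8 1 (a ^ 4 * ((1 + t) * t ^ 2 * c ^ 8 / a)) := by
    have : a ^ 4 * ((1 + t) * t ^ 2 * c ^ 8 / a) = (a + b ^ 4) * b ^ 8 * c ^ 8 := by
      rw [e1, e2]; field_simp
    rw [this]
    exact ((h.homog_a.mul (homog_pow_eight b)).mul (homog_pow_eight c)).congr (by decide)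
  have h5 : Homog 8 5 (a ^ 4 * ((1 + t) ^ 3 * (b + c ^ 4) ^ 2 / a)) := by
    have : a ^ 4 * ((1 + t) ^ 3 * (b + c ^ 4) ^ 2 / a) = (a + b ^ 4) ^ 3 * (b + c ^ 4) ^ 2 := by
      rw [e1]; field_simp
    rw [this]
    exact ((h.homog_a.pow 3).mul (h.homog_b.pow 2)).congr (by decide)
  have p1 := (h.proj_eight ht h1 (j := 5)).2 (by decide)
  have p5 := (h.proj_eight ht h5 (j := 5)).1 (by decide)
  rw [← proj_proj (by decide : 4 ∣ 8) (by decide : (5 : ℕ) ≡ (1 : ℕ) [ZMOD 4]),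
    (h.proj_four_sq ht).1]
  have key : (1 + t) * (c ^ 4 + t * b + b) ^ 2 / a = (1 + t) * t ^ 2 * c ^ 8 / a +
      (1 + t) ^ 3 * (b + c ^ 4) ^ 2 / a := by
    rw [← add_div]
    congr 1
    grind
  rw [key, proj_add, p1, p5, ← mul_div_assoc, ← mul_div_assoc, ← add_div]
  congr 1
  grind

/-- Times a⁴, the component of b²/a in class 3 modulo 4 is (a+b⁴)³c⁸ + (a+b⁴)b⁸(b+c⁴)², both of
degree 3 modulo 8, so one refinement handles it. -/
theorem proj_sq_three (h : Tower a b c d e g₃ g₅ g₇) (ht : a * t = b ^ 4) :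
    proj 8 3 (b ^ 2 / a) = t ^ 4 * (1 + t) * (c ^ 4 + t * b) ^ 2 / a ∧
      proj 8 7 (b ^ 2 / a) = (1 + t) ^ 5 * (c ^ 4 + t * b) ^ 2 / a := by
  have ha := h.ne_zero
  have e1 : 1 + t = (a + b ^ 4) / a := (h.add_div_eq ht).symm
  have e2 : t = b ^ 4 / a := (h.div_eq ht).symm
  have h1 : Homog 8 3 (a ^ 4 * ((1 + t) * (c ^ 4 + t * b) ^ 2 / a)) := by
    have e3 : c ^ 4 + t * b = (1 + t) * c ^ 4 + t * (b + c ^ 4) := by grind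
    have e4 : (c ^ 4 + t * b) ^ 2 = (1 + t) ^ 2 * c ^ 8 + t ^ 2 * (b + c ^ 4) ^ 2 := by grind
    have : a ^ 4 * ((1 + t) * (c ^ 4 + t * b) ^ 2 / a) =
        (a + b ^ 4) ^ 3 * c ^ 8 + (a + b ^ 4) * b ^ 8 * (b + c ^ 4) ^ 2 := by
      rw [e4, e1, e2]; field_simp
    rw [this]
    exact (((h.homog_a.pow 3).mul (homog_pow_eight c)).congr (by decide)).add
      (((h.homog_a.mul (homog_pow_eight b)).mul (h.homog_b.pow 2)).congr (by decide))
  have p3 := (h.proj_eight ht h1 (j := 3)).1 (by decide)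
  have p7 := (h.proj_eight ht h1 (j := 7)).2 (by decide)
  rw [← (h.proj_four_sq ht).2, proj_proj (by decide) (by decide)] at p3 p7
  rw [p3, p7, (h.proj_four_sq ht).2]
  constructor <;> ring

/-- With E = c⁴ + tb, the component of b³/a in class 3 modulo 4 is E³/a = (aE)³/a⁴. Since aE = p + q
with p, q of degrees 1 and 5 modulo 8 and (p+q)² of degree 2, this splits into pieces of degrees 3
and 7, to be multiplied by t⁴ and (1+t)⁴. -/
theorem proj_cube_three (h : Tower a b c d e g₃ g₅ g₇) (ht : a * t = b ^ 4) :
    proj 8 3 (b ^ 3 / a) = (c ^ 4 + t * b) ^ 2 *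
      ((1 + t) * (c + e ^ 4 + t * c) ^ 4 + (b + c ^ 4) * (c ^ 4 + t * b + b) ^ 4 / a) / a := by
  have ha := h.ne_zero
  have e1 : 1 + t = (a + b ^ 4) / a := (h.add_div_eq ht).symm
  have h16 : ∀ F : L, Homog 8 0 (F ^ 16) := fun F => by
    have := homog_pow_eight (F ^ 2)
    rwa [← pow_mul] at this
  -- aE = ac⁴ + b⁵ = c⁴(a+b⁴) + b⁴(b+c⁴). Splitting c⁴ and b⁴ into their parts of degrees 0 and 4
  -- modulo 8, namely e¹⁶ + (c+e⁴)⁴ and c¹⁶ + (b+c⁴)⁴, gives p and q.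
  set p := e ^ 16 * (a + b ^ 4) + c ^ 16 * (b + c ^ 4) with hp
  set q := (c + e ^ 4) ^ 4 * (a + b ^ 4) + (b + c ^ 4) ^ 5 with hq
  have p1 : Homog 8 1 p :=
    (((h16 e).mul h.homog_a).congr (by decide)).add (((h16 c).mul h.homog_b).congr (by decide))
  have q5 : Homog 8 5 q :=
    (((h.homog_c.pow 4).mul h.homog_a).congr (by decide)).add
      ((h.homog_b.pow 5).congr (by decide))
  have hE : a * (c ^ 4 + t * b) = p + q := by
    rw [hp, hq, mul_add, ← mul_assoc, ht]
    grind
  have hE2 : Homog 8 2 ((p + q) ^ 2) := by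
    have : (p + q) ^ 2 = p ^ 2 + q ^ 2 := by grind
    rw [this]
    exact ((p1.pow 2).congr (by decide)).add ((q5.pow 2).congr (by decide))
  have h3 : Homog 8 3 (a ^ 4 * (p * (p + q) ^ 2 / a ^ 4)) := by
    rw [mul_div_cancel₀ _ (pow_ne_zero _ ha)]
    exact (p1.mul hE2).congr (by decide)
  have h7 : Homog 8 7 (a ^ 4 * (q * (p + q) ^ 2 / a ^ 4)) := by
    rw [mul_div_cancel₀ _ (pow_ne_zero _ ha)]
    exact (q5.mul hE2).congr (by decide)
  have r3 := (h.proj_eight ht h3 (j := 3)).1 (by decide)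
  have r7 := (h.proj_eight ht h7 (j := 3)).2 (by decide)
  have key : (c ^ 4 + t * b) * (c ^ 4 + t * b) ^ 2 / a =
      p * (p + q) ^ 2 / a ^ 4 + q * (p + q) ^ 2 / a ^ 4 := by
    rw [← add_div, ← hE]
    field_simp
    rw [← hE]
    ring
  rw [← proj_proj (by decide : 4 ∣ 8) (by decide : (3 : ℕ) ≡ (3 : ℕ) [ZMOD 4]),
    (h.proj_four_cube ht).2, key, proj_add, r3, r7, ← hE]
  -- Grouped by the factors a+b⁴ and b+c⁴, the combination consists of fourth powers of te⁴ +
  -- (1+t)(c+e⁴) and tc⁴ + (1+t)(b+c⁴).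
  have hpq : t ^ 4 * p + (1 + t) ^ 4 * q =
      a * (1 + t) * (c + e ^ 4 + t * c) ^ 4 + (b + c ^ 4) * (c ^ 4 + t * b + b) ^ 4 := by
    have hv : a + b ^ 4 = a * (1 + t) := by rw [← ht]; ring
    have hD : c ^ 4 + t * b + b = t * c ^ 4 + (1 + t) * (b + c ^ 4) := by grind
    have hG : c + e ^ 4 + t * c = (1 + t) * (c + e ^ 4) + t * e ^ 4 := by grind
    rw [hD, hG, hp, hq, hv]
    grind
  have hfin : t ^ 4 * (p * (a * (c ^ 4 + t * b)) ^ 2 / a ^ 4) +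
      (1 + t) ^ 4 * (q * (a * (c ^ 4 + t * b)) ^ 2 / a ^ 4) =
      (t ^ 4 * p + (1 + t) ^ 4 * q) * (c ^ 4 + t * b) ^ 2 / a ^ 2 := by
    field_simp
  rw [hfin, hpq]
  field_simp

end Tower

/-! ### The ring `S` is stable under projections -/

theorem thetaL_mem (l : ℕ) (i : ℤ) : thetaL l i ∈ S l := Algebra.subset_adjoin ⟨i, rfl⟩

/-- Every generator is some [2k], since 2 is invertible modulo l, and its components [k]⁴ and [2k] +
[k]⁴ lie in S. Components of a product are sums of products of components, so stability passes to
products. -/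
theorem proj_four_mem {l : ℕ} (hl : Odd l) {F : L} (hF : F ∈ S l) (j : ℕ) :
    proj 4 j F ∈ S l := by
  induction hF using Algebra.adjoin_induction generalizing j with
  | mem x hx =>
    obtain ⟨i, rfl⟩ := hx
    -- For l = 2m + 1 the inverse of 2 modulo l is m + 1.
    obtain ⟨k, hk⟩ : ∃ k : ℤ, thetaL l i = thetaL l (2 * k) := by
      obtain ⟨m, hm⟩ := hl
      refine ⟨i * (m + 1), thetaL_congr (Int.modEq_iff_dvd.2 ⟨i, ?_⟩)⟩
      rw [hm]
      push_cast
      ring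
    have h1 : Homog 4 1 (thetaL l (2 * k) + thetaL l k ^ 4) :=
      (homog_thetaL_add hl k).mono (by decide)
    have h0 := homog_pow_four (thetaL l k)
    have m0 : thetaL l k ^ 4 ∈ S l := pow_mem (thetaL_mem l k) 4
    have e : thetaL l i = (thetaL l (2 * k) + thetaL l k ^ 4) + thetaL l k ^ 4 := by
      rw [hk]; grind
    rw [e, proj_add]
    refine add_mem ?_ ?_
    · by_cases h : (1 : ℤ) ≡ j [ZMOD (4 : ℕ)]
      · rw [h1.proj_self h]
        exact add_mem (thetaL_mem _ _) m0
      · rw [h1.proj_eq_zero h]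
        exact zero_mem _
    · by_cases h : (0 : ℤ) ≡ j [ZMOD (4 : ℕ)]
      · rw [h0.proj_self h]
        exact m0
      · rw [h0.proj_eq_zero h]
        exact zero_mem _
  | algebraMap r =>
    rcases (by decide : ∀ z : ZMod 2, z = 0 ∨ z = 1) r with rfl | rfl
    · rw [map_zero]
      have h0 : proj 4 j (0 : L) = 0 := by
        ext n
        simp [proj_coeff]
      rw [h0]
      exact zero_mem _
    rw [map_one]
    by_cases h : (0 : ℤ) ≡ j [ZMOD (4 : ℕ)]
    · rw [Homog.one.proj_self h]
      exact one_mem _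
    · rw [Homog.one.proj_eq_zero h]
      exact zero_mem _
  | add x y _ _ hx hy =>
    rw [proj_add]
    exact add_mem (hx j) (hy j)
  | mul x y _ _ hx hy =>
    have ex := sum_proj 2 x
    have ey := sum_proj 2 y
    rw [← ex, ← ey, Finset.sum_mul_sum, proj_sum]
    refine sum_mem fun i _ => ?_
    rw [proj_sum]
    refine sum_mem fun k _ => ?_
    have h := (homog_proj 4 i x).mul (homog_proj 4 k y)
    by_cases h' : (i : ℤ) + k ≡ j [ZMOD (4 : ℕ)]
    · exact (h.proj_self h').symm ▸ mul_mem (hx i) (hy k)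
    · exact (h.proj_eq_zero h').symm ▸ zero_mem _

theorem proj_two_mem {l : ℕ} (hl : Odd l) {F : L} (hF : F ∈ S l) : proj 2 0 F ∈ S l := by
  have e : proj 2 0 F = proj 4 0 F + proj 4 2 F := by
    ext n
    have h2 : n ≡ (0 : ℕ) [ZMOD (2 : ℕ)] ↔ n % 2 = 0 := Iff.rfl
    have h4 : n ≡ (0 : ℕ) [ZMOD (4 : ℕ)] ↔ n % 4 = 0 := Iff.rfl
    have h4' : n ≡ (2 : ℕ) [ZMOD (4 : ℕ)] ↔ n % 4 = 2 := Iff.rfl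
    rw [HahnSeries.coeff_add, proj_coeff, proj_coeff, proj_coeff]
    by_cases h0 : n % 4 = 0
    · rw [if_pos (h2.2 (by omega)), if_pos (h4.2 h0), if_neg (by rw [h4']; omega), add_zero]
    by_cases h1 : n % 4 = 2
    · rw [if_pos (h2.2 (by omega)), if_neg (by rwa [h4]), if_pos (h4'.2 h1), zero_add]
    · rw [if_neg (by rw [h2]; omega), if_neg (by rwa [h4]), if_neg (by rwa [h4']), add_zero]
  rw [e]
  exact add_mem (proj_four_mem hl hF 0) (proj_four_mem hl hF 2)

end

/-! ### Relations between theta series -/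

/-- The formal sum of `thetaL_rotation` for `i = A`, `j = B`. -/
def rotationPoly (l A B : ℕ) : Poly :=
  [[2 * A, 2 * B], [A, A, A, A, 2 * B], [B, B, B, B, 2 * A],
    [A + B, A + B, A + (l - 1) * B, A + (l - 1) * B]]

/-- The consequence of three rotation relations in which no fourth powers occur. -/
def triplePoly (l A B D : ℕ) : Poly :=
  [[2 * A, 2 * B, 2 * D], [2 * D, A + B, A + B, A + (l - 1) * B, A + (l - 1) * B],
    [2 * A, B + D, B + D, B + (l - 1) * D, B + (l - 1) * D],
    [2 * B, A + D, A + D, A + (l - 1) * D, A + (l - 1) * D]]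

/-- One side of the cubic reflection for `l = 15`. -/
def cubicSide (i j k : ℕ) : Poly := (List.range 3).map fun d => [i + d * 5, j + d * 5, k + d * 5]

/-- The relation coming from the reflection of the cubic lattice; here `i + j + k = 3 s`. -/
def cubicPoly (i j k : ℕ) : Poly :=
  cubicSide i j k ++ cubicSide (i + 13 * ((i + j + k) / 3)) (j + 13 * ((i + j + k) / 3))
    (k + 13 * ((i + j + k) / 3))

/-- One side of the reflection in `(1, 1, 2, 2)` for `l = 15`. -/
def quarticSide (i j k m : ℕ) : Poly :=
  (List.range 5).map fun d => [i + d * 3, j + d * 3, k + 2 * d * 3, m + 2 * d * 3]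

/-- The relation coming from the reflection in `(1, 1, 2, 2)`; here `i + j + 2 k + 2 m = 5 s`. -/
def quarticPoly (i j k m : ℕ) : Poly :=
  quarticSide i j k m ++ quarticSide (i + 14 * ((i + j + 2 * k + 2 * m) / 5))
    (j + 14 * ((i + j + 2 * k + 2 * m) / 5)) (k + 13 * ((i + j + 2 * k + 2 * m) / 5))
    (m + 13 * ((i + j + 2 * k + 2 * m) / 5))

noncomputable section

theorem vanishes_rotationPoly {l : ℕ} (hl : Odd l) (A B : ℕ) : Vanishes l (rotationPoly l A B) := by
  intro r _
  have h := thetaL_rotation hl (A * r) (B * r)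
  -- Formal indices are natural numbers, so l - 1 plays the role of -1.
  have e : thetaL l ((A + (l - 1) * B : ℕ) * r) = thetaL l (A * r - B * r) := by
    refine thetaL_congr (Int.modEq_iff_dvd.2 ⟨-(B * r), ?_⟩)
    have := hl.pos
    push_cast [Nat.cast_sub (show 1 ≤ l by omega)]
    ring
  have e1 : ∀ z : ℕ, ((2 * z : ℕ) : ℤ) * r = 2 * (z * r) := fun z => by push_cast; ring
  have e2 : ((A + B : ℕ) : ℤ) * r = A * r + B * r := by push_cast; ring
  simp only [eval, rotationPoly, evalMon, List.map_cons, List.map_nil, List.sum_cons, List.sum_nil,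
    List.prod_cons, List.prod_nil, e, e1, e2]
  linear_combination h

/-- Multiply the relation for each pair by the remaining series among [2A], [2B], [2D] and add:
every term with a fourth power appears twice and cancels, while [2A][2B][2D] appears three times and
survives. -/
theorem vanishes_triplePoly {l : ℕ} (hl : Odd l) (A B D : ℕ) :
    Vanishes l (triplePoly l A B D) := by
  intro r _
  have h1 := thetaL_rotation hl (A * r) (B * r)
  have h2 := thetaL_rotation hl (B * r) (D * r)
  have h3 := thetaL_rotation hl (A * r) (D * r)
  have e : ∀ A B : ℕ, thetaL l ((A + (l - 1) * B : ℕ) * r) = thetaL l (A * r - B * r) := by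
    intro A B
    refine thetaL_congr (Int.modEq_iff_dvd.2 ⟨-(B * r), ?_⟩)
    have := hl.pos
    push_cast [Nat.cast_sub (show 1 ≤ l by omega)]
    ring
  have e1 : ∀ z : ℕ, ((2 * z : ℕ) : ℤ) * r = 2 * (z * r) := fun z => by push_cast; ring
  have e2 : ∀ A B : ℕ, ((A + B : ℕ) : ℤ) * r = A * r + B * r := fun A B => by push_cast; ring
  simp only [eval, triplePoly, evalMon, List.map_cons, List.map_nil, List.sum_cons, List.sum_nil,
    List.prod_cons, List.prod_nil, e1, e2]
  generalize thetaL l (2 * (A * r)) = x at *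
  generalize thetaL l (2 * (B * r)) = y at *
  generalize thetaL l (2 * (D * r)) = z at *
  have h4 : z * 0 + x * 0 + y * 0 = (0 : L) := by ring
  nth_rewrite 1 [← h1] at h4
  nth_rewrite 1 [← h2] at h4
  nth_rewrite 1 [← h3] at h4
  rw [← h4]
  grind

end

/-- The rotation relation. -/
def rot (l : ℕ) (hl : Odd l) (A B : ℕ) : Relation l := ⟨_, vanishes_rotationPoly hl A B⟩

/-- The triple rotation relation. -/
def tri (l : ℕ) (hl : Odd l) (A B D : ℕ) : Relation l := ⟨_, vanishes_triplePoly hl A B D⟩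

theorem eval_append (l : ℕ) (r : ℤ) (p q : Poly) : eval l r (p ++ q) = eval l r p + eval l r q := by
  simp [eval]

theorem periodic_emod {F : ℤ → L} {q : ℤ} (hF : ∀ z, F (z + q) = F z) (z : ℤ) :
    F z = F (z % q) := by
  have h : ∀ n : ℤ, ∀ z, F (z + n * q) = F z := by
    intro n
    induction n using Int.induction_on with
    | zero => simp
    | succ n ih =>
      intro z
      rw [← ih z, ← hF (z + n * q)]
      congr 1
      ring
    | pred n ih =>
      intro z
      rw [← ih z, ← hF (z + (-n - 1) * q)]
      congr 1
      ring
  conv_lhs => rw [← Int.emod_add_mul_ediv z q, mul_comm q]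
  exact h _ _

/-- Multiplication by a unit r permutes the residues modulo 3. Evaluation at r turns the shift 5d
into 5dr, and this undoes the scaling of d. -/
theorem sum_three_scale {F : ℤ → L} (hF : ∀ z, F (z + 3) = F z) {r : ℤ} (hr : r % 3 ≠ 0) :
    F 0 + (F r + F (2 * r)) = F 0 + (F 1 + F 2) := by
  rw [periodic_emod hF r, periodic_emod hF (2 * r)]
  have h : r % 3 = 1 ∨ r % 3 = 2 := by omega
  rcases h with h | h
  · rw [h, show 2 * r % 3 = 2 by omega]
  · rw [h, show 2 * r % 3 = 1 by omega]
    ring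

theorem sum_five_scale {F : ℤ → L} (hF : ∀ z, F (z + 5) = F z) {r : ℤ} (hr : r % 5 ≠ 0) :
    F 0 + (F r + (F (2 * r) + (F (3 * r) + F (4 * r)))) = F 0 + (F 1 + (F 2 + (F 3 + F 4))) := by
  rw [periodic_emod hF r, periodic_emod hF (2 * r), periodic_emod hF (3 * r),
    periodic_emod hF (4 * r)]
  have h : r % 5 = 1 ∨ r % 5 = 2 ∨ r % 5 = 3 ∨ r % 5 = 4 := by omega
  rcases h with h | h | h | h
  · rw [h, show 2 * r % 5 = 2 by omega, show 3 * r % 5 = 3 by omega, show 4 * r % 5 = 4 by omega]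
  · rw [h, show 2 * r % 5 = 4 by omega, show 3 * r % 5 = 1 by omega, show 4 * r % 5 = 3 by omega]
    ring
  · rw [h, show 2 * r % 5 = 1 by omega, show 3 * r % 5 = 4 by omega, show 4 * r % 5 = 2 by omega]
    ring
  · rw [h, show 2 * r % 5 = 3 by omega, show 3 * r % 5 = 2 by omega, show 4 * r % 5 = 1 by omega]
    ring

theorem thetaL_eq_of_sub {l : ℕ} {x y : ℤ} (z : ℤ) (h : x - y = l * z) :
    thetaL l x = thetaL l y :=
  (thetaL_congr (Int.modEq_iff_dvd.2 ⟨z, h⟩)).symm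

/-- One side of the cubic reflection as a function of the parameters. -/
noncomputable def cubicSum (i j k : ℤ) : L :=
  let F := fun d : ℤ => thetaL 15 (i + d * 5) * (thetaL 15 (j + d * 5) * thetaL 15 (k + d * 5))
  F 0 + (F 1 + F 2)

theorem cubicSum_reflect {i j k s : ℤ} (hs : i + j + k = 3 * s) :
    cubicSum i j k = cubicSum (i - 2 * s) (j - 2 * s) (k - 2 * s) := by
  have h := congrArg (HahnSeries.ofPowerSeries ℤ (ZMod 2))
    (sum_theta_triple_reflect 5 (by decide) i j k s hs)
  simp only [Finset.sum_range_succ, Finset.sum_range_zero, map_add, map_mul, map_zero] at h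
  simp only [cubicSum, thetaL]
  simp only [Nat.cast_zero, Nat.cast_one, Nat.cast_ofNat, zero_add, add_assoc] at h
  exact h

/-- The summands agree only up to the permutation d ↦ dr of residues modulo 3, which is where 3 not
dividing r is needed. -/
theorem eval_cubicSide {r : ℤ} (hr : r % 3 ≠ 0) (i j k : ℕ) :
    eval 15 r (cubicSide i j k) = cubicSum (i * r) (j * r) (k * r) := by
  rw [cubicSum]
  dsimp only
  have key := sum_three_scale (F := fun d : ℤ => thetaL 15 (i * r + d * 5) *
    (thetaL 15 (j * r + d * 5) * thetaL 15 (k * r + d * 5))) (fun z => by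
      have : ∀ x : ℤ, thetaL 15 (x + (z + 3) * 5) = thetaL 15 (x + z * 5) := fun x =>
        thetaL_eq_of_sub 1 (by push_cast; ring)
      simp only [this]) hr
  rw [← key]
  simp only [eval, cubicSide, evalMon, List.range_succ, List.range_zero, List.nil_append,
    List.cons_append, List.map_cons, List.map_nil, List.sum_cons, List.sum_nil, List.prod_cons,
    List.prod_nil, mul_one, add_zero]
  push_cast
  ring_nf

theorem vanishes_cubicPoly (i j k : ℕ) (h : 3 ∣ i + j + k) : Vanishes 15 (cubicPoly i j k) := by
  intro r hr
  have hr3 : r % 3 ≠ 0 := by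
    intro h0
    have := hr.isUnit_of_dvd' (Int.dvd_of_emod_eq_zero h0) (by decide)
    exact absurd this (by decide)
  obtain ⟨s, hs⟩ := h
  have hs' : (i + j + k) / 3 = s := by omega
  rw [cubicPoly, eval_append, eval_cubicSide hr3, eval_cubicSide hr3, hs',
    cubicSum_reflect (s := s * r) (by
      have : (i : ℤ) + j + k = 3 * s := by exact_mod_cast hs
      linear_combination r * this)]
  -- Modulo 15 the natural number 13 stands for the -2 of the reflection.
  have e : ∀ n : ℕ, ∀ d : ℤ, thetaL 15 (((n + 13 * s : ℕ) : ℤ) * r + d * 5) =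
      thetaL 15 (n * r - 2 * (s * r) + d * 5) := fun n d =>
    thetaL_eq_of_sub (s * r) (by push_cast; ring)
  simp only [cubicSum, e]
  exact add_self _

/-- One side of the reflection in `(1, 1, 2, 2)` as a function of the parameters. -/
noncomputable def quarticSum (i j k m : ℤ) : L :=
  let F := fun d : ℤ => thetaL 15 (i + d * 3) * (thetaL 15 (j + d * 3) *
    (thetaL 15 (k + 2 * d * 3) * thetaL 15 (m + 2 * d * 3)))
  F 0 + (F 1 + (F 2 + (F 3 + F 4)))

theorem quarticSum_reflect {i j k m s : ℤ} (hs : i + j + 2 * k + 2 * m = 5 * s) :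
    quarticSum i j k m = quarticSum (i - s) (j - s) (k - 2 * s) (m - 2 * s) := by
  have h := congrArg (HahnSeries.ofPowerSeries ℤ (ZMod 2))
    (sum_theta_quadruple_reflect 3 (by decide) i j k m s hs)
  simp only [Finset.sum_range_succ, Finset.sum_range_zero, map_add, map_mul, map_zero] at h
  simp only [quarticSum, thetaL]
  simp only [Nat.cast_zero, Nat.cast_one, Nat.cast_ofNat, zero_add, add_assoc] at h
  exact h

theorem eval_quarticSide {r : ℤ} (hr : r % 5 ≠ 0) (i j k m : ℕ) :
    eval 15 r (quarticSide i j k m) = quarticSum (i * r) (j * r) (k * r) (m * r) := by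
  rw [quarticSum]
  dsimp only
  have key := sum_five_scale (F := fun d : ℤ => thetaL 15 (i * r + d * 3) *
    (thetaL 15 (j * r + d * 3) * (thetaL 15 (k * r + 2 * d * 3) *
      thetaL 15 (m * r + 2 * d * 3)))) (fun z => by
      have : ∀ x : ℤ, thetaL 15 (x + (z + 5) * 3) = thetaL 15 (x + z * 3) := fun x =>
        thetaL_eq_of_sub 1 (by push_cast; ring)
      have h2 : ∀ x : ℤ, thetaL 15 (x + 2 * (z + 5) * 3) = thetaL 15 (x + 2 * z * 3) := fun x =>
        thetaL_eq_of_sub 2 (by push_cast; ring)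
      simp only [this, h2]) hr
  rw [← key]
  simp only [eval, quarticSide, evalMon, List.range_succ, List.range_zero, List.nil_append,
    List.cons_append, List.map_cons, List.map_nil, List.sum_cons, List.sum_nil, List.prod_cons,
    List.prod_nil, mul_one, add_zero]
  push_cast
  ring_nf

theorem vanishes_quarticPoly (i j k m : ℕ) (h : 5 ∣ i + j + 2 * k + 2 * m) :
    Vanishes 15 (quarticPoly i j k m) := by
  intro r hr
  have hr5 : r % 5 ≠ 0 := by
    intro h0
    have := hr.isUnit_of_dvd' (Int.dvd_of_emod_eq_zero h0) (by decide)
    exact absurd this (by decide)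
  obtain ⟨s, hs⟩ := h
  have hs' : (i + j + 2 * k + 2 * m) / 5 = s := by omega
  rw [quarticPoly, eval_append, eval_quarticSide hr5, eval_quarticSide hr5, hs',
    quarticSum_reflect (s := s * r) (by
      have : (i : ℤ) + j + 2 * k + 2 * m = 5 * s := by exact_mod_cast hs
      linear_combination r * this)]
  -- Here 13 and 14 stand for -2 and -1: the last two coordinates move by -2s, the first two by -s.
  have e : ∀ n : ℕ, ∀ d : ℤ, thetaL 15 (((n + 13 * s : ℕ) : ℤ) * r + d) =
      thetaL 15 (n * r - 2 * (s * r) + d) := fun n d =>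
    thetaL_eq_of_sub (s * r) (by push_cast; ring)
  have e' : ∀ n : ℕ, ∀ d : ℤ, thetaL 15 (((n + 14 * s : ℕ) : ℤ) * r + d) =
      thetaL 15 (n * r - s * r + d) := fun n d =>
    thetaL_eq_of_sub (s * r) (by push_cast; ring)
  simp only [quarticSum, e, e']
  exact add_self _

/-- The cubic reflection relation, if `3` divides `i + j + k`. -/
def cub (i j k : ℕ) : Relation 15 where
  poly := if 3 ∣ i + j + k then cubicPoly i j k else []
  vanishes := by
    split_ifs with h
    · exact vanishes_cubicPoly i j k h
    · exact fun _ _ => rfl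

/-- The quartic reflection relation, if `5` divides `i + j + 2 k + 2 m`. -/
def qua (i j k m : ℕ) : Relation 15 where
  poly := if 5 ∣ i + j + 2 * k + 2 * m then quarticPoly i j k m else []
  vanishes := by
    split_ifs with h
    · exact vanishes_quarticPoly i j k m h
    · exact fun _ _ => rfl

noncomputable section

/-- The theta series with index `i` at the parameter `r`. -/
def thetaAt (l : ℕ) (r : ℤ) (i : ℕ) : L := thetaL l (i * r)

theorem eval_index (l : ℕ) (r : ℤ) (i : ℕ) : eval l r [[i]] = thetaAt l r i := by
  simp [eval, evalMon, thetaAt]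

/-- The value of a product. -/
def prodEval (l : ℕ) (r : ℤ) (ps : List Poly) : L := (ps.map (eval l r)).prod

theorem prodEval_nil (l : ℕ) (r : ℤ) : prodEval l r [] = 1 := rfl

theorem prodEval_cons (l : ℕ) (r : ℤ) (p : Poly) (ps : List Poly) :
    prodEval l r (p :: ps) = eval l r p * prodEval l r ps := List.prod_cons

theorem evalSum_nil (l : ℕ) (r : ℤ) : evalSum l r [] = 0 := rfl

theorem evalSum_cons (l : ℕ) (r : ℤ) (ps : List Poly) (t : List (List Poly)) :
    evalSum l r (ps :: t) = prodEval l r ps + evalSum l r t := List.sum_cons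

/-- A formal sum that is a combination of relations is a relation. -/
def Relation.ofCheck {l : ℕ} (hl : Odd l) (hl' : l ≤ 15) (p : Poly) (c : List (Multiple l))
    (h : check l [[p]] c = true) : Relation l :=
  ⟨p, fun r hr => by
    have := evalSum_eq_zero hl hl' [[p]] c h r hr
    rwa [evalSum_cons, evalSum_nil, prodEval_cons, prodEval_nil, mul_one, add_zero] at this⟩

end

/-! ### Certified divisions by a = [r] for l = 11, where b = [5r], c = [3r], d = [2r], e = [4r]. -/

namespace Eleven

/-- The rotation relations. -/
def rotation (A B : ℕ) : Relation 11 := rot 11 (by decide) A B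

/-- The triple rotation relations. -/
def triple (A B D : ℕ) : Relation 11 := tri 11 (by decide) A B D

/-- An auxiliary relation. -/
def quartic : Relation 11 := .ofCheck (by decide) (by decide) (lit [23, 445, 135, 3355, 2555,
    1334, 1245, 1222]) [⟨rotation 1 3, 4, [0, 233]⟩, ⟨triple 1 2 4, 4, [0]⟩, ⟨rotation 1 3, 3,
    [4]⟩, ⟨triple 1 2 3, 3, [2, 15, 355, 134]⟩, ⟨rotation 1 2, 5, [22]⟩, ⟨rotation 1 3, 1, [55]⟩,
    ⟨rotation 1 3, 2, [33, 155, 114]⟩, ⟨triple 1 2 4, 1, [55, 223, 112]⟩, ⟨rotation 1 2, 1, [444,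
    355]⟩, ⟨rotation 1 2, 3, [145, 122]⟩, ⟨rotation 1 3, 5, [111]⟩, ⟨triple 1 2 3, 1, [334, 222]⟩,
    ⟨triple 1 2 3, 2, [555, 145, 122]⟩, ⟨triple 1 2 4, 3, [115]⟩] (by decide +kernel)

/-- The product of `[4 s] ^ 4 / [8 s]` and the theta series with index `2`. -/
def mul2 : Poly := lit [355, 2455, 2225, 1244, 23445, 14555, 12335]

/-- Together with its analogues for the other indices this shows that multiplication by t = b⁴/a
maps the ideal of theta series into itself. In a certificate the middle entry scales the relation
but not the multiplier, and a multiplier term 0 has no digits, so it denotes the monomial 1. -/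
theorem mul2_eq {r : ℤ} (hr : IsCoprime r (11 : ℕ)) : thetaAt 11 r 1 * eval 11 r mul2 = thetaAt 11
    r 5 ^ 4 * thetaAt 11 r 2 := by
  have h := evalSum_eq_zero (l := 11) (by decide) (by decide) [[[[1]], mul2], [[[5]], [[5]],
    [[5]], [[5]], [[2]]]] [⟨triple 1 2 3, 4, [0]⟩, ⟨quartic, 3, [3]⟩, ⟨triple 1 2 3, 1, [2]⟩,
    ⟨triple 1 2 3, 2, [1]⟩, ⟨quartic, 1, [34]⟩, ⟨quartic, 2, [22]⟩, ⟨quartic, 4, [55]⟩]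
    (by decide +kernel) r hr
  simp only [evalSum_cons, evalSum_nil, prodEval_cons, prodEval_nil, eval_index] at h
  -- The certificate proves that the sum of both sides vanishes, which in characteristic 2 is
  -- equality.
  exact CharTwo.add_eq_zero.1 (by linear_combination h)

/-- The product of `[4 s] ^ 4 / [8 s]` and the theta series with index `3`. -/
def mul3 : Poly := lit [3, 122, 4444]

/-- A single rotation relation, for the indices 5r and 4r, is already a formula for b⁴c in which all
other terms contain a. -/
theorem mul3_eq {r : ℤ} (hr : IsCoprime r (11 : ℕ)) : thetaAt 11 r 1 * eval 11 r mul3 = thetaAt 11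
    r 5 ^ 4 * thetaAt 11 r 3 := by
  have h := evalSum_eq_zero (l := 11) (by decide) (by decide) [[[[1]], mul3], [[[5]], [[5]],
    [[5]], [[5]], [[3]]]] [⟨rotation 1 3, 5, [0]⟩] (by decide +kernel) r hr
  simp only [evalSum_cons, evalSum_nil, prodEval_cons, prodEval_nil, eval_index] at h
  exact CharTwo.add_eq_zero.1 (by linear_combination h)

/-- The product of `[4 s] ^ 4 / [8 s]` and the theta series with index `4`. -/
def mul4 : Poly := lit [235, 115, 2245, 1355, 1134, 34445, 33555, 13345, 12455]

theorem mul4_eq {r : ℤ} (hr : IsCoprime r (11 : ℕ)) : thetaAt 11 r 1 * eval 11 r mul4 = thetaAt 11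
    r 5 ^ 4 * thetaAt 11 r 4 := by
  have h := evalSum_eq_zero (l := 11) (by decide) (by decide) [[[[1]], mul4], [[[5]], [[5]],
    [[5]], [[5]], [[4]]]] [⟨quartic, 5, [0]⟩, ⟨rotation 1 3, 2, [0]⟩, ⟨quartic, 1, [2]⟩, ⟨triple 1
    2 4, 4, [2]⟩, ⟨rotation 1 3, 3, [3]⟩, ⟨triple 1 2 3, 1, [4]⟩, ⟨quartic, 3, [13]⟩, ⟨quartic, 4,
    [33, 25]⟩, ⟨quartic, 2, [24]⟩] (by decide +kernel) r hr
  simp only [evalSum_cons, evalSum_nil, prodEval_cons, prodEval_nil, eval_index] at h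
  exact CharTwo.add_eq_zero.1 (by linear_combination h)

/-- The product of `[4 s] ^ 4 / [8 s]` and the theta series with index `5`. -/
def mul5 : Poly := lit [5, 244, 2255, 1445, 1224, 34455, 13444, 13355, 12555]

theorem mul5_eq {r : ℤ} (hr : IsCoprime r (11 : ℕ)) : thetaAt 11 r 1 * eval 11 r mul5 = thetaAt 11
    r 5 ^ 4 * thetaAt 11 r 5 := by
  have h := evalSum_eq_zero (l := 11) (by decide) (by decide) [[[[1]], mul5], [[[5]], [[5]],
    [[5]], [[5]], [[5]]]] [⟨rotation 1 2, 3, [0]⟩, ⟨triple 1 2 3, 2, [0]⟩, ⟨rotation 1 3, 2, [3]⟩,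
    ⟨triple 1 2 3, 1, [5]⟩, ⟨triple 1 2 4, 2, [3]⟩, ⟨triple 1 2 4, 5, [4]⟩, ⟨quartic, 1, [23]⟩,
    ⟨quartic, 2, [33]⟩, ⟨quartic, 3, [45]⟩] (by decide +kernel) r hr
  simp only [evalSum_cons, evalSum_nil, prodEval_cons, prodEval_nil, eval_index] at h
  exact CharTwo.add_eq_zero.1 (by linear_combination h)

/-- The series `t ^ 2 + t`, where `t = [4 s] ^ 4 / [8 s]`. -/
def polyW : Poly := lit [233, 225, 144, 1335, 1255, 1124, 33444, 33355, 333345, 234444, 233455,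
  222335]

/-- The right side is b³(tb) + b⁴ = b⁴(t + 1) = a(t² + t), so this places t² + t in S. -/
theorem polyW_eq {r : ℤ} (hr : IsCoprime r (11 : ℕ)) : thetaAt 11 r 1 * eval 11 r polyW = thetaAt
    11 r 5 ^ 3 * eval 11 r mul5 + thetaAt 11 r 5 ^ 4 := by
  have h := evalSum_eq_zero (l := 11) (by decide) (by decide) [[[[1]], polyW], [[[5]], [[5]],
    [[5]], mul5], [[[5]], [[5]], [[5]], [[5]]]] [⟨triple 1 2 3, 1, [0, 144, 113]⟩, ⟨quartic, 3,
    [4, 12]⟩, ⟨quartic, 1, [44, 335]⟩, ⟨triple 1 2 4, 3, [15, 444, 134]⟩, ⟨triple 1 2 3, 3, [34,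
    123]⟩, ⟨rotation 1 3, 5, [23]⟩, ⟨triple 1 2 3, 2, [45, 344]⟩, ⟨rotation 1 3, 4, [335]⟩,
    ⟨triple 1 2 4, 1, [235]⟩, ⟨triple 1 2 3, 4, [234, 155]⟩, ⟨rotation 1 3, 2, [345]⟩, ⟨rotation 1
    2, 3, [125]⟩, ⟨rotation 1 3, 3, [134]⟩, ⟨rotation 1 2, 2, [555]⟩, ⟨quartic, 5, [3344]⟩]
    (by decide +kernel) r hr
  simp only [evalSum_cons, evalSum_nil, prodEval_cons, prodEval_nil, eval_index] at h
  exact CharTwo.add_eq_zero.1 (by linear_combination h)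

/-- The series `t * W`. -/
def polyV : Poly := lit [233, 1255, 1124, 33355, 24445, 23555, 445555, 234444, 3355555, 24444555,
  444555555, 333444445, 333344555, 244444444]

theorem polyV_eq {r : ℤ} (hr : IsCoprime r (11 : ℕ)) : thetaAt 11 r 1 * eval 11 r polyV = thetaAt
    11 r 5 ^ 4 * eval 11 r polyW := by
  have h := evalSum_eq_zero (l := 11) (by decide) (by decide) [[[[1]], polyV], [[[5]], [[5]],
    [[5]], [[5]], polyW]] [⟨quartic, 2, [2]⟩, ⟨rotation 1 3, 1, [4, 22344, 12233]⟩, ⟨triple 1 2 4,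
    3, [2, 355, 2455, 14555, 13333, 11445]⟩, ⟨triple 1 2 4, 4, [44, 13]⟩, ⟨triple 1 2 4, 2, [55,
    14, 345, 223, 11134]⟩, ⟨triple 1 2 3, 2, [45, 344, 133, 1234, 22233, 14445, 11345]⟩, ⟨quartic,
    3, [115]⟩, ⟨rotation 1 3, 4, [255, 3334, 2345, 2223]⟩, ⟨rotation 1 3, 2, [345, 3344, 1235,
    23355]⟩, ⟨rotation 1 3, 5, [224, 3355, 24444]⟩, ⟨rotation 1 3, 3, [355]⟩, ⟨triple 1 2 3, 1,
    [233, 144, 113, 2234, 1335, 11122]⟩, ⟨rotation 1 2, 3, [125, 1234]⟩, ⟨rotation 1 2, 4, [113,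
    3445, 2234, 11555]⟩, ⟨triple 1 2 4, 5, [224, 3444, 2555, 1334, 1245, 1222]⟩, ⟨quartic, 5,
    [1333]⟩, ⟨triple 1 2 4, 1, [2334, 2245, 33555]⟩, ⟨rotation 1 2, 1, [4555, 13444]⟩, ⟨triple 1 2
    3, 4, [2244, 1223, 12224]⟩, ⟨triple 1 2 3, 5, [2235]⟩, ⟨triple 1 2 3, 3, [3333, 11334,
    11222]⟩] (by decide +kernel) r hr
  simp only [evalSum_cons, evalSum_nil, prodEval_cons, prodEval_nil, eval_index] at h
  exact CharTwo.add_eq_zero.1 (by linear_combination h)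

/-- The series `t ^ 3 * (1 + t) / [8 s]`. -/
def polyY : Poly := lit [255, 3334, 1145, 44455, 35555, 22224, 12333, 344445, 334555, 233335,
  3344444, 3334455, 2344555, 34555555, 33334445, 23344455, 444444445, 344444555, 334455555,
  233344445, 233334555, 3344444455, 44444555555, 34455555555, 33334444555, 24444444444]

/-- With W = t² + t and V = tW, the right side is t⁴ + t³. From the quotient Y the components of 1/a
in classes 1 and 3 modulo 8 are reached by multiplying with powers of t. -/
theorem polyY_eq {r : ℤ} (hr : IsCoprime r (11 : ℕ)) : thetaAt 11 r 1 * eval 11 r polyY = eval 11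
    r polyW ^ 2 + eval 11 r polyV := by
  have h := evalSum_eq_zero (l := 11) (by decide) (by decide) [[[[1]], polyY], [polyW, polyW],
    [polyV]] [⟨quartic, 1, [3]⟩, ⟨quartic, 3, [2]⟩, ⟨quartic, 4, [1, 35]⟩, ⟨quartic, 5, [4]⟩,
    ⟨rotation 1 3, 1, [2, 2225, 233355, 223555, 2223333]⟩, ⟨rotation 1 3, 2, [4, 333, 1444,
    334444, 155555, 4445555]⟩, ⟨rotation 1 3, 5, [1, 1113]⟩, ⟨triple 1 2 4, 3, [5, 244]⟩, ⟨triple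
    1 2 4, 5, [1]⟩, ⟨rotation 1 2, 2, [45, 133, 125, 2444, 2355, 1114, 44555, 23345, 22233, 22225,
    11345, 344455, 233344, 223445, 222234, 133455, 124555, 123333, 122335, 122255, 113344, 112445,
    111333, 111235, 3344445, 3333333, 2444455, 2345555, 2333335, 2224445, 1244444, 1145555]⟩,
    ⟨rotation 1 2, 3, [33, 25, 1345, 1112, 34444, 24555, 12224, 222345, 145555, 4444555, 2222224,
    1444445, 1344555, 1113345, 1112455, 1112233, 1112225]⟩, ⟨rotation 1 2, 4, [44, 13, 255, 3334,
    1122, 44455, 35555, 23344, 14444, 11344, 223444, 124455, 122245, 122222, 113335, 111234,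
    3344444, 3334455, 2444445, 1144555, 1122455, 1111223]⟩, ⟨rotation 1 2, 5, [55, 3344, 2445,
    45555, 23444, 14455, 122344, 3444444, 2333344]⟩, ⟨triple 1 2 3, 1, [44, 335, 3334, 2345, 2223,
    44455, 22445, 13455, 12333, 11344, 245555, 233335, 223444, 223355, 122334, 122245, 112444,
    112355, 111234, 3344444, 2444445, 2233345, 2223455, 1455555, 1225555, 1144555]⟩, ⟨triple 1 2
    3, 2, [25, 234, 2244, 1345, 1223, 24555, 23333, 22335, 12445, 12224, 11333, 11235, 244444,
    234455, 223334, 222345, 123444, 123355, 122555, 4444555]⟩, ⟨triple 1 2 3, 3, [11, 224, 135,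
    2555, 33345, 24444, 23455]⟩, ⟨triple 1 2 3, 4, [55, 14, 345, 223]⟩, ⟨quartic, 2, [244]⟩,
    ⟨rotation 1 2, 1, [445, 2555, 1334, 1245, 23455, 22333, 22235, 15555, 11455, 444555, 233445,
    123335, 122355, 3345555, 3333335, 2455555, 2333355, 2234445, 1344444, 1233334]⟩, ⟨rotation 1
    3, 4, [122, 2333]⟩, ⟨triple 1 2 3, 5, [133]⟩, ⟨triple 1 2 4, 1, [134]⟩, ⟨triple 1 2 4, 2,
    [115]⟩] (by decide +kernel) r hr
  simp only [evalSum_cons, evalSum_nil, prodEval_cons, prodEval_nil, eval_index] at h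
  exact CharTwo.add_eq_zero.1 (by linear_combination h)

/-- The series `[2 s] ^ 4 + t * [4 s]`. -/
def polyE : Poly := lit [5, 244, 3333, 2255, 1445, 1224, 34455, 13444, 13355, 12555]

theorem polyE_eq {r : ℤ} (hr : IsCoprime r (11 : ℕ)) : eval 11 r polyE = thetaAt 11 r 3 ^ 4 + eval
    11 r mul5 := by
  have h := evalSum_eq_zero (l := 11) (by decide) (by decide) [[polyE], [[[3]], [[3]], [[3]],
    [[3]]], [mul5]] [] (by decide +kernel) r hr
  simp only [evalSum_cons, evalSum_nil, prodEval_cons, prodEval_nil, eval_index] at h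
  exact CharTwo.add_eq_zero.1 (by linear_combination h)

/-- The series `[2 s] + [s] ^ 4 + t * [2 s]`. -/
def polyG : Poly := lit [122]

theorem polyG_eq {r : ℤ} (hr : IsCoprime r (11 : ℕ)) : eval 11 r polyG = thetaAt 11 r 3 + thetaAt
    11 r 4 ^ 4 + eval 11 r mul3 := by
  have h := evalSum_eq_zero (l := 11) (by decide) (by decide) [[polyG], [[[3]]], [[[4]], [[4]],
    [[4]], [[4]]], [mul3]] [] (by decide +kernel) r hr
  simp only [evalSum_cons, evalSum_nil, prodEval_cons, prodEval_nil, eval_index] at h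
  exact CharTwo.add_eq_zero.1 (by linear_combination h)

/-- A quotient by `[8 s]`, see `quotE1_eq`. -/
def quotE1 : Poly := lit [225, 144]

/-- First of two divisions showing Ec²/a² ∈ S. Since E + b = c²d²/a, this gives E(E + b)/a ∈ S. -/
theorem quotE1_eq {r : ℤ} (hr : IsCoprime r (11 : ℕ)) : thetaAt 11 r 1 * eval 11 r quotE1 = eval
    11 r polyE * thetaAt 11 r 3 := by
  have h := evalSum_eq_zero (l := 11) (by decide) (by decide) [[[[1]], quotE1], [polyE, [[3]]]]
    [⟨rotation 1 2, 4, [0]⟩, ⟨triple 1 2 3, 1, [0]⟩, ⟨rotation 1 3, 1, [4]⟩, ⟨triple 1 2 3, 3,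
    [5]⟩, ⟨triple 1 2 3, 5, [3]⟩, ⟨triple 1 2 4, 3, [2]⟩, ⟨quartic, 1, [44]⟩, ⟨quartic, 2, [15]⟩,
    ⟨quartic, 4, [23]⟩] (by decide +kernel) r hr
  simp only [evalSum_cons, evalSum_nil, prodEval_cons, prodEval_nil, eval_index] at h
  exact CharTwo.add_eq_zero.1 (by linear_combination h)

/-- A quotient by `[8 s]`, see `quotE2_eq`. -/
def quotE2 : Poly := lit [22, 344, 125, 3335, 2444, 2355, 44555, 23345, 22455, 22233, 11345,
  11112]

theorem quotE2_eq {r : ℤ} (hr : IsCoprime r (11 : ℕ)) : thetaAt 11 r 1 * eval 11 r quotE2 = eval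
    11 r quotE1 * thetaAt 11 r 3 := by
  have h := evalSum_eq_zero (l := 11) (by decide) (by decide) [[[[1]], quotE2], [quotE1, [[3]]]]
    [⟨rotation 1 2, 5, [2]⟩, ⟨triple 1 2 3, 2, [4]⟩, ⟨triple 1 2 3, 4, [2]⟩, ⟨triple 1 2 4, 2,
    [5]⟩, ⟨triple 1 2 4, 3, [1]⟩, ⟨quartic, 2, [35]⟩, ⟨quartic, 4, [44]⟩] (by decide +kernel) r hr
  simp only [evalSum_cons, evalSum_nil, prodEval_cons, prodEval_nil, eval_index] at h
  exact CharTwo.add_eq_zero.1 (by linear_combination h)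

/-- A sum, see `polyTE_eq`. -/
def polyTE : Poly := lit [2335, 2255, 1445, 1135, 34455, 13444, 13355, 12555, 334445, 333555]

/-- The right side is E + tc⁴ + tb + (t² + t)b, which is (1 + t)E for E = c⁴ + tb. -/
theorem polyTE_eq {r : ℤ} (hr : IsCoprime r (11 : ℕ)) : eval 11 r polyTE = eval 11 r polyE +
    thetaAt 11 r 3 ^ 3 * eval 11 r mul3 + eval 11 r mul5 + eval 11 r polyW * thetaAt 11 r 5 := by
  have h := evalSum_eq_zero (l := 11) (by decide) (by decide) [[polyTE], [polyE], [[[3]], [[3]],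
    [[3]], mul3], [mul5], [polyW, [[5]]]] [⟨triple 1 2 3, 5, [0]⟩, ⟨quartic, 1, [1, 334]⟩, ⟨triple
    1 2 3, 4, [3]⟩, ⟨quartic, 3, [33]⟩, ⟨rotation 1 2, 3, [44]⟩, ⟨rotation 1 2, 4, [23]⟩,
    ⟨rotation 1 3, 1, [33]⟩, ⟨triple 1 2 3, 1, [11]⟩, ⟨triple 1 2 3, 2, [44]⟩, ⟨triple 1 2 3, 3,
    [12]⟩, ⟨triple 1 2 4, 3, [55]⟩] (by decide +kernel) r hr
  simp only [evalSum_cons, evalSum_nil, prodEval_cons, prodEval_nil, eval_index] at h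
  exact CharTwo.add_eq_zero.1 (by linear_combination h)

/-- A quotient by `[8 s]`, see `quotTE1_eq`. -/
def quotTE1 : Poly := lit [233, 225, 144, 1255, 1124, 33355, 24445, 23555, 333345, 233455]

/-- Dividing (1+t)Ec, and likewise (1+t)Eb, by a gives (1+t)E²/a, because one factor E is c³·c +
t·b. -/
theorem quotTE1_eq {r : ℤ} (hr : IsCoprime r (11 : ℕ)) : thetaAt 11 r 1 * eval 11 r quotTE1 = eval
    11 r polyTE * thetaAt 11 r 3 := by
  have h := evalSum_eq_zero (l := 11) (by decide) (by decide) [[[[1]], quotTE1], [polyTE, [[3]]]]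
    [⟨quartic, 2, [2]⟩, ⟨triple 1 2 3, 3, [5]⟩, ⟨triple 1 2 4, 3, [2]⟩, ⟨triple 1 2 3, 5, [3,
    24]⟩, ⟨rotation 1 3, 1, [4]⟩, ⟨quartic, 3, [12]⟩, ⟨quartic, 5, [14]⟩, ⟨quartic, 1, [13]⟩,
    ⟨quartic, 4, [23, 445]⟩, ⟨triple 1 2 3, 2, [22]⟩, ⟨triple 1 2 3, 4, [33, 25]⟩, ⟨rotation 1 2,
    5, [33]⟩, ⟨triple 1 2 4, 5, [11]⟩, ⟨rotation 1 3, 3, [15]⟩] (by decide +kernel) r hr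
  simp only [evalSum_cons, evalSum_nil, prodEval_cons, prodEval_nil, eval_index] at h
  exact CharTwo.add_eq_zero.1 (by linear_combination h)

/-- A quotient by `[8 s]`, see `quotTE2_eq`. -/
def quotTE2 : Poly := lit [4455, 2245, 2222, 1355, 34445, 25555, 22344, 13345, 12455, 11123,
  333455, 234555]

theorem quotTE2_eq {r : ℤ} (hr : IsCoprime r (11 : ℕ)) : thetaAt 11 r 1 * eval 11 r quotTE2 = eval
    11 r polyTE * thetaAt 11 r 5 := by
  have h := evalSum_eq_zero (l := 11) (by decide) (by decide) [[[[1]], quotTE2], [polyTE, [[5]]]]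
    [⟨quartic, 2, [3]⟩, ⟨quartic, 1, [2, 15]⟩, ⟨rotation 1 2, 4, [4]⟩, ⟨rotation 1 3, 4, [2]⟩,
    ⟨triple 1 2 3, 5, [5]⟩, ⟨triple 1 2 4, 3, [3]⟩, ⟨triple 1 2 3, 1, [4]⟩, ⟨quartic, 3, [44, 13,
    335]⟩, ⟨quartic, 4, [33, 155]⟩, ⟨triple 1 2 3, 3, [45]⟩, ⟨triple 1 2 4, 5, [33]⟩, ⟨rotation 1
    3, 1, [44]⟩, ⟨triple 1 2 4, 4, [15]⟩, ⟨triple 1 2 4, 1, [13]⟩] (by decide +kernel) r hr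
  simp only [evalSum_cons, evalSum_nil, prodEval_cons, prodEval_nil, eval_index] at h
  exact CharTwo.add_eq_zero.1 (by linear_combination h)

/-- The rotation relation makes aG the square of [5s][3s]. Here [3s] = a, so G is itself divisible
by a. -/
theorem polyG_factor {r : ℤ} (hr : IsCoprime r (11 : ℕ)) : eval 11 r polyG = thetaAt 11 r 1 *
    thetaAt 11 r 2 ^ 2 := by
  have h := evalSum_eq_zero (l := 11) (by decide) (by decide) [[polyG], [[[1]], [[2]], [[2]]]] []
    (by decide +kernel) r hr
  simp only [evalSum_cons, evalSum_nil, prodEval_cons, prodEval_nil, eval_index] at h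
  exact CharTwo.add_eq_zero.1 (by linear_combination h)

/-- A quotient by `[8 s]`, see `rootX_eq`. -/
def rootX : Poly := lit [445, 224]

/-- The right side is `numer` + bc²d. This and the following quotients J, R, K, C are the input of
`mem_of_root`. -/
theorem rootX_eq {r : ℤ} (hr : IsCoprime r (11 : ℕ)) : thetaAt 11 r 1 * eval 11 r rootX = thetaAt
    11 r 1 * thetaAt 11 r 4 * thetaAt 11 r 5 * thetaAt 11 r 4 + thetaAt 11 r 3 ^ 2 * thetaAt 11 r
    1 ^ 2 * thetaAt 11 r 2 * thetaAt 11 r 1 + thetaAt 11 r 3 ^ 2 * thetaAt 11 r 5 ^ 3 * thetaAt 11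
    r 3 + thetaAt 11 r 4 ^ 2 * thetaAt 11 r 1 ^ 2 * thetaAt 11 r 2 * thetaAt 11 r 3 + thetaAt 11 r
    4 ^ 2 * thetaAt 11 r 5 ^ 2 * thetaAt 11 r 2 * thetaAt 11 r 4 + thetaAt 11 r 5 * thetaAt 11 r 3
    ^ 2 * thetaAt 11 r 2 := by
  have h := evalSum_eq_zero (l := 11) (by decide) (by decide) [[[[1]], rootX], [[[1]], [[4]],
    [[5]], [[4]]], [[[3]], [[3]], [[1]], [[1]], [[2]], [[1]]], [[[3]], [[3]], [[5]], [[5]], [[5]],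
    [[3]]], [[[4]], [[4]], [[1]], [[1]], [[2]], [[3]]], [[[4]], [[4]], [[5]], [[5]], [[2]],
    [[4]]], [[[5]], [[3]], [[3]], [[2]]]] [⟨triple 1 2 3, 4, [3]⟩, ⟨triple 1 2 4, 5, [2]⟩]
    (by decide +kernel) r hr
  simp only [evalSum_cons, evalSum_nil, prodEval_cons, prodEval_nil, eval_index] at h
  exact CharTwo.add_eq_zero.1 (by linear_combination h)

/-- A quotient by `[8 s]`, see `rootJ_eq`. -/
def rootJ : Poly := lit [445, 2555, 1334, 1245, 23455, 22333, 444555, 233445]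

theorem rootJ_eq {r : ℤ} (hr : IsCoprime r (11 : ℕ)) : thetaAt 11 r 1 * eval 11 r rootJ = thetaAt
    11 r 5 * thetaAt 11 r 3 ^ 2 * thetaAt 11 r 2 + thetaAt 11 r 2 * thetaAt 11 r 3 ^ 6 := by
  have h := evalSum_eq_zero (l := 11) (by decide) (by decide) [[[[1]], rootJ], [[[5]], [[3]],
    [[3]], [[2]]], [[[2]], [[3]], [[3]], [[3]], [[3]], [[3]], [[3]]]] [⟨triple 1 2 3, 4, [3]⟩,
    ⟨rotation 1 2, 5, [3]⟩, ⟨rotation 1 3, 4, [1]⟩, ⟨triple 1 2 4, 4, [1]⟩, ⟨quartic, 4, [15]⟩,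
    ⟨quartic, 1, [35]⟩, ⟨quartic, 2, [14]⟩, ⟨triple 1 2 4, 5, [15]⟩, ⟨rotation 1 3, 1, [33]⟩]
    (by decide +kernel) r hr
  simp only [evalSum_cons, evalSum_nil, prodEval_cons, prodEval_nil, eval_index] at h
  exact CharTwo.add_eq_zero.1 (by linear_combination h)

/-- A quotient by `[8 s]`, see `rootR_eq`. -/
def rootR : Poly := lit [235, 2334, 1444, 13345, 12455, 334444, 333455, 244445, 223335, 4445555,
  3555555]

theorem rootR_eq {r : ℤ} (hr : IsCoprime r (11 : ℕ)) : thetaAt 11 r 1 * eval 11 r rootR = thetaAt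
    11 r 5 ^ 2 * thetaAt 11 r 3 ^ 4 * thetaAt 11 r 2 ^ 2 := by
  have h := evalSum_eq_zero (l := 11) (by decide) (by decide) [[[[1]], rootR], [[[5]], [[5]],
    [[3]], [[3]], [[3]], [[3]], [[2]], [[2]]]] [⟨triple 1 2 4, 2, [0, 144]⟩, ⟨quartic, 2, [3,
    24]⟩, ⟨rotation 1 2, 2, [5, 111]⟩, ⟨rotation 1 2, 4, [4, 12, 235]⟩, ⟨triple 1 2 3, 5, [5, 244,
    123]⟩, ⟨quartic, 4, [33, 25]⟩, ⟨rotation 1 2, 3, [23, 135]⟩, ⟨rotation 1 3, 1, [44, 335,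
    255]⟩, ⟨triple 1 2 3, 2, [23, 445]⟩, ⟨triple 1 2 4, 1, [44]⟩, ⟨triple 1 2 4, 4, [15]⟩,
    ⟨quartic, 1, [355, 134]⟩, ⟨quartic, 3, [335]⟩, ⟨rotation 1 3, 2, [144]⟩, ⟨triple 1 2 3, 1,
    [333, 115]⟩, ⟨triple 1 2 3, 3, [344]⟩] (by decide +kernel) r hr
  simp only [evalSum_cons, evalSum_nil, prodEval_cons, prodEval_nil, eval_index] at h
  exact CharTwo.add_eq_zero.1 (by linear_combination h)

/-- A quotient by `[8 s]`, see `rootK_eq`. -/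
def rootK : Poly := lit [2, 355, 3345, 2455, 1244, 1111, 444455, 222244]

theorem rootK_eq {r : ℤ} (hr : IsCoprime r (11 : ℕ)) : thetaAt 11 r 1 * eval 11 r rootK = thetaAt
    11 r 5 * thetaAt 11 r 3 * thetaAt 11 r 2 + eval 11 r rootR := by
  have h := evalSum_eq_zero (l := 11) (by decide) (by decide) [[[[1]], rootK], [[[5]], [[3]],
    [[2]]], [rootR]] [⟨rotation 1 2, 5, [0]⟩, ⟨quartic, 3, [3, 24]⟩, ⟨triple 1 2 3, 1, [2]⟩,
    ⟨rotation 1 3, 4, [5]⟩, ⟨triple 1 2 4, 1, [3]⟩, ⟨triple 1 2 4, 4, [5]⟩, ⟨quartic, 2, [45]⟩,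
    ⟨quartic, 5, [13]⟩, ⟨quartic, 1, [34]⟩, ⟨quartic, 4, [55]⟩, ⟨rotation 1 3, 5, [55]⟩, ⟨rotation
    1 3, 2, [44]⟩] (by decide +kernel) r hr
  simp only [evalSum_cons, evalSum_nil, prodEval_cons, prodEval_nil, eval_index] at h
  exact CharTwo.add_eq_zero.1 (by linear_combination h)

/-- A quotient by `[8 s]`, see `rootC_eq`. -/
def rootC : Poly := lit [2344, 44445, 34555, 23335, 22355, 13445, 11335]

theorem rootC_eq {r : ℤ} (hr : IsCoprime r (11 : ℕ)) : thetaAt 11 r 1 * eval 11 r rootC = thetaAt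
    11 r 3 ^ 3 * thetaAt 11 r 5 * thetaAt 11 r 4 := by
  have h := evalSum_eq_zero (l := 11) (by decide) (by decide) [[[[1]], rootC], [[[3]], [[3]],
    [[3]], [[5]], [[4]]]] [⟨quartic, 4, [5, 34]⟩, ⟨triple 1 2 4, 5, [5]⟩, ⟨triple 1 2 3, 2, [3]⟩,
    ⟨rotation 1 3, 5, [5]⟩, ⟨triple 1 2 3, 3, [2]⟩, ⟨quartic, 5, [25]⟩, ⟨quartic, 3, [55]⟩]
    (by decide +kernel) r hr
  simp only [evalSum_cons, evalSum_nil, prodEval_cons, prodEval_nil, eval_index] at h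
  exact CharTwo.add_eq_zero.1 (by linear_combination h)

end Eleven

/-! ### Certified divisions by a = [r] for l = 13, where b = [6r], c = [3r], d = [4r], e = [5r]. -/

namespace Thirteen

/-- The rotation relations. -/
def rotation (A B : ℕ) : Relation 13 := rot 13 (by decide) A B

/-- The triple rotation relations. -/
def triple (A B D : ℕ) : Relation 13 := tri 13 (by decide) A B D

/-- An auxiliary relation. -/
def quarticA : Relation 13 := .ofCheck (by decide) (by decide) (lit [26, 146, 115, 3445, 3356,
    2244, 1256, 1134]) [⟨rotation 1 3, 1, [0]⟩, ⟨triple 1 2 5, 3, [0]⟩, ⟨rotation 1 5, 4, [1, 333,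
    115]⟩, ⟨triple 1 2 4, 4, [3]⟩, ⟨triple 1 2 4, 2, [4, 366]⟩, ⟨triple 1 3 4, 1, [1, 333]⟩,
    ⟨rotation 1 3, 5, [11, 344]⟩, ⟨triple 1 2 5, 4, [33, 445]⟩, ⟨triple 1 2 3, 6, [23, 134]⟩,
    ⟨triple 1 3 4, 2, [455, 123]⟩, ⟨rotation 1 2, 3, [111]⟩, ⟨triple 1 2 4, 3, [116]⟩, ⟨rotation 1
    5, 1, [333, 123]⟩, ⟨triple 1 2 4, 5, [355, 144]⟩, ⟨triple 1 2 3, 4, [336, 255]⟩, ⟨rotation 1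
    2, 6, [233]⟩, ⟨triple 1 2 3, 3, [666]⟩, ⟨rotation 1 5, 2, [455]⟩, ⟨triple 1 2 3, 5, [226]⟩,
    ⟨triple 1 2 5, 6, [244]⟩] (by decide +kernel)

/-- An auxiliary relation. -/
def quarticB : Relation 13 := .ofCheck (by decide) (by decide) (lit [344, 126, 4456, 3566, 2345,
    1455, 1333, 1115]) [⟨quarticA, 1, [1, 455, 123]⟩, ⟨triple 1 2 3, 2, [5]⟩, ⟨triple 1 2 4, 4,
    [6]⟩, ⟨rotation 1 3, 5, [4]⟩, ⟨triple 1 2 5, 2, [4]⟩, ⟨quarticA, 2, [16, 266, 224, 113]⟩,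
    ⟨quarticA, 5, [25, 446, 366]⟩, ⟨rotation 1 3, 6, [33]⟩, ⟨triple 1 2 3, 6, [26]⟩, ⟨triple 1 2
    3, 1, [16]⟩, ⟨triple 1 2 3, 4, [25]⟩, ⟨triple 1 2 3, 5, [44]⟩, ⟨quarticA, 6, [445, 356, 226]⟩,
    ⟨quarticA, 4, [235, 155]⟩] (by decide +kernel)

/-- An auxiliary relation. -/
def quarticC : Relation 13 := .ofCheck (by decide) (by decide) (lit [46, 256, 134, 4466, 3666,
    2444, 2233, 1456]) [⟨rotation 1 5, 2, [0, 46, 15]⟩, ⟨quarticA, 5, [1, 26, 333]⟩, ⟨quarticA, 2,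
    [3]⟩, ⟨triple 1 2 5, 4, [2, 14]⟩, ⟨rotation 1 3, 3, [2]⟩, ⟨triple 1 2 5, 5, [4]⟩, ⟨triple 1 2
    3, 4, [1]⟩, ⟨triple 1 2 5, 3, [5]⟩, ⟨rotation 1 3, 5, [1]⟩, ⟨quarticA, 4, [13]⟩, ⟨quarticB, 5,
    [45]⟩, ⟨quarticB, 2, [33, 12]⟩, ⟨quarticB, 6, [44]⟩, ⟨triple 1 2 4, 5, [36]⟩, ⟨rotation 1 2,
    5, [66]⟩, ⟨triple 1 3 4, 2, [23]⟩, ⟨triple 1 2 3, 3, [25]⟩, ⟨triple 1 2 4, 1, [24]⟩, ⟨triple 1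
    2 4, 3, [55]⟩, ⟨rotation 1 2, 1, [44]⟩, ⟨triple 1 3 4, 1, [23]⟩, ⟨quarticA, 3, [125]⟩,
    ⟨quarticA, 1, [222]⟩] (by decide +kernel)

/-- The product of `[4 s] ^ 4 / [8 s]` and the theta series with index `2`. -/
def mul2 : Poly := lit [2, 14, 335, 246, 223, 4455, 1446, 1145, 1111, 46666, 34445, 24555, 23666,
  23335, 15666]

theorem mul2_eq {r : ℤ} (hr : IsCoprime r (13 : ℕ)) : thetaAt 13 r 1 * eval 13 r mul2 = thetaAt 13
    r 6 ^ 4 * thetaAt 13 r 2 := by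
  have h := evalSum_eq_zero (l := 13) (by decide) (by decide) [[[[1]], mul2], [[[6]], [[6]],
    [[6]], [[6]], [[2]]]] [⟨quarticB, 3, [0, 46]⟩, ⟨rotation 1 2, 6, [0]⟩, ⟨triple 1 2 4, 4, [0,
    46]⟩, ⟨quarticA, 1, [2, 14, 246]⟩, ⟨quarticA, 2, [1, 455]⟩, ⟨quarticA, 3, [3, 56, 346]⟩,
    ⟨rotation 1 2, 4, [6]⟩, ⟨rotation 1 3, 1, [2]⟩, ⟨rotation 1 3, 2, [1]⟩, ⟨triple 1 2 3, 1, [1,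
    26]⟩, ⟨triple 1 2 3, 5, [3]⟩, ⟨triple 1 2 3, 6, [2]⟩, ⟨triple 1 2 4, 3, [4]⟩, ⟨quarticA, 4,
    [45, 11]⟩, ⟨quarticA, 5, [44, 36]⟩, ⟨quarticB, 1, [25]⟩, ⟨quarticB, 6, [55]⟩, ⟨quarticC, 1,
    [33]⟩, ⟨rotation 1 3, 5, [36]⟩, ⟨triple 1 2 3, 2, [45]⟩, ⟨triple 1 2 3, 3, [22]⟩, ⟨triple 1 2
    4, 5, [16]⟩, ⟨triple 1 2 4, 6, [13]⟩, ⟨triple 1 2 5, 1, [11]⟩] (by decide +kernel) r hr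
  simp only [evalSum_cons, evalSum_nil, prodEval_cons, prodEval_nil, eval_index] at h
  exact CharTwo.add_eq_zero.1 (by linear_combination h)

/-- The product of `[4 s] ^ 4 / [8 s]` and the theta series with index `3`. -/
def mul3 : Poly := lit [3, 122, 5555]

theorem mul3_eq {r : ℤ} (hr : IsCoprime r (13 : ℕ)) : thetaAt 13 r 1 * eval 13 r mul3 = thetaAt 13
    r 6 ^ 4 * thetaAt 13 r 3 := by
  have h := evalSum_eq_zero (l := 13) (by decide) (by decide) [[[[1]], mul3], [[[6]], [[6]],
    [[6]], [[6]], [[3]]]] [⟨rotation 1 3, 6, [0]⟩] (by decide +kernel) r hr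
  simp only [evalSum_cons, evalSum_nil, prodEval_cons, prodEval_nil, eval_index] at h
  exact CharTwo.add_eq_zero.1 (by linear_combination h)

/-- The product of `[4 s] ^ 4 / [8 s]` and the theta series with index `4`. -/
def mul4 : Poly := lit [25, 366, 234, 3355, 2222, 1336, 1255, 34666, 33345, 23446, 23366, 22556,
  11123]

theorem mul4_eq {r : ℤ} (hr : IsCoprime r (13 : ℕ)) : thetaAt 13 r 1 * eval 13 r mul4 = thetaAt 13
    r 6 ^ 4 * thetaAt 13 r 4 := by
  have h := evalSum_eq_zero (l := 13) (by decide) (by decide) [[[[1]], mul4], [[[6]], [[6]],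
    [[6]], [[6]], [[4]]]] [⟨quarticA, 2, [0, 46, 15, 256, 134]⟩, ⟨rotation 1 3, 2, [0]⟩, ⟨triple 1
    2 3, 1, [0, 46]⟩, ⟨quarticA, 1, [4, 25, 446, 366]⟩, ⟨quarticB, 6, [6]⟩, ⟨rotation 1 5, 1,
    [2]⟩, ⟨triple 1 2 3, 2, [1]⟩, ⟨triple 1 2 4, 6, [3]⟩, ⟨triple 1 2 5, 1, [1]⟩, ⟨triple 1 3 4,
    1, [2]⟩, ⟨quarticA, 3, [35]⟩, ⟨quarticA, 6, [66]⟩, ⟨quarticB, 2, [56]⟩, ⟨rotation 1 2, 2,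
    [11]⟩, ⟨rotation 1 2, 4, [56]⟩, ⟨rotation 1 2, 5, [55]⟩, ⟨triple 1 2 3, 4, [33]⟩, ⟨triple 1 2
    3, 5, [35]⟩, ⟨triple 1 2 3, 6, [25]⟩, ⟨triple 1 2 4, 1, [55]⟩, ⟨triple 1 2 4, 2, [44]⟩,
    ⟨triple 1 2 4, 4, [34]⟩, ⟨quarticA, 4, [455]⟩] (by decide +kernel) r hr
  simp only [evalSum_cons, evalSum_nil, prodEval_cons, prodEval_nil, eval_index] at h
  exact CharTwo.add_eq_zero.1 (by linear_combination h)

/-- The product of `[4 s] ^ 4 / [8 s]` and the theta series with index `5`. -/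
def mul5 : Poly := lit [235, 155, 116, 3446, 2556, 1266, 45555, 33355, 22666, 22246, 13336]

theorem mul5_eq {r : ℤ} (hr : IsCoprime r (13 : ℕ)) : thetaAt 13 r 1 * eval 13 r mul5 = thetaAt 13
    r 6 ^ 4 * thetaAt 13 r 5 := by
  have h := evalSum_eq_zero (l := 13) (by decide) (by decide) [[[[1]], mul5], [[[6]], [[6]],
    [[6]], [[6]], [[5]]]] [⟨triple 1 3 4, 1, [0, 46, 23]⟩, ⟨quarticA, 5, [1]⟩, ⟨quarticA, 4, [6,
    466]⟩, ⟨rotation 1 3, 6, [4]⟩, ⟨triple 1 2 3, 4, [1]⟩, ⟨triple 1 2 3, 6, [5, 34]⟩, ⟨triple 1 2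
    5, 2, [1]⟩, ⟨triple 1 2 3, 5, [2]⟩, ⟨triple 1 2 3, 2, [6, 13]⟩, ⟨triple 1 2 3, 1, [3, 56]⟩,
    ⟨triple 1 2 5, 5, [4, 25]⟩, ⟨triple 1 2 5, 6, [3]⟩, ⟨quarticC, 1, [46, 15]⟩, ⟨quarticB, 4,
    [24]⟩, ⟨quarticC, 2, [46]⟩, ⟨quarticC, 4, [15, 256]⟩, ⟨quarticA, 3, [14, 666]⟩, ⟨rotation 1 5,
    4, [46, 23]⟩, ⟨triple 1 2 3, 3, [25]⟩, ⟨triple 1 3 4, 2, [15]⟩, ⟨rotation 1 2, 3, [11]⟩,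
    ⟨triple 1 2 5, 1, [13]⟩, ⟨rotation 1 2, 2, [16]⟩, ⟨triple 1 2 4, 4, [22]⟩, ⟨triple 1 2 4, 3,
    [55]⟩, ⟨quarticB, 6, [566]⟩, ⟨quarticB, 3, [166, 124]⟩] (by decide +kernel) r hr
  simp only [evalSum_cons, evalSum_nil, prodEval_cons, prodEval_nil, eval_index] at h
  exact CharTwo.add_eq_zero.1 (by linear_combination h)

/-- The product of `[4 s] ^ 4 / [8 s]` and the theta series with index `6`. -/
def mul6 : Poly := lit [6, 236, 3455, 2245, 1135, 45556, 44666, 33356, 23555, 23466, 22344, 22336,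
  12356]

theorem mul6_eq {r : ℤ} (hr : IsCoprime r (13 : ℕ)) : thetaAt 13 r 1 * eval 13 r mul6 = thetaAt 13
    r 6 ^ 4 * thetaAt 13 r 6 := by
  have h := evalSum_eq_zero (l := 13) (by decide) (by decide) [[[[1]], mul6], [[[6]], [[6]],
    [[6]], [[6]], [[6]]]] [⟨rotation 1 2, 3, [0]⟩, ⟨triple 1 2 4, 2, [0, 15]⟩, ⟨quarticB, 6, [2]⟩,
    ⟨quarticA, 1, [6]⟩, ⟨quarticB, 1, [3, 135]⟩, ⟨rotation 1 2, 2, [3, 56]⟩, ⟨rotation 1 3, 1,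
    [6]⟩, ⟨triple 1 2 4, 5, [2]⟩, ⟨quarticA, 4, [22]⟩, ⟨quarticB, 5, [46, 15]⟩, ⟨quarticB, 3,
    [44]⟩, ⟨quarticB, 2, [25, 234]⟩, ⟨rotation 1 3, 3, [11]⟩, ⟨triple 1 2 5, 6, [66, 24]⟩, ⟨triple
    1 2 4, 3, [56]⟩, ⟨triple 1 2 4, 6, [25]⟩, ⟨triple 1 2 4, 1, [33, 12]⟩, ⟨triple 1 2 5, 1,
    [35]⟩, ⟨triple 1 3 4, 2, [55]⟩, ⟨triple 1 2 3, 2, [35]⟩, ⟨rotation 1 5, 2, [55, 16]⟩, ⟨triple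
    1 2 3, 5, [11]⟩, ⟨triple 1 2 5, 2, [34]⟩, ⟨triple 1 2 4, 4, [44]⟩, ⟨quarticB, 4, [445]⟩,
    ⟨quarticA, 3, [336]⟩] (by decide +kernel) r hr
  simp only [evalSum_cons, evalSum_nil, prodEval_cons, prodEval_nil, eval_index] at h
  exact CharTwo.add_eq_zero.1 (by linear_combination h)

/-- The series `t ^ 2 + t`, where `t = [4 s] ^ 4 / [8 s]`. -/
def polyW : Poly := lit [46, 23, 15, 256, 4555, 4466, 2233, 1222, 56666, 34455, 33556, 33334,
  25555, 24566, 22445, 13446, 445556, 444666, 334445, 234466]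

theorem polyW_eq {r : ℤ} (hr : IsCoprime r (13 : ℕ)) : thetaAt 13 r 1 * eval 13 r polyW = thetaAt
    13 r 6 ^ 3 * eval 13 r mul6 + thetaAt 13 r 6 ^ 4 := by
  have h := evalSum_eq_zero (l := 13) (by decide) (by decide) [[[[1]], polyW], [[[6]], [[6]],
    [[6]], mul6], [[[6]], [[6]], [[6]], [[6]]]] [⟨triple 1 2 5, 3, [0]⟩, ⟨rotation 1 2, 3, [4,
    234, 145]⟩, ⟨rotation 1 3, 2, [6, 13, 466, 156]⟩, ⟨rotation 1 3, 6, [2]⟩, ⟨rotation 1 5, 4,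
    [1, 115]⟩, ⟨triple 1 2 3, 3, [2, 14, 335]⟩, ⟨triple 1 2 4, 2, [4, 446, 366, 145, 111]⟩,
    ⟨triple 1 2 4, 3, [5, 222, 116]⟩, ⟨triple 1 2 5, 6, [6]⟩, ⟨quarticA, 1, [46, 256, 134, 4555,
    4466]⟩, ⟨quarticA, 5, [45]⟩, ⟨quarticB, 2, [44]⟩, ⟨rotation 1 2, 1, [66, 144]⟩, ⟨rotation 1 3,
    5, [11]⟩, ⟨triple 1 2 3, 4, [11, 336]⟩, ⟨triple 1 2 4, 1, [22, 556, 334, 166]⟩, ⟨triple 1 2 4,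
    4, [56, 122]⟩, ⟨triple 1 2 4, 5, [24, 225]⟩, ⟨quarticA, 2, [466, 156]⟩, ⟨quarticA, 3, [356]⟩,
    ⟨quarticA, 4, [224]⟩, ⟨rotation 1 2, 2, [116]⟩, ⟨rotation 1 2, 4, [566, 112]⟩, ⟨rotation 1 2,
    5, [556, 124]⟩, ⟨rotation 1 2, 6, [135]⟩, ⟨rotation 1 3, 3, [226]⟩, ⟨rotation 1 3, 4, [113]⟩,
    ⟨triple 1 2 3, 1, [555]⟩, ⟨triple 1 2 3, 2, [345, 266, 224]⟩, ⟨triple 1 2 3, 5, [445]⟩,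
    ⟨triple 1 2 3, 6, [256]⟩, ⟨triple 1 2 4, 6, [566]⟩] (by decide +kernel) r hr
  simp only [evalSum_cons, evalSum_nil, prodEval_cons, prodEval_nil, eval_index] at h
  exact CharTwo.add_eq_zero.1 (by linear_combination h)

/-- The series `t * W`. -/
def polyV : Poly := lit [23, 15, 134, 4466, 3335, 2444, 1222, 56666, 25555, 22445, 445556, 444666,
  346666, 4444455, 3355555, 3345566, 44555555, 35555556, 34555666, 33345555, 455556666, 444444556,
  344455555, 334455666]

theorem polyV_eq {r : ℤ} (hr : IsCoprime r (13 : ℕ)) : thetaAt 13 r 1 * eval 13 r polyV = thetaAt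
    13 r 6 ^ 4 * eval 13 r polyW := by
  have h := evalSum_eq_zero (l := 13) (by decide) (by decide) [[[[1]], polyV], [[[6]], [[6]],
    [[6]], [[6]], polyW]] [⟨triple 1 2 5, 3, [0, 23, 3666, 11345]⟩, ⟨quarticB, 1, [5, 116]⟩,
    ⟨quarticB, 3, [3]⟩, ⟨triple 1 2 5, 6, [6, 13, 466, 236, 3455, 2566, 1122, 36666, 22344,
    11166]⟩, ⟨rotation 1 3, 2, [6, 13, 244, 3333, 45556, 23466]⟩, ⟨rotation 1 5, 4, [1, 146, 2244,
    2236, 1256, 1134, 22566, 11222, 11155]⟩, ⟨triple 1 2 3, 1, [6, 13, 555, 466, 1444, 1346]⟩,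
    ⟨rotation 1 5, 1, [1, 123, 115, 2236, 14555]⟩, ⟨triple 1 2 4, 2, [4, 366, 234, 5666, 1344,
    1255, 1126, 33345, 11455]⟩, ⟨quarticA, 6, [14, 1111]⟩, ⟨quarticC, 4, [26]⟩, ⟨quarticA, 1, [46,
    23, 256]⟩, ⟨quarticB, 4, [35, 166]⟩, ⟨quarticA, 3, [33]⟩, ⟨rotation 1 3, 3, [33, 5566, 2333,
    1335, 1246, 34566, 14455]⟩, ⟨triple 1 2 4, 4, [56, 346, 135, 122, 1334, 12223, 11355]⟩,
    ⟨rotation 1 2, 5, [35, 556, 166, 124, 2223]⟩, ⟨rotation 1 3, 4, [16, 25556]⟩, ⟨triple 1 2 5,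
    2, [45, 344, 255, 1455, 33466, 12466]⟩, ⟨triple 1 2 3, 4, [45, 11, 4456, 1333, 1146, 23336,
    12244, 12236]⟩, ⟨triple 1 2 3, 5, [33, 114, 3444, 3346, 44456, 34566, 26666, 14455, 11366,
    11111]⟩, ⟨triple 1 2 4, 5, [66, 24, 225, 136, 1133]⟩, ⟨rotation 1 2, 3, [25, 5666, 2456, 2222,
    1344, 22556, 12266]⟩, ⟨triple 1 2 4, 6, [36, 245, 112, 3555, 1356, 45666, 22266]⟩, ⟨triple 1 2
    3, 6, [23, 256, 134, 3335, 2233, 13366]⟩, ⟨triple 1 2 3, 2, [16, 345, 266, 2355, 1555, 66666,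
    22234]⟩, ⟨quarticA, 2, [244, 236]⟩, ⟨quarticC, 1, [115]⟩, ⟨quarticA, 5, [336, 2345]⟩,
    ⟨quarticB, 6, [355]⟩, ⟨quarticA, 4, [113, 13455]⟩, ⟨rotation 1 5, 2, [123, 115, 14555,
    13666]⟩, ⟨rotation 1 2, 2, [155, 116, 1266, 12225]⟩, ⟨triple 1 2 5, 5, [666, 223, 125, 4455,
    34445]⟩, ⟨rotation 1 2, 4, [566, 133, 112, 2336]⟩, ⟨triple 1 2 5, 4, [114, 2333, 35555,
    26666]⟩, ⟨triple 1 3 4, 2, [455, 333, 3356, 2466, 33346, 11116]⟩, ⟨rotation 1 3, 6, [335,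
    3556, 3334, 1366, 1234, 33456]⟩, ⟨triple 1 3 4, 1, [333, 146, 123, 2236, 23333, 22566,
    14555]⟩, ⟨triple 1 2 4, 1, [334, 124, 2666, 11566]⟩, ⟨triple 1 2 4, 3, [222, 155, 116, 3366,
    1266, 35666, 24445, 22335]⟩, ⟨rotation 1 2, 6, [444, 135, 122, 12246, 11355]⟩, ⟨rotation 1 2,
    1, [136, 12255]⟩, ⟨rotation 1 3, 5, [4456, 1123, 16666, 13445, 12555]⟩, ⟨triple 1 2 3, 3,
    [1446, 33456]⟩, ⟨triple 1 2 5, 1, [4556, 1555, 66666]⟩, ⟨rotation 1 3, 1, [4466, 3335,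
    25555]⟩] (by decide +kernel) r hr
  simp only [evalSum_cons, evalSum_nil, prodEval_cons, prodEval_nil, eval_index] at h
  exact CharTwo.add_eq_zero.1 (by linear_combination h)

/-- The series `t * (1 + t) ^ 3 / [8 s]`. -/
def polyY : Poly := lit [235, 222, 3446, 2334, 1345, 1266, 1113, 45555, 24445, 23456, 22666,
  22335, 22246, 13336, 556666, 444446, 344555, 344466, 335556, 245566, 4455556, 3555566, 44444555,
  44444466, 33455566, 445555555, 444456666, 355555556, 345555666, 333445566, 4455666666,
  4444444666, 46666666666, 44455555556, 44445555666, 44444566666]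

/-- With W = t² + t and V = tW, the right side is t + t² + t³ + t⁴ = t(1 + t)³. -/
theorem polyY_eq {r : ℤ} (hr : IsCoprime r (13 : ℕ)) : thetaAt 13 r 1 * eval 13 r polyY = eval 13
    r polyW + eval 13 r polyW ^ 2 + eval 13 r polyV := by
  have h := evalSum_eq_zero (l := 13) (by decide) (by decide) [[[[1]], polyY], [polyW], [polyW,
    polyW], [polyV]] [⟨quarticC, 4, [0, 256, 2346, 1235]⟩, ⟨quarticC, 2, [0, 4555]⟩, ⟨quarticC, 1,
    [0, 46, 15]⟩, ⟨triple 1 3 4, 1, [0, 23, 15, 4466, 1222, 22356, 11113, 122666, 122335, 2244456,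
    1224455, 1124666, 1122366]⟩, ⟨rotation 1 5, 4, [0, 2346, 1456, 14444, 445556, 444666, 244446,
    233666, 223444, 2334455, 1334666, 1233446, 1112566, 1112245]⟩, ⟨rotation 1 5, 1, [0, 23, 15,
    2444, 2233, 1456, 1222, 1116, 13446, 13366, 11345, 11113, 222333, 122666, 4444455]⟩,
    ⟨quarticA, 5, [1, 26, 455]⟩, ⟨rotation 1 3, 4, [6, 555, 3455, 2566, 23555, 22255, 12356,
    144446, 125566, 4555555, 1334455, 1333556, 1222555, 1115556]⟩, ⟨triple 1 2 5, 6, [3, 56, 2356,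
    34466, 22333, 14445, 223356, 133446, 115556, 111112, 2334555, 1122222]⟩, ⟨triple 1 2 3, 5, [2,
    14, 223, 4455, 1145, 12456, 12235, 11344, 11336, 233334, 222445, 2223444, 1112466]⟩, ⟨triple 1
    2 3, 1, [3, 56, 346, 122, 1334, 34466, 25566, 13456, 11136, 134444, 113345, 111566, 3444666,
    2233346, 1114446, 1112336]⟩, ⟨triple 1 2 5, 3, [5, 235, 155, 22666, 444446, 222256, 112245,
    4445666, 2666666, 1455555, 1344444, 1145556, 1111556]⟩, ⟨rotation 1 3, 2, [3, 444, 346, 233,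
    135, 122, 5555, 4566, 1556, 34555, 455556, 244456, 223356, 114666, 2455666, 1123355]⟩, ⟨triple
    1 2 5, 5, [4, 446, 145, 1336, 1126, 23366, 12266, 11146, 11123, 456666, 112555, 4444666,
    2224455, 1123455]⟩, ⟨triple 1 2 5, 4, [2, 4455, 3334, 12235, 234455, 3335666, 1124556]⟩,
    ⟨triple 1 2 3, 6, [5, 3366, 1113, 13344, 12355, 334666, 123345, 1123466, 1114566]⟩, ⟨quarticB,
    5, [11]⟩, ⟨quarticB, 2, [33, 356, 226]⟩, ⟨quarticB, 1, [55, 224]⟩, ⟨rotation 1 5, 2, [46, 23,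
    15, 256, 2233, 14444, 144566]⟩, ⟨triple 1 2 4, 4, [35, 556, 124, 2246, 2223, 55555, 666666,
    144455, 134556, 123355, 122456, 112255, 111445, 111226, 1133455, 1113444]⟩, ⟨triple 1 2 4, 5,
    [44, 112, 3466, 2336, 33333, 24456, 22266, 13346, 345556, 255666, 135555, 113556, 1222566,
    1111336]⟩, ⟨triple 1 2 4, 2, [45, 11, 255, 44444, 23336, 345666, 133444, 122245, 112233,
    2334446, 1122445]⟩, ⟨triple 1 3 4, 2, [46, 4466, 2346, 1456, 1116, 25555, 13366, 113344,
    1444446, 1334666, 1245566, 1124666, 1111135]⟩, ⟨triple 1 2 4, 1, [24, 2446, 14446, 13466,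
    12336, 222334, 115566, 111246, 111125, 4444556, 1224556, 1134566, 1122466]⟩, ⟨rotation 1 2, 2,
    [16, 345, 266, 4556, 1555, 1236, 13333, 122336, 3333455]⟩, ⟨rotation 1 2, 3, [11, 336, 255,
    3566, 1146, 55666, 113666, 1466666]⟩, ⟨triple 1 2 4, 6, [33, 445, 356, 1666, 1223, 13556,
    333666, 222245, 123335, 122233, 112456, 2224446, 1333446, 1135556, 1113566, 1112266,
    1111123]⟩, ⟨triple 1 2 3, 3, [25, 145, 3355, 2222, 1255, 34666, 23446, 11146, 334556, 222246,
    134446, 4445556, 1224666, 1222366, 1133346]⟩, ⟨rotation 1 2, 5, [66, 225, 1566, 1133, 44455,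
    14446, 11356, 11114, 344445, 111666]⟩, ⟨quarticA, 1, [222]⟩, ⟨quarticA, 6, [366]⟩, ⟨quarticA,
    3, [335]⟩, ⟨quarticB, 4, [144]⟩, ⟨rotation 1 3, 1, [235, 222, 1113, 35666, 14556, 11236,
    334666, 124666, 112245, 1455555]⟩, ⟨rotation 1 3, 6, [446, 366, 35556, 12345, 11146, 11115,
    334556, 122355, 2344466, 1345666, 1133444]⟩, ⟨rotation 1 3, 5, [333, 3356, 2555, 33444,
    344456, 335555, 1122335, 1122223, 1113344]⟩, ⟨triple 1 2 4, 3, [266, 2355, 1236, 12245,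
    222456, 144666, 111556, 2223446]⟩, ⟨triple 1 2 3, 2, [466, 2566, 1135, 15555, 14566, 245666,
    144446, 111225, 1445666, 1112234]⟩, ⟨rotation 1 3, 3, [666, 334444, 2233666, 1112555]⟩,
    ⟨triple 1 2 3, 4, [115, 6666, 2555, 2236, 1256, 33444, 14466, 133556, 122445, 112334, 1145555,
    1112355]⟩, ⟨quarticB, 6, [1114]⟩, ⟨rotation 1 2, 4, [5566, 1666, 11234, 133456, 115666,
    113355, 1334444]⟩, ⟨triple 1 2 5, 2, [2244, 33444, 33346, 22245, 11222, 335555, 222344,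
    222336, 113366, 111266, 111224, 2344556, 1223346, 1144566, 1122246, 1112225]⟩, ⟨rotation 1 2,
    1, [1356, 45666, 33333, 11125, 344666, 333356, 134566, 2445555, 1344446, 1333666, 1123335]⟩,
    ⟨triple 1 2 5, 1, [1233, 1122, 12356, 11556, 11166, 4555555, 4455566, 3344456, 1445666,
    1112366, 1111245]⟩, ⟨rotation 1 2, 6, [2335, 55555, 33446, 14666, 12234, 11245, 11133, 335666,
    255566, 222233, 122456, 1122345, 1112333]⟩] (by decide +kernel) r hr
  simp only [evalSum_cons, evalSum_nil, prodEval_cons, prodEval_nil, eval_index] at h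
  exact CharTwo.add_eq_zero.1 (by linear_combination h)

/-- The series `[2 s] ^ 4 + t * [4 s]`. -/
def polyE : Poly := lit [6, 236, 3455, 3333, 2245, 1135, 45556, 44666, 33356, 23555, 23466, 22344,
  22336, 12356]

theorem polyE_eq {r : ℤ} (hr : IsCoprime r (13 : ℕ)) : eval 13 r polyE = thetaAt 13 r 3 ^ 4 + eval
    13 r mul6 := by
  have h := evalSum_eq_zero (l := 13) (by decide) (by decide) [[polyE], [[[3]], [[3]], [[3]],
    [[3]]], [mul6]] [] (by decide +kernel) r hr
  simp only [evalSum_cons, evalSum_nil, prodEval_cons, prodEval_nil, eval_index] at h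
  exact CharTwo.add_eq_zero.1 (by linear_combination h)

/-- The series `[2 s] + [s] ^ 4 + t * [2 s]`. -/
def polyG : Poly := lit [122]

theorem polyG_eq {r : ℤ} (hr : IsCoprime r (13 : ℕ)) : eval 13 r polyG = thetaAt 13 r 3 + thetaAt
    13 r 5 ^ 4 + eval 13 r mul3 := by
  have h := evalSum_eq_zero (l := 13) (by decide) (by decide) [[polyG], [[[3]]], [[[5]], [[5]],
    [[5]], [[5]]], [mul3]] [] (by decide +kernel) r hr
  simp only [evalSum_cons, evalSum_nil, prodEval_cons, prodEval_nil, eval_index] at h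
  exact CharTwo.add_eq_zero.1 (by linear_combination h)

/-- A quotient by `[8 s]`, see `quotE1_eq`. -/
def quotE1 : Poly := lit [35, 22, 334, 2335, 1355, 55555, 33366, 23334, 22256, 11112]

/-- First of three divisions showing Ec⁴d²/a³ ∈ S; times d² this is E(E + b)²/a. -/
theorem quotE1_eq {r : ℤ} (hr : IsCoprime r (13 : ℕ)) : thetaAt 13 r 1 * eval 13 r quotE1 = eval
    13 r polyE * thetaAt 13 r 3 * thetaAt 13 r 4 := by
  have h := evalSum_eq_zero (l := 13) (by decide) (by decide) [[[[1]], quotE1], [polyE, [[3]],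
    [[4]]]] [⟨triple 1 2 3, 5, [0, 46]⟩, ⟨quarticA, 5, [6, 236]⟩, ⟨quarticA, 6, [5]⟩, ⟨quarticC,
    1, [3]⟩, ⟨rotation 1 2, 5, [4]⟩, ⟨rotation 1 2, 6, [2]⟩, ⟨rotation 1 3, 5, [6]⟩, ⟨triple 1 2
    3, 3, [5]⟩, ⟨triple 1 2 3, 4, [6]⟩, ⟨triple 1 2 5, 5, [5]⟩, ⟨quarticA, 2, [33, 445, 226]⟩,
    ⟨quarticA, 3, [46]⟩, ⟨quarticB, 5, [55]⟩, ⟨rotation 1 2, 2, [66]⟩, ⟨rotation 1 3, 2, [33]⟩,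
    ⟨triple 1 2 3, 1, [33]⟩, ⟨triple 1 2 3, 2, [44, 36]⟩, ⟨triple 1 2 4, 2, [16]⟩, ⟨triple 1 2 4,
    4, [14]⟩, ⟨triple 1 2 4, 5, [45]⟩, ⟨triple 1 2 5, 1, [44, 36]⟩, ⟨triple 1 2 5, 6, [12]⟩,
    ⟨triple 1 3 4, 1, [56]⟩, ⟨quarticA, 1, [556, 334, 166]⟩, ⟨quarticA, 4, [245]⟩]
    (by decide +kernel) r hr
  simp only [evalSum_cons, evalSum_nil, prodEval_cons, prodEval_nil, eval_index] at h
  exact CharTwo.add_eq_zero.1 (by linear_combination h)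

/-- A quotient by `[8 s]`, see `quotE2_eq`. -/
def quotE2 : Poly := lit [456, 235, 3446, 2556, 2334, 1345, 44566, 22246, 13344, 13336]

theorem quotE2_eq {r : ℤ} (hr : IsCoprime r (13 : ℕ)) : thetaAt 13 r 1 * eval 13 r quotE2 = eval
    13 r quotE1 * thetaAt 13 r 3 ^ 2 := by
  have h := evalSum_eq_zero (l := 13) (by decide) (by decide) [[[[1]], quotE2], [quotE1, [[3]],
    [[3]]]] [⟨triple 1 3 4, 1, [0, 23]⟩, ⟨triple 1 3 4, 2, [0, 23]⟩, ⟨rotation 1 3, 6, [4]⟩,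
    ⟨triple 1 2 3, 4, [1]⟩, ⟨triple 1 2 3, 3, [4]⟩, ⟨triple 1 2 3, 6, [5, 34]⟩, ⟨rotation 1 3, 1,
    [5, 34]⟩, ⟨triple 1 2 5, 2, [1]⟩, ⟨triple 1 2 3, 5, [2]⟩, ⟨triple 1 2 5, 5, [4, 25]⟩,
    ⟨quarticB, 5, [11]⟩, ⟨quarticB, 3, [35]⟩, ⟨quarticA, 2, [56]⟩, ⟨quarticA, 5, [26, 455, 333,
    146]⟩, ⟨quarticC, 1, [46, 15]⟩, ⟨quarticC, 4, [46]⟩, ⟨quarticB, 4, [24, 355]⟩, ⟨quarticA, 3,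
    [14, 335]⟩, ⟨quarticA, 4, [13, 466]⟩, ⟨triple 1 2 4, 4, [35, 22]⟩, ⟨triple 1 2 4, 5, [36]⟩,
    ⟨rotation 1 5, 1, [46, 23]⟩, ⟨triple 1 2 4, 1, [24]⟩, ⟨triple 1 2 5, 3, [34]⟩, ⟨triple 1 2 5,
    6, [56]⟩, ⟨rotation 1 2, 4, [33]⟩, ⟨rotation 1 5, 2, [46]⟩, ⟨triple 1 2 4, 3, [55]⟩, ⟨triple 1
    2 3, 2, [13]⟩] (by decide +kernel) r hr
  simp only [evalSum_cons, evalSum_nil, prodEval_cons, prodEval_nil, eval_index] at h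
  exact CharTwo.add_eq_zero.1 (by linear_combination h)

/-- A quotient by `[8 s]`, see `quotE3_eq`. -/
def quotE3 : Poly := lit [244, 156, 1135, 33445, 22336, 566666, 344556, 255556]

theorem quotE3_eq {r : ℤ} (hr : IsCoprime r (13 : ℕ)) : thetaAt 13 r 1 * eval 13 r quotE3 = eval
    13 r quotE2 * thetaAt 13 r 3 * thetaAt 13 r 4 := by
  have h := evalSum_eq_zero (l := 13) (by decide) (by decide) [[[[1]], quotE3], [quotE2, [[3]],
    [[4]]]] [⟨triple 1 2 4, 2, [0]⟩, ⟨rotation 1 2, 2, [3]⟩, ⟨triple 1 2 4, 3, [3]⟩, ⟨triple 1 2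
    4, 5, [2]⟩, ⟨triple 1 2 5, 2, [5]⟩, ⟨quarticA, 1, [13, 555, 466]⟩, ⟨quarticA, 3, [11, 336]⟩,
    ⟨quarticA, 4, [22, 166]⟩, ⟨quarticA, 6, [26]⟩, ⟨quarticB, 3, [44, 36]⟩, ⟨quarticB, 4, [12]⟩,
    ⟨quarticC, 1, [55]⟩, ⟨rotation 1 2, 3, [15]⟩, ⟨rotation 1 2, 6, [44]⟩, ⟨rotation 1 3, 3,
    [11]⟩, ⟨rotation 1 3, 4, [22]⟩, ⟨triple 1 2 3, 1, [24]⟩, ⟨triple 1 2 3, 3, [26]⟩, ⟨triple 1 2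
    3, 5, [45, 11]⟩, ⟨triple 1 2 4, 4, [44, 36]⟩, ⟨triple 1 2 5, 1, [22]⟩, ⟨triple 1 2 5, 3,
    [13]⟩, ⟨triple 1 2 5, 4, [11]⟩, ⟨triple 1 2 5, 5, [26]⟩, ⟨quarticA, 2, [355, 225]⟩, ⟨quarticA,
    5, [235]⟩] (by decide +kernel) r hr
  simp only [evalSum_cons, evalSum_nil, prodEval_cons, prodEval_nil, eval_index] at h
  exact CharTwo.add_eq_zero.1 (by linear_combination h)

/-- A quotient by `[8 s]`, see `quotT1_eq`. -/
def quotT1 : Poly := lit [224, 2355, 2225, 1244, 44445, 34456, 23345, 22446]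

/-- First of three divisions leading from (1+t)cd to (1+t)c⁴d²/a³; times d² this is (1+t)(E + b)²/a.
-/
theorem quotT1_eq {r : ℤ} (hr : IsCoprime r (13 : ℕ)) : thetaAt 13 r 1 * eval 13 r quotT1 =
    thetaAt 13 r 3 * thetaAt 13 r 4 + thetaAt 13 r 3 * eval 13 r mul4 := by
  have h := evalSum_eq_zero (l := 13) (by decide) (by decide) [[[[1]], quotT1], [[[3]], [[4]]],
    [[[3]], mul4]] [⟨quarticA, 5, [0, 46, 23]⟩, ⟨triple 1 2 3, 4, [0, 23]⟩, ⟨triple 1 2 5, 2, [0,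
    15]⟩, ⟨quarticB, 1, [6]⟩, ⟨quarticB, 2, [2, 14]⟩, ⟨quarticB, 5, [1]⟩, ⟨quarticC, 1, [5]⟩,
    ⟨rotation 1 3, 3, [4]⟩, ⟨rotation 1 5, 4, [5]⟩, ⟨triple 1 2 4, 3, [6, 13]⟩, ⟨triple 1 2 4, 6,
    [2]⟩, ⟨triple 1 2 5, 4, [4]⟩, ⟨quarticA, 6, [11]⟩, ⟨quarticB, 4, [44]⟩, ⟨rotation 1 3, 1,
    [55]⟩, ⟨rotation 1 3, 6, [11]⟩, ⟨triple 1 2 3, 3, [45]⟩, ⟨triple 1 2 5, 3, [16]⟩, ⟨quarticA,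
    2, [334, 166]⟩, ⟨quarticA, 4, [346]⟩] (by decide +kernel) r hr
  simp only [evalSum_cons, evalSum_nil, prodEval_cons, prodEval_nil, eval_index] at h
  exact CharTwo.add_eq_zero.1 (by linear_combination h)

/-- A quotient by `[8 s]`, see `quotT2_eq`. -/
def quotT2 : Poly := lit [55, 345, 266, 4556, 3344, 2355, 2225, 1244, 44445, 25556, 23345, 455555,
  445566, 355666, 334446, 333466]

theorem quotT2_eq {r : ℤ} (hr : IsCoprime r (13 : ℕ)) : thetaAt 13 r 1 * eval 13 r quotT2 = eval
    13 r quotT1 * thetaAt 13 r 3 ^ 3 := by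
  have h := evalSum_eq_zero (l := 13) (by decide) (by decide) [[[[1]], quotT2], [quotT1, [[3]],
    [[3]], [[3]]]] [⟨quarticA, 5, [0, 46, 23]⟩, ⟨rotation 1 3, 5, [0]⟩, ⟨triple 1 2 3, 4, [0]⟩,
    ⟨triple 1 2 5, 2, [0]⟩, ⟨quarticB, 1, [6, 13]⟩, ⟨quarticB, 5, [1]⟩, ⟨quarticC, 1, [5]⟩,
    ⟨rotation 1 2, 2, [6, 555, 236]⟩, ⟨rotation 1 3, 4, [3]⟩, ⟨triple 1 2 3, 5, [4, 25]⟩, ⟨triple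
    1 2 5, 1, [3]⟩, ⟨triple 1 2 5, 4, [4, 25]⟩, ⟨quarticA, 2, [22, 556, 124]⟩, ⟨quarticA, 4, [56,
    444, 346, 122]⟩, ⟨rotation 1 2, 4, [14, 246, 223]⟩, ⟨rotation 1 2, 5, [44, 245]⟩, ⟨rotation 1
    3, 1, [55]⟩, ⟨triple 1 2 3, 1, [35, 166]⟩, ⟨triple 1 2 3, 6, [55, 16]⟩, ⟨triple 1 2 4, 2,
    [26]⟩, ⟨triple 1 2 4, 3, [13]⟩, ⟨triple 1 2 4, 5, [33, 356]⟩, ⟨quarticA, 1, [345, 1156]⟩,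
    ⟨quarticA, 3, [446, 145]⟩, ⟨rotation 1 2, 1, [356]⟩, ⟨triple 1 2 3, 2, [444]⟩, ⟨triple 1 2 3,
    3, [344]⟩, ⟨triple 1 2 4, 4, [355, 225, 136]⟩] (by decide +kernel) r hr
  simp only [evalSum_cons, evalSum_nil, prodEval_cons, prodEval_nil, eval_index] at h
  exact CharTwo.add_eq_zero.1 (by linear_combination h)

/-- A quotient by `[8 s]`, see `quotT3_eq`. -/
def quotT3 : Poly := lit [46, 23, 15, 256, 134, 4555, 4466, 2346, 1222, 56666, 33334, 22445,
  445556, 346666]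

theorem quotT3_eq {r : ℤ} (hr : IsCoprime r (13 : ℕ)) : thetaAt 13 r 1 * eval 13 r quotT3 = eval
    13 r quotT2 * thetaAt 13 r 4 := by
  have h := evalSum_eq_zero (l := 13) (by decide) (by decide) [[[[1]], quotT3], [quotT2, [[4]]]]
    [⟨triple 1 2 5, 3, [0, 46, 15]⟩, ⟨quarticA, 2, [6, 466]⟩, ⟨quarticC, 4, [1]⟩, ⟨triple 1 3 4,
    1, [1]⟩, ⟨rotation 1 2, 2, [5]⟩, ⟨rotation 1 5, 2, [1]⟩, ⟨triple 1 2 5, 5, [2]⟩, ⟨triple 1 2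
    4, 2, [4]⟩, ⟨rotation 1 5, 4, [1]⟩, ⟨quarticA, 6, [14, 666, 335]⟩, ⟨quarticC, 1, [26]⟩,
    ⟨quarticB, 6, [66]⟩, ⟨quarticB, 4, [35, 22]⟩, ⟨quarticA, 1, [15]⟩, ⟨quarticA, 4, [55, 345]⟩,
    ⟨triple 1 2 4, 6, [44, 36]⟩, ⟨triple 1 2 4, 5, [66]⟩, ⟨rotation 1 3, 1, [23]⟩, ⟨triple 1 2 4,
    4, [56]⟩, ⟨triple 1 2 3, 2, [55]⟩, ⟨rotation 1 3, 4, [55]⟩, ⟨rotation 1 3, 2, [13]⟩, ⟨triple 1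
    2 3, 6, [23]⟩, ⟨rotation 1 5, 1, [26]⟩, ⟨rotation 1 2, 6, [56]⟩, ⟨triple 1 2 5, 4, [33]⟩,
    ⟨quarticB, 1, [116]⟩] (by decide +kernel) r hr
  simp only [evalSum_cons, evalSum_nil, prodEval_cons, prodEval_nil, eval_index] at h
  exact CharTwo.add_eq_zero.1 (by linear_combination h)

/-- A quotient by `[8 s]`, see `quotTb_eq`. -/
def quotTb : Poly := lit [245, 3466, 2344, 1445, 1356, 22224, 13444, 12333, 444555, 444466,
  345556, 344666, 336666, 333445, 5555555, 3344556, 3333444, 2444566]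

/-- The right side is b² + (tb)² = (1+t)²b². This quotient turns (E + b)² into E² in the projection
p_{16,14}. -/
theorem quotTb_eq {r : ℤ} (hr : IsCoprime r (13 : ℕ)) : thetaAt 13 r 1 * eval 13 r quotTb =
    thetaAt 13 r 6 ^ 2 + eval 13 r mul6 ^ 2 := by
  have h := evalSum_eq_zero (l := 13) (by decide) (by decide) [[[[1]], quotTb], [[[6]], [[6]]],
    [mul6, mul6]] [⟨triple 1 2 4, 5, [0, 15, 56666]⟩, ⟨quarticB, 2, [5]⟩, ⟨quarticB, 5, [3]⟩,
    ⟨quarticA, 4, [2]⟩, ⟨triple 1 2 3, 2, [2, 14, 223, 2256, 1145, 12456]⟩, ⟨triple 1 2 3, 3, [6,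
    466, 156, 3455, 3333, 1122, 33356, 12226, 11334]⟩, ⟨rotation 1 2, 3, [3, 56, 135, 122, 2226,
    34555]⟩, ⟨rotation 1 3, 4, [2, 666, 335, 4455, 22233]⟩, ⟨triple 1 2 5, 6, [4, 145, 1336,
    12266, 12224, 11115]⟩, ⟨quarticA, 5, [22, 334, 124, 1136]⟩, ⟨quarticB, 6, [23, 15, 256]⟩,
    ⟨quarticB, 4, [26, 455]⟩, ⟨quarticA, 3, [16]⟩, ⟨quarticC, 2, [24, 1133]⟩, ⟨quarticA, 1, [44,
    36]⟩, ⟨quarticB, 3, [45, 126]⟩, ⟨quarticB, 1, [33]⟩, ⟨triple 1 3 4, 2, [66, 24, 355, 225,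
    4666, 1133, 34556, 33336, 25666]⟩, ⟨triple 1 2 5, 3, [44, 566, 245, 133, 112, 3466, 1445,
    11335]⟩, ⟨triple 1 2 5, 4, [55, 16, 224]⟩, ⟨triple 1 2 3, 4, [22, 166, 1144, 23556, 22256,
    14666]⟩, ⟨triple 1 2 4, 1, [26, 455, 333, 44556, 23333, 14555, 13335, 11235]⟩, ⟨rotation 1 2,
    2, [12, 114, 3346, 1335]⟩, ⟨triple 1 2 3, 5, [55, 16, 224, 3336, 23345, 13455, 13333]⟩,
    ⟨rotation 1 5, 4, [66, 144, 5556, 1112, 33344]⟩, ⟨triple 1 2 5, 2, [35, 22, 556, 334, 166,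
    4445, 1225, 34444, 12366, 11566]⟩, ⟨rotation 1 2, 4, [34, 456, 222, 116, 3366, 13344]⟩,
    ⟨triple 1 2 3, 6, [44, 36, 133, 112, 2344, 55556, 45666, 33455, 13444]⟩, ⟨triple 1 2 4, 3,
    [12, 356, 11446]⟩, ⟨rotation 1 3, 3, [55, 224, 3344, 2225, 22366, 11233]⟩, ⟨triple 1 3 4, 1,
    [24, 144, 2446, 1566, 23355, 22456, 22235, 13466, 11226]⟩, ⟨triple 1 2 5, 5, [13, 555, 244,
    236, 24446, 11556]⟩, ⟨quarticC, 4, [225]⟩, ⟨quarticA, 6, [244, 1346]⟩, ⟨rotation 1 3, 5, [166,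
    1144, 45566]⟩, ⟨triple 1 2 4, 4, [344, 336, 126]⟩, ⟨rotation 1 2, 5, [455, 6666, 2244, 2236,
    35566]⟩, ⟨triple 1 2 3, 1, [446, 145, 111, 23446, 13566, 11146]⟩, ⟨rotation 1 3, 6, [555,
    1122]⟩, ⟨triple 1 2 5, 1, [223, 125, 24466, 12222]⟩, ⟨rotation 1 2, 6, [255, 2266, 23344]⟩,
    ⟨quarticA, 2, [1255]⟩, ⟨triple 1 2 4, 2, [5555, 34555, 12666, 12223]⟩, ⟨rotation 1 3, 2,
    [3355, 1336, 44466, 22334]⟩, ⟨rotation 1 5, 1, [2366, 23355, 12344]⟩, ⟨triple 1 2 4, 6, [4444,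
    1224, 22223, 14556]⟩, ⟨rotation 1 3, 1, [45666, 33455, 12455]⟩] (by decide +kernel) r hr
  simp only [evalSum_cons, evalSum_nil, prodEval_cons, prodEval_nil, eval_index] at h
  exact CharTwo.add_eq_zero.1 (by linear_combination h)

theorem polyG_factor {r : ℤ} (hr : IsCoprime r (13 : ℕ)) : eval 13 r polyG = thetaAt 13 r 1 *
    thetaAt 13 r 2 ^ 2 := by
  have h := evalSum_eq_zero (l := 13) (by decide) (by decide) [[polyG], [[[1]], [[2]], [[2]]]] []
    (by decide +kernel) r hr
  simp only [evalSum_cons, evalSum_nil, prodEval_cons, prodEval_nil, eval_index] at h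
  exact CharTwo.add_eq_zero.1 (by linear_combination h)

/-- A quotient by `[8 s]`, see `rootX_eq`. -/
def rootX : Poly := lit [2, 335, 246, 125, 2256, 1366, 1145, 1111, 34445, 33456, 23335, 22346]

theorem rootX_eq {r : ℤ} (hr : IsCoprime r (13 : ℕ)) : thetaAt 13 r 1 * eval 13 r rootX = thetaAt
    13 r 2 * thetaAt 13 r 5 * thetaAt 13 r 4 * thetaAt 13 r 5 + thetaAt 13 r 3 ^ 2 * thetaAt 13 r
    2 ^ 2 * thetaAt 13 r 1 * thetaAt 13 r 2 + thetaAt 13 r 3 ^ 2 * thetaAt 13 r 6 ^ 3 * thetaAt 13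
    r 3 + thetaAt 13 r 5 ^ 2 * thetaAt 13 r 2 ^ 2 * thetaAt 13 r 4 * thetaAt 13 r 3 + thetaAt 13 r
    5 ^ 2 * thetaAt 13 r 6 ^ 2 * thetaAt 13 r 1 * thetaAt 13 r 5 + thetaAt 13 r 6 * thetaAt 13 r 3
    ^ 2 * thetaAt 13 r 4 := by
  have h := evalSum_eq_zero (l := 13) (by decide) (by decide) [[[[1]], rootX], [[[2]], [[5]],
    [[4]], [[5]]], [[[3]], [[3]], [[2]], [[2]], [[1]], [[2]]], [[[3]], [[3]], [[6]], [[6]], [[6]],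
    [[3]]], [[[5]], [[5]], [[2]], [[2]], [[4]], [[3]]], [[[5]], [[5]], [[6]], [[6]], [[1]],
    [[5]]], [[[6]], [[3]], [[3]], [[4]]]] [⟨quarticB, 3, [0]⟩, ⟨rotation 1 2, 6, [0]⟩, ⟨quarticA,
    2, [1, 455, 146, 123]⟩, ⟨quarticA, 3, [3, 444, 135]⟩, ⟨quarticB, 1, [4, 25]⟩, ⟨quarticB, 2,
    [6, 13]⟩, ⟨triple 1 2 3, 5, [3]⟩, ⟨triple 1 2 4, 1, [5, 34]⟩, ⟨triple 1 2 4, 3, [4, 25]⟩,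
    ⟨triple 1 2 4, 6, [6]⟩, ⟨triple 1 2 5, 6, [1, 26]⟩, ⟨quarticA, 4, [45]⟩, ⟨quarticA, 5, [44,
    36]⟩, ⟨rotation 1 2, 1, [55]⟩, ⟨rotation 1 2, 2, [25]⟩, ⟨rotation 1 3, 5, [44, 36]⟩, ⟨triple 1
    2 3, 1, [26]⟩, ⟨triple 1 2 3, 3, [35]⟩, ⟨triple 1 2 4, 2, [24]⟩, ⟨triple 1 2 4, 4, [46]⟩,
    ⟨triple 1 2 5, 3, [14]⟩, ⟨quarticA, 1, [246, 223, 125]⟩] (by decide +kernel) r hr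
  simp only [evalSum_cons, evalSum_nil, prodEval_cons, prodEval_nil, eval_index] at h
  exact CharTwo.add_eq_zero.1 (by linear_combination h)

/-- A quotient by `[8 s]`, see `rootJ_eq`. -/
def rootJ : Poly := lit [14, 335, 223, 4455, 3556, 2256, 1446, 1145, 55566, 46666, 34445, 33456,
  24466, 444556, 355555, 256666]

theorem rootJ_eq {r : ℤ} (hr : IsCoprime r (13 : ℕ)) : thetaAt 13 r 1 * eval 13 r rootJ = thetaAt
    13 r 6 * thetaAt 13 r 3 ^ 2 * thetaAt 13 r 4 + thetaAt 13 r 4 * thetaAt 13 r 3 ^ 6 := by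
  have h := evalSum_eq_zero (l := 13) (by decide) (by decide) [[[[1]], rootJ], [[[6]], [[3]],
    [[3]], [[4]]], [[[4]], [[3]], [[3]], [[3]], [[3]], [[3]], [[3]]]] [⟨quarticB, 3, [0]⟩,
    ⟨quarticA, 3, [3, 56]⟩, ⟨quarticA, 1, [2]⟩, ⟨quarticA, 2, [1, 146]⟩, ⟨quarticB, 1, [4, 25]⟩,
    ⟨rotation 1 3, 1, [2]⟩, ⟨triple 1 2 3, 5, [3]⟩, ⟨rotation 1 3, 2, [1]⟩, ⟨triple 1 2 5, 3, [2,
    14]⟩, ⟨triple 1 2 5, 6, [1]⟩, ⟨quarticC, 1, [33]⟩, ⟨quarticC, 2, [33]⟩, ⟨quarticA, 4, [45,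
    11]⟩, ⟨triple 1 2 4, 5, [55]⟩, ⟨triple 1 3 4, 2, [12]⟩, ⟨rotation 1 5, 2, [33]⟩, ⟨rotation 1
    3, 3, [56]⟩, ⟨triple 1 2 5, 2, [36]⟩, ⟨rotation 1 3, 6, [22]⟩, ⟨triple 1 2 3, 4, [44]⟩,
    ⟨triple 1 2 3, 3, [22]⟩, ⟨triple 1 3 4, 1, [33, 12]⟩, ⟨rotation 1 2, 4, [13]⟩, ⟨rotation 1 5,
    4, [12]⟩, ⟨quarticA, 6, [124]⟩, ⟨quarticB, 4, [155]⟩] (by decide +kernel) r hr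
  simp only [evalSum_cons, evalSum_nil, prodEval_cons, prodEval_nil, eval_index] at h
  exact CharTwo.add_eq_zero.1 (by linear_combination h)

/-- A quotient by `[8 s]`, see `rootR_eq`. -/
def rootR : Poly := lit [135, 4566, 2445, 2356, 1334, 44446, 33666, 25566, 23444, 23346, 14445,
  455556, 356666, 334455, 234566, 4444555, 3445556, 3355566, 3346666]

theorem rootR_eq {r : ℤ} (hr : IsCoprime r (13 : ℕ)) : thetaAt 13 r 1 * eval 13 r rootR = thetaAt
    13 r 6 ^ 2 * thetaAt 13 r 3 ^ 4 * thetaAt 13 r 4 ^ 2 := by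
  have h := evalSum_eq_zero (l := 13) (by decide) (by decide) [[[[1]], rootR], [[[6]], [[6]],
    [[3]], [[3]], [[3]], [[3]], [[4]], [[4]]]] [⟨triple 1 2 5, 5, [0]⟩, ⟨quarticB, 4, [2]⟩,
    ⟨quarticB, 5, [5]⟩, ⟨quarticB, 6, [4]⟩, ⟨rotation 1 2, 5, [2, 14]⟩, ⟨triple 1 2 3, 5, [1, 26,
    455, 146]⟩, ⟨quarticA, 1, [56, 233, 1556]⟩, ⟨quarticA, 2, [44, 36, 133, 112]⟩, ⟨quarticA, 5,
    [55]⟩, ⟨quarticA, 6, [23]⟩, ⟨quarticB, 1, [35]⟩, ⟨quarticB, 2, [45]⟩, ⟨rotation 1 3, 1, [56,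
    444]⟩, ⟨rotation 1 3, 2, [44]⟩, ⟨rotation 1 3, 3, [26]⟩, ⟨rotation 1 3, 6, [15]⟩, ⟨triple 1 2
    3, 1, [44, 566]⟩, ⟨triple 1 2 3, 3, [15]⟩, ⟨triple 1 2 3, 4, [16, 345, 224]⟩, ⟨triple 1 2 3,
    6, [56, 444, 233]⟩, ⟨triple 1 2 4, 3, [35, 22, 334, 166]⟩, ⟨triple 1 2 4, 4, [33, 12]⟩,
    ⟨triple 1 2 4, 5, [25, 366]⟩, ⟨triple 1 2 5, 1, [66, 24]⟩, ⟨triple 1 2 5, 2, [55, 16]⟩,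
    ⟨triple 1 3 4, 2, [13]⟩, ⟨quarticA, 3, [333, 146]⟩, ⟨quarticA, 4, [225, 144]⟩, ⟨rotation 1 2,
    2, [334, 166]⟩, ⟨rotation 1 2, 3, [155]⟩, ⟨rotation 1 2, 4, [344]⟩, ⟨rotation 1 3, 5, [113]⟩,
    ⟨triple 1 2 3, 2, [355, 225, 144]⟩, ⟨triple 1 2 4, 1, [335]⟩, ⟨triple 1 2 4, 2, [235, 116]⟩]
    (by decide +kernel) r hr
  simp only [evalSum_cons, evalSum_nil, prodEval_cons, prodEval_nil, eval_index] at h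
  exact CharTwo.add_eq_zero.1 (by linear_combination h)

/-- A quotient by `[8 s]`, see `rootK_eq`. -/
def rootK : Poly := lit [35, 22, 556, 166, 124, 3456, 2666, 2246, 2223, 1225, 55555, 22256, 11112,
  666666, 444456, 345555, 344566, 233456]

theorem rootK_eq {r : ℤ} (hr : IsCoprime r (13 : ℕ)) : thetaAt 13 r 1 * eval 13 r rootK = thetaAt
    13 r 6 * thetaAt 13 r 3 * thetaAt 13 r 4 + eval 13 r rootR := by
  have h := evalSum_eq_zero (l := 13) (by decide) (by decide) [[[[1]], rootK], [[[6]], [[3]],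
    [[4]]], [rootR]] [⟨quarticA, 3, [0]⟩, ⟨rotation 1 3, 3, [0, 15]⟩, ⟨quarticB, 2, [1]⟩,
    ⟨quarticB, 3, [2]⟩, ⟨quarticA, 5, [6, 244]⟩, ⟨quarticC, 4, [3]⟩, ⟨triple 1 3 4, 2, [3]⟩,
    ⟨rotation 1 2, 6, [2]⟩, ⟨rotation 1 3, 6, [5, 34]⟩, ⟨quarticA, 6, [34, 456]⟩, ⟨quarticC, 1,
    [56]⟩, ⟨quarticB, 1, [66]⟩, ⟨quarticB, 6, [45]⟩, ⟨quarticA, 1, [22]⟩, ⟨triple 1 2 3, 1, [33,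
    12]⟩, ⟨rotation 1 2, 2, [66]⟩, ⟨triple 1 2 4, 6, [26]⟩, ⟨triple 1 2 3, 2, [44]⟩, ⟨rotation 1
    2, 3, [16]⟩, ⟨triple 1 2 4, 1, [25]⟩, ⟨triple 1 2 4, 5, [11]⟩, ⟨triple 1 2 5, 1, [44]⟩,
    ⟨rotation 1 3, 1, [22]⟩, ⟨triple 1 2 5, 6, [33]⟩, ⟨quarticA, 4, [245]⟩] (by decide +kernel) r
    hr
  simp only [evalSum_cons, evalSum_nil, prodEval_cons, prodEval_nil, eval_index] at h
  exact CharTwo.add_eq_zero.1 (by linear_combination h)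

/-- A quotient by `[8 s]`, see `rootC_eq`. -/
def rootC : Poly := lit [344, 126, 4456, 3566, 1455, 55666, 34446, 33466, 23344, 22355, 13445]

theorem rootC_eq {r : ℤ} (hr : IsCoprime r (13 : ℕ)) : thetaAt 13 r 1 * eval 13 r rootC = thetaAt
    13 r 3 ^ 3 * thetaAt 13 r 4 * thetaAt 13 r 5 := by
  have h := evalSum_eq_zero (l := 13) (by decide) (by decide) [[[[1]], rootC], [[[3]], [[3]],
    [[3]], [[4]], [[5]]]] [⟨triple 1 2 5, 1, [0]⟩, ⟨triple 1 2 3, 2, [0]⟩, ⟨quarticA, 2, [5]⟩,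
    ⟨quarticB, 6, [3]⟩, ⟨rotation 1 5, 1, [4]⟩, ⟨triple 1 2 4, 3, [1]⟩, ⟨triple 1 2 3, 1, [5]⟩,
    ⟨triple 1 3 4, 2, [4]⟩, ⟨quarticC, 2, [25]⟩, ⟨quarticA, 1, [45]⟩, ⟨quarticA, 6, [36]⟩,
    ⟨quarticB, 4, [13]⟩, ⟨quarticB, 1, [26]⟩] (by decide +kernel) r hr
  simp only [evalSum_cons, evalSum_nil, prodEval_cons, prodEval_nil, eval_index] at h
  exact CharTwo.add_eq_zero.1 (by linear_combination h)

end Thirteen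

/-! ### Certified divisions by a = [r] for l = 15, where b = [7r], c = [4r], d = [3r], e = [2r], f =
[6r], k = [5r]. -/

namespace Fifteen

/-- The rotation relations. -/
def rotation (A B : ℕ) : Relation 15 := rot 15 (by decide) A B

/-- The triple rotation relations. -/
def triple (A B D : ℕ) : Relation 15 := tri 15 (by decide) A B D

/-- The product of `[4 s] ^ 4 / [8 s]` and the theta series with index `2`. -/
def mul2 : Poly := lit [2555, 2457, 2245, 1444, 56666, 46777, 44456, 34477, 33667, 33346, 24677,
  23366, 22246, 16777, 13336]

theorem mul2_eq {r : ℤ} (hr : IsCoprime r (15 : ℕ)) : thetaAt 15 r 1 * eval 15 r mul2 = thetaAt 15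
    r 7 ^ 4 * thetaAt 15 r 2 := by
  have h := evalSum_eq_zero (l := 15) (by decide) (by decide) [[[[1]], mul2], [[[7]], [[7]],
    [[7]], [[7]], [[2]]]] [⟨cub 0 1 5, 1, [3, 224, 1146]⟩, ⟨cub 0 1 5, 2, [6, 155, 147, 117, 112,
    2377]⟩, ⟨triple 1 3 5, 4, [0, 36]⟩, ⟨triple 1 3 5, 1, [0, 36]⟩, ⟨triple 1 3 5, 7, [0]⟩,
    ⟨triple 1 3 5, 2, [0]⟩, ⟨cub 0 1 11, 1, [33, 257, 114]⟩, ⟨cub 0 0 3, 2, [57, 25, 267, 137,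
    123, 1335, 1166]⟩, ⟨cub 0 3 3, 2, [77, 235, 3347, 2236, 1566]⟩, ⟨qua 0 1 0 12, 1, [5]⟩, ⟨qua 0
    1 3 9, 2, [4]⟩, ⟨qua 0 1 3 9, 4, [7]⟩, ⟨triple 1 3 6, 4, [4, 56]⟩, ⟨rotation 3 5, 2, [1]⟩,
    ⟨triple 1 2 6, 4, [6]⟩, ⟨triple 1 3 6, 7, [7, 35]⟩, ⟨triple 1 2 6, 2, [3]⟩, ⟨rotation 1 3, 4,
    [5, 67]⟩, ⟨rotation 1 3, 1, [5]⟩, ⟨triple 3 5 6, 1, [5, 13]⟩, ⟨cub 0 1 11, 2, [445, 333, 115,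
    3666]⟩, ⟨cub 0 3 3, 1, [156, 2335]⟩, ⟨cub 0 0 3, 1, [167]⟩, ⟨triple 1 2 4, 1, [15]⟩, ⟨triple 1
    5 6, 7, [33]⟩, ⟨triple 1 5 6, 2, [33]⟩, ⟨triple 1 2 5, 2, [12]⟩, ⟨triple 1 2 5, 7, [55, 12]⟩,
    ⟨triple 1 5 6, 4, [66]⟩, ⟨rotation 1 6, 2, [37]⟩, ⟨triple 1 2 5, 1, [47, 24]⟩, ⟨rotation 1 4,
    1, [66]⟩, ⟨triple 1 2 4, 2, [57]⟩, ⟨rotation 1 3, 2, [13]⟩] (by decide +kernel) r hr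
  simp only [evalSum_cons, evalSum_nil, prodEval_cons, prodEval_nil, eval_index] at h
  exact CharTwo.add_eq_zero.1 (by linear_combination h)

/-- The product of `[4 s] ^ 4 / [8 s]` and the theta series with index `3`. -/
def mul3 : Poly := lit [557, 477, 336, 255, 6666]

theorem mul3_eq {r : ℤ} (hr : IsCoprime r (15 : ℕ)) : thetaAt 15 r 1 * eval 15 r mul3 = thetaAt 15
    r 7 ^ 4 * thetaAt 15 r 3 := by
  have h := evalSum_eq_zero (l := 15) (by decide) (by decide) [[[[1]], mul3], [[[7]], [[7]],
    [[7]], [[7]], [[3]]]] [⟨cub 0 0 3, 1, [1]⟩, ⟨rotation 1 3, 7, [0]⟩] (by decide +kernel) r hr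
  simp only [evalSum_cons, evalSum_nil, prodEval_cons, prodEval_nil, eval_index] at h
  exact CharTwo.add_eq_zero.1 (by linear_combination h)

/-- The product of `[4 s] ^ 4 / [8 s]` and the theta series with index `4`. -/
def mul4 : Poly := lit [4, 56, 667, 266, 4555, 4457, 3566, 3337, 2777, 2445, 2222, 55556, 45567,
  44677, 35777, 33466, 23666]

theorem mul4_eq {r : ℤ} (hr : IsCoprime r (15 : ℕ)) : thetaAt 15 r 1 * eval 15 r mul4 = thetaAt 15
    r 7 ^ 4 * thetaAt 15 r 4 := by
  have h := evalSum_eq_zero (l := 15) (by decide) (by decide) [[[[1]], mul4], [[[7]], [[7]],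
    [[7]], [[7]], [[4]]]] [⟨cub 0 1 11, 2, [3, 336]⟩, ⟨rotation 1 4, 2, [0]⟩, ⟨triple 1 5 6, 2,
    [0]⟩, ⟨triple 1 4 6, 1, [0]⟩, ⟨cub 0 1 11, 1, [36, 157, 2556, 1677, 1355, 1226]⟩, ⟨cub 0 0 3,
    1, [77, 27, 235, 3355, 2367]⟩, ⟨cub 0 3 3, 2, [55, 17, 567]⟩, ⟨cub 0 1 5, 2, [33, 577, 444,
    144, 114, 3557, 2677, 2267]⟩, ⟨cub 0 0 3, 2, [45, 15, 556, 467, 246, 167, 2337]⟩, ⟨cub 0 3 3,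
    1, [57, 267, 234, 137]⟩, ⟨qua 0 0 1 9, 7, [7]⟩, ⟨qua 0 1 3 9, 4, [1]⟩, ⟨rotation 1 6, 4, [2]⟩,
    ⟨triple 1 2 3, 4, [6]⟩, ⟨triple 1 3 6, 7, [4]⟩, ⟨triple 1 5 6, 4, [3]⟩, ⟨triple 1 2 3, 1,
    [6]⟩, ⟨triple 1 3 6, 2, [4, 56]⟩, ⟨cub 0 1 5, 1, [447, 366, 155, 147, 5556, 2377, 2223]⟩,
    ⟨rotation 3 6, 1, [11]⟩, ⟨triple 1 2 5, 1, [14]⟩, ⟨triple 1 2 4, 7, [45, 15]⟩, ⟨triple 1 2 5,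
    7, [44]⟩, ⟨triple 1 3 5, 7, [66]⟩, ⟨triple 1 3 6, 1, [23]⟩, ⟨rotation 1 5, 1, [33]⟩, ⟨triple 3
    5 6, 1, [46]⟩, ⟨rotation 1 6, 7, [13]⟩, ⟨triple 1 4 5, 2, [47, 12]⟩, ⟨triple 1 3 5, 2, [66]⟩,
    ⟨triple 1 3 6, 4, [37]⟩, ⟨triple 1 2 4, 1, [77]⟩, ⟨triple 1 3 5, 4, [66]⟩, ⟨triple 1 2 5, 2,
    [14]⟩, ⟨rotation 3 5, 1, [56]⟩] (by decide +kernel) r hr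
  simp only [evalSum_cons, evalSum_nil, prodEval_cons, prodEval_nil, eval_index] at h
  exact CharTwo.add_eq_zero.1 (by linear_combination h)

/-- The product of `[4 s] ^ 4 / [8 s]` and the theta series with index `6`. -/
def mul6 : Poly := lit [6, 244, 5556, 4567, 2456, 34467, 33666, 23357, 22466]

theorem mul6_eq {r : ℤ} (hr : IsCoprime r (15 : ℕ)) : thetaAt 15 r 1 * eval 15 r mul6 = thetaAt 15
    r 7 ^ 4 * thetaAt 15 r 6 := by
  have h := evalSum_eq_zero (l := 15) (by decide) (by decide) [[[[1]], mul6], [[[7]], [[7]],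
    [[7]], [[7]], [[6]]]] [⟨cub 0 3 3, 2, [5]⟩, ⟨rotation 1 6, 7, [0]⟩, ⟨cub 0 3 3, 1, [35, 133]⟩,
    ⟨cub 0 1 11, 1, [55, 135]⟩, ⟨cub 0 0 3, 2, [56]⟩, ⟨cub 0 1 5, 1, [15, 246, 167, 134, 126]⟩,
    ⟨triple 1 2 4, 7, [4]⟩, ⟨triple 1 4 5, 1, [7, 2]⟩, ⟨triple 1 3 6, 7, [6]⟩, ⟨cub 0 0 3, 1,
    [166]⟩, ⟨cub 0 1 11, 2, [355]⟩, ⟨cub 0 1 5, 2, [146]⟩] (by decide +kernel) r hr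
  simp only [evalSum_cons, evalSum_nil, prodEval_cons, prodEval_nil, eval_index] at h
  exact CharTwo.add_eq_zero.1 (by linear_combination h)

/-- The product of `[4 s] ^ 4 / [8 s]` and the theta series with index `7`. -/
def mul7 : Poly := lit [7, 3356, 2457, 2245, 1666, 1577, 55677, 46777, 44456, 33346, 24677, 23366,
  22246]

theorem mul7_eq {r : ℤ} (hr : IsCoprime r (15 : ℕ)) : thetaAt 15 r 1 * eval 15 r mul7 = thetaAt 15
    r 7 ^ 4 * thetaAt 15 r 7 := by
  have h := evalSum_eq_zero (l := 15) (by decide) (by decide) [[[[1]], mul7], [[[7]], [[7]],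
    [[7]], [[7]], [[7]]]] [⟨cub 0 1 5, 2, [6]⟩, ⟨rotation 1 2, 4, [0]⟩, ⟨cub 0 0 3, 2, [57, 25,
    347, 234]⟩, ⟨cub 0 1 11, 2, [66, 445]⟩, ⟨cub 0 3 3, 1, [14]⟩, ⟨qua 0 1 3 9, 2, [4]⟩, ⟨triple 1
    2 3, 2, [6]⟩, ⟨triple 1 2 3, 4, [3]⟩, ⟨triple 1 2 3, 7, [6]⟩, ⟨triple 1 2 6, 2, [3]⟩, ⟨triple
    1 2 6, 7, [3]⟩, ⟨triple 1 3 6, 1, [1]⟩, ⟨triple 1 3 6, 2, [7]⟩, ⟨triple 1 3 6, 4, [1]⟩, ⟨cub 0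
    0 3, 1, [556, 467, 344, 246, 167, 126]⟩, ⟨cub 0 1 5, 1, [557, 477, 336, 255, 247, 127]⟩, ⟨cub
    0 1 11, 1, [444, 144]⟩] (by decide +kernel) r hr
  simp only [evalSum_cons, evalSum_nil, prodEval_cons, prodEval_nil, eval_index] at h
  exact CharTwo.add_eq_zero.1 (by linear_combination h)

/-- The series `t ^ 2 + t`, where `t = [4 s] ^ 4 / [8 s]`. -/
def polyW : Poly := lit [555, 245, 3455, 2467, 2344, 2246, 1355, 555555]

theorem polyW_eq {r : ℤ} (hr : IsCoprime r (15 : ℕ)) : thetaAt 15 r 1 * eval 15 r polyW = thetaAt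
    15 r 7 ^ 3 * eval 15 r mul7 + thetaAt 15 r 7 ^ 4 := by
  have h := evalSum_eq_zero (l := 15) (by decide) (by decide) [[[[1]], polyW], [[[7]], [[7]],
    [[7]], mul7], [[[7]], [[7]], [[7]], [[7]]]] [⟨cub 0 0 3, 1, [16, 566, 337, 6667, 5777, 4447,
    2257, 1455, 1447, 1366, 1124, 22267]⟩, ⟨cub 0 0 3, 2, [67, 13, 356, 4557, 4477, 3667, 2366]⟩,
    ⟨cub 0 1 5, 1, [47, 24, 17, 567, 256]⟩, ⟨cub 0 1 5, 2, [44, 237]⟩, ⟨cub 0 1 11, 1, [57, 355,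
    347, 267]⟩, ⟨cub 0 1 11, 2, [22, 446, 357, 146]⟩, ⟨rotation 1 3, 4, [6, 455, 117]⟩, ⟨triple 1
    2 4, 7, [5, 26]⟩, ⟨triple 1 2 5, 1, [1]⟩, ⟨triple 1 2 5, 4, [4, 1, 56]⟩, ⟨rotation 1 2, 2,
    [15, 556, 167, 126]⟩, ⟨rotation 1 2, 4, [45, 15, 467, 246]⟩, ⟨rotation 1 2, 7, [45]⟩,
    ⟨rotation 1 4, 1, [22]⟩, ⟨rotation 1 5, 1, [14]⟩, ⟨rotation 1 5, 2, [55]⟩, ⟨rotation 1 5, 4,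
    [11]⟩, ⟨rotation 1 5, 7, [55]⟩, ⟨rotation 1 6, 4, [33]⟩, ⟨triple 1 2 3, 1, [24, 17, 12]⟩,
    ⟨triple 1 2 3, 2, [44, 14, 11, 223]⟩, ⟨triple 1 2 3, 4, [55, 24, 17]⟩, ⟨triple 1 2 3, 7, [44,
    14]⟩, ⟨triple 1 2 4, 1, [16, 337]⟩, ⟨triple 1 2 4, 2, [34, 26]⟩, ⟨triple 1 2 4, 4, [46]⟩,
    ⟨triple 1 2 6, 1, [44]⟩, ⟨triple 1 2 6, 2, [55, 12]⟩, ⟨triple 1 2 6, 4, [11]⟩, ⟨triple 1 2 6,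
    7, [24, 17, 256]⟩, ⟨triple 1 3 5, 4, [15]⟩, ⟨triple 1 3 6, 1, [66, 777]⟩, ⟨triple 1 3 6, 4,
    [66]⟩, ⟨triple 1 3 6, 7, [36]⟩, ⟨triple 1 4 5, 1, [37, 23]⟩, ⟨triple 1 4 6, 1, [57, 25]⟩,
    ⟨triple 1 5 6, 1, [77, 22]⟩, ⟨qua 0 0 0 5, 1, [455]⟩, ⟨rotation 1 3, 2, [455]⟩, ⟨triple 1 2 5,
    7, [266]⟩, ⟨triple 1 3 5, 1, [556, 126]⟩, ⟨triple 1 3 5, 2, [467]⟩] (by decide +kernel) r hr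
  simp only [evalSum_cons, evalSum_nil, prodEval_cons, prodEval_nil, eval_index] at h
  exact CharTwo.add_eq_zero.1 (by linear_combination h)

/-- The series `[2 s] ^ 4 + t * [4 s]`. -/
def polyE : Poly := lit [7, 4444, 3356, 2457, 2245, 1666, 1577, 55677, 46777, 44456, 33346, 24677,
  23366, 22246]

theorem polyE_eq {r : ℤ} (hr : IsCoprime r (15 : ℕ)) : eval 15 r polyE = thetaAt 15 r 4 ^ 4 + eval
    15 r mul7 := by
  have h := evalSum_eq_zero (l := 15) (by decide) (by decide) [[polyE], [[[4]], [[4]], [[4]],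
    [[4]]], [mul7]] [] (by decide +kernel) r hr
  simp only [evalSum_cons, evalSum_nil, prodEval_cons, prodEval_nil, eval_index] at h
  exact CharTwo.add_eq_zero.1 (by linear_combination h)

/-- The series `[2 s] + [s] ^ 4 + t * [2 s]`. -/
def polyG : Poly := lit [56, 667, 266, 4555, 4457, 3566, 3337, 2777, 2445, 55556, 45567, 44677,
  35777, 33466, 23666]

theorem polyG_eq {r : ℤ} (hr : IsCoprime r (15 : ℕ)) : eval 15 r polyG = thetaAt 15 r 4 + thetaAt
    15 r 2 ^ 4 + eval 15 r mul4 := by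
  have h := evalSum_eq_zero (l := 15) (by decide) (by decide) [[polyG], [[[4]]], [[[2]], [[2]],
    [[2]], [[2]]], [mul4]] [] (by decide +kernel) r hr
  simp only [evalSum_cons, evalSum_nil, prodEval_cons, prodEval_nil, eval_index] at h
  exact CharTwo.add_eq_zero.1 (by linear_combination h)

/-- A quotient by `[8 s]`, see `quotE1_eq`. -/
def quotE1 : Poly := lit [37, 466, 5666, 4777, 2336, 2247, 2224, 1333, 56777, 44556, 44467, 35557,
  23555, 23457]

/-- First of three divisions showing Ec²d⁴/a³ ∈ S; times c² this is E(E + b)²/a. -/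
theorem quotE1_eq {r : ℤ} (hr : IsCoprime r (15 : ℕ)) : thetaAt 15 r 1 * eval 15 r quotE1 = eval
    15 r polyE * thetaAt 15 r 4 * thetaAt 15 r 3 := by
  have h := evalSum_eq_zero (l := 15) (by decide) (by decide) [[[[1]], quotE1], [polyE, [[4]],
    [[3]]]] [⟨triple 1 2 6, 1, [0]⟩, ⟨triple 1 3 4, 1, [0]⟩, ⟨cub 0 3 3, 2, [14, 11, 156, 3446,
    1667]⟩, ⟨cub 0 0 3, 1, [24, 3556, 1334]⟩, ⟨cub 0 0 3, 2, [27, 22, 235, 146, 2367, 1566]⟩, ⟨cub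
    0 3 3, 1, [15, 467, 113, 2233]⟩, ⟨cub 0 1 5, 2, [36, 457, 125, 3447, 1355]⟩, ⟨qua 0 1 3 9, 7,
    [5]⟩, ⟨qua 0 3 3 8, 2, [1]⟩, ⟨triple 1 3 6, 1, [5, 26]⟩, ⟨rotation 1 3, 7, [7]⟩, ⟨rotation 1
    3, 1, [2]⟩, ⟨rotation 1 6, 4, [4]⟩, ⟨triple 1 3 5, 7, [3]⟩, ⟨triple 1 5 6, 1, [6]⟩, ⟨cub 0 1
    11, 2, [455, 124, 3333, 2456]⟩, ⟨cub 0 1 11, 1, [777, 445, 333, 277]⟩, ⟨cub 0 1 5, 1, [114,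
    111, 1456]⟩, ⟨rotation 1 5, 4, [36]⟩, ⟨rotation 3 5, 2, [13]⟩, ⟨triple 1 3 6, 4, [26]⟩,
    ⟨triple 1 2 6, 4, [36]⟩, ⟨triple 1 4 5, 1, [45]⟩, ⟨triple 1 4 5, 2, [44, 11]⟩, ⟨triple 1 5 6,
    7, [66]⟩, ⟨rotation 3 5, 1, [23]⟩, ⟨triple 1 2 3, 1, [33]⟩, ⟨triple 1 3 6, 2, [23]⟩, ⟨triple 1
    2 4, 4, [47, 12]⟩, ⟨triple 1 2 5, 1, [57, 25]⟩, ⟨triple 1 3 4, 2, [33]⟩, ⟨triple 1 3 6, 7,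
    [37]⟩, ⟨rotation 1 5, 2, [33]⟩, ⟨rotation 1 3, 4, [35]⟩, ⟨triple 1 2 3, 2, [36]⟩, ⟨triple 1 2
    5, 2, [25]⟩, ⟨triple 1 2 4, 7, [77]⟩] (by decide +kernel) r hr
  simp only [evalSum_cons, evalSum_nil, prodEval_cons, prodEval_nil, eval_index] at h
  exact CharTwo.add_eq_zero.1 (by linear_combination h)

/-- A quotient by `[8 s]`, see `quotE2_eq`. -/
def quotE2 : Poly := lit [56, 4457, 3566, 2445, 2277, 1457, 55556, 45567, 44677, 34455, 33466,
  555667, 466666, 456677, 344567, 334777]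

theorem quotE2_eq {r : ℤ} (hr : IsCoprime r (15 : ℕ)) : thetaAt 15 r 1 * eval 15 r quotE2 = eval
    15 r quotE1 * thetaAt 15 r 4 * thetaAt 15 r 3 ^ 2 := by
  have h := evalSum_eq_zero (l := 15) (by decide) (by decide) [[[[1]], quotE2], [quotE1, [[4]],
    [[3]], [[3]]]] [⟨cub 0 1 5, 1, [6, 455, 447, 244, 112, 5556, 2377, 1567]⟩, ⟨cub 0 1 11, 2, [3,
    557, 477, 177]⟩, ⟨triple 1 5 6, 7, [0, 36]⟩, ⟨cub 0 0 3, 1, [27, 235, 116, 4566, 3347, 2334,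
    1566, 33345, 25557]⟩, ⟨cub 0 0 3, 2, [45, 15, 344, 246, 113, 3456, 3377, 2337, 34667]⟩, ⟨cub 0
    1 5, 2, [33, 666, 6777, 4456]⟩, ⟨cub 0 1 11, 1, [36, 555, 457, 125]⟩, ⟨cub 0 3 3, 1, [25]⟩,
    ⟨cub 0 3 3, 2, [47, 12]⟩, ⟨qua 0 0 1 9, 1, [5]⟩, ⟨qua 0 0 1 9, 2, [7]⟩, ⟨qua 0 1 3 9, 1, [4]⟩,
    ⟨rotation 1 5, 2, [6, 147, 117]⟩, ⟨rotation 1 5, 7, [6]⟩, ⟨rotation 1 6, 1, [7, 236]⟩,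
    ⟨rotation 1 6, 2, [5, 34, 13, 356]⟩, ⟨triple 1 2 3, 1, [6, 455, 447, 366]⟩, ⟨triple 1 2 3, 4,
    [6, 447, 155, 147]⟩, ⟨triple 1 3 4, 2, [6]⟩, ⟨triple 1 3 6, 2, [4, 56]⟩, ⟨triple 1 3 6, 7, [4,
    56]⟩, ⟨rotation 1 3, 2, [46, 16, 337]⟩, ⟨rotation 1 3, 4, [46, 233]⟩, ⟨rotation 1 5, 4, [33]⟩,
    ⟨rotation 1 6, 7, [13]⟩, ⟨rotation 3 5, 1, [56]⟩, ⟨triple 1 2 4, 1, [27, 446, 116]⟩, ⟨triple 1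
    2 4, 2, [15, 344, 167, 134, 113]⟩, ⟨triple 1 2 4, 4, [27, 446]⟩, ⟨triple 1 2 4, 7, [45, 126,
    113]⟩, ⟨triple 1 2 5, 1, [14, 11, 377, 237, 223]⟩, ⟨triple 1 2 5, 2, [44, 11, 456, 377, 223]⟩,
    ⟨triple 1 2 5, 4, [14]⟩, ⟨triple 1 2 5, 7, [14, 223]⟩, ⟨triple 1 3 4, 1, [33, 257]⟩, ⟨triple 1
    3 5, 1, [66, 777, 333, 115]⟩, ⟨triple 1 3 6, 1, [37]⟩, ⟨triple 1 4 5, 1, [57]⟩, ⟨triple 1 4 5,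
    2, [55]⟩, ⟨rotation 1 2, 1, [777, 333, 277, 115]⟩, ⟨rotation 1 2, 2, [333, 277, 227, 145]⟩,
    ⟨rotation 1 2, 4, [445, 333, 222]⟩, ⟨rotation 1 2, 7, [445, 333]⟩, ⟨rotation 1 3, 1, [337]⟩,
    ⟨rotation 1 4, 2, [555]⟩, ⟨rotation 1 5, 1, [577, 444, 257, 144, 114]⟩, ⟨triple 1 2 3, 2,
    [577, 111]⟩, ⟨triple 1 2 3, 7, [444, 225]⟩, ⟨triple 1 2 6, 1, [666, 577, 444, 257, 225, 114]⟩,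
    ⟨triple 1 2 6, 2, [455, 366, 244, 112]⟩, ⟨triple 1 2 6, 4, [666, 577, 257, 225]⟩, ⟨triple 1 2
    6, 7, [455, 244, 155, 124]⟩, ⟨triple 1 3 5, 7, [145]⟩] (by decide +kernel) r hr
  simp only [evalSum_cons, evalSum_nil, prodEval_cons, prodEval_nil, eval_index] at h
  exact CharTwo.add_eq_zero.1 (by linear_combination h)

/-- A quotient by `[8 s]`, see `quotE3_eq`. -/
def quotE3 : Poly := lit [557, 336, 177, 6666, 4446, 3555, 3457, 2345, 44566, 26677, 22667,
  777777, 455577, 356677]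

theorem quotE3_eq {r : ℤ} (hr : IsCoprime r (15 : ℕ)) : thetaAt 15 r 1 * eval 15 r quotE3 = eval
    15 r quotE2 * thetaAt 15 r 3 := by
  have h := evalSum_eq_zero (l := 15) (by decide) (by decide) [[[[1]], quotE3], [quotE2, [[3]]]]
    [⟨cub 0 0 3, 2, [7, 2, 367, 236, 5557, 4444]⟩, ⟨rotation 1 3, 4, [0]⟩, ⟨rotation 1 3, 1, [0]⟩,
    ⟨cub 0 0 3, 1, [56, 4457, 3566]⟩, ⟨cub 0 3 3, 2, [23, 335, 1777, 1445, 1333, 1227]⟩, ⟨cub 0 1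
    11, 2, [11, 223, 3446]⟩, ⟨cub 0 3 3, 1, [16, 337, 5777, 3335, 1147]⟩, ⟨triple 1 2 5, 1, [5,
    34]⟩, ⟨triple 1 3 6, 1, [6]⟩, ⟨triple 1 2 5, 7, [5, 67, 34]⟩, ⟨triple 1 3 6, 7, [3]⟩, ⟨triple
    1 3 6, 2, [3]⟩, ⟨cub 0 1 5, 2, [556, 467, 167, 126, 3377]⟩, ⟨cub 0 1 11, 1, [446, 357, 3677]⟩,
    ⟨cub 0 1 5, 1, [267, 1166]⟩, ⟨rotation 1 2, 7, [17]⟩, ⟨triple 1 5 6, 7, [77, 27, 22]⟩, ⟨triple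
    1 3 4, 2, [57]⟩, ⟨triple 1 3 5, 2, [47, 17]⟩, ⟨triple 1 2 6, 7, [57]⟩, ⟨rotation 1 2, 4, [55,
    17]⟩, ⟨triple 1 3 5, 4, [55]⟩, ⟨triple 1 2 6, 1, [15]⟩, ⟨rotation 1 3, 2, [36]⟩, ⟨triple 1 5
    6, 1, [44]⟩, ⟨triple 1 3 5, 7, [55]⟩, ⟨rotation 1 6, 7, [33]⟩, ⟨triple 1 4 5, 2, [23]⟩,
    ⟨triple 1 2 3, 4, [57]⟩, ⟨rotation 1 4, 1, [44, 11]⟩, ⟨triple 1 4 5, 1, [16]⟩, ⟨triple 1 5 6,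
    4, [44]⟩, ⟨rotation 1 5, 4, [45, 15]⟩, ⟨triple 1 2 4, 4, [56]⟩, ⟨triple 1 2 5, 2, [13]⟩,
    ⟨triple 1 2 6, 4, [15]⟩] (by decide +kernel) r hr
  simp only [evalSum_cons, evalSum_nil, prodEval_cons, prodEval_nil, eval_index] at h
  exact CharTwo.add_eq_zero.1 (by linear_combination h)

/-- A sum, see `polyTD_eq`. -/
def polyTD : Poly := lit [367, 2457, 2245, 566777, 444667, 334457]

/-- The right side is (1+t)(E + b), expanded by means of tc, tb and W. Two divisions after
multiplying by cd then give (1+t)(E + b)²/a. -/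
theorem polyTD_eq {r : ℤ} (hr : IsCoprime r (15 : ℕ)) : eval 15 r polyTD = eval 15 r polyE +
    thetaAt 15 r 7 + thetaAt 15 r 4 ^ 3 * eval 15 r mul4 + eval 15 r mul7 + eval 15 r polyW *
    thetaAt 15 r 7 + eval 15 r mul7 := by
  have h := evalSum_eq_zero (l := 15) (by decide) (by decide) [[polyTD], [polyE], [[[7]]], [[[4]],
    [[4]], [[4]], mul4], [mul7], [polyW, [[7]]], [mul7]] [⟨cub 0 3 3, 1, [1]⟩, ⟨qua 0 1 3 9, 2,
    [0]⟩, ⟨triple 1 3 6, 1, [0, 36, 245]⟩, ⟨cub 0 0 3, 1, [67, 13, 4557, 3346, 2455, 2366,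
    46666]⟩, ⟨cub 0 0 3, 2, [37, 466, 335, 166, 4777, 4445, 1445, 1115, 25677]⟩, ⟨cub 0 1 5, 1,
    [77, 27, 146, 3677, 1566]⟩, ⟨cub 0 1 5, 2, [24, 345]⟩, ⟨cub 0 1 11, 2, [45, 15, 467, 246]⟩,
    ⟨rotation 1 3, 7, [3, 177, 127, 122]⟩, ⟨triple 1 2 4, 4, [5, 34, 13]⟩, ⟨triple 1 2 5, 1, [7,
    334]⟩, ⟨triple 1 2 5, 4, [7, 2, 35, 367, 334]⟩, ⟨triple 1 2 5, 7, [7, 2, 35]⟩, ⟨triple 3 5 6,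
    1, [3]⟩, ⟨cub 0 1 11, 1, [237, 223, 156, 4667]⟩, ⟨rotation 1 2, 2, [57, 677, 226]⟩, ⟨rotation
    1 2, 4, [25, 137, 123]⟩, ⟨rotation 1 2, 7, [57]⟩, ⟨rotation 1 4, 2, [14]⟩, ⟨rotation 1 5, 2,
    [77, 446]⟩, ⟨rotation 1 5, 4, [55]⟩, ⟨rotation 1 6, 7, [66]⟩, ⟨triple 1 2 3, 1, [27, 22,
    446]⟩, ⟨triple 1 2 3, 2, [55, 47, 17, 12]⟩, ⟨triple 1 2 3, 7, [24, 17, 12, 256]⟩, ⟨triple 1 2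
    4, 1, [13]⟩, ⟨triple 1 2 4, 2, [37, 23, 466]⟩, ⟨triple 1 2 4, 7, [23, 466]⟩, ⟨triple 1 2 5, 2,
    [35, 334]⟩, ⟨triple 1 2 6, 1, [17, 12, 345]⟩, ⟨triple 1 2 6, 2, [77, 22]⟩, ⟨triple 1 2 6, 4,
    [17]⟩, ⟨triple 1 2 6, 7, [77, 116]⟩, ⟨triple 1 3 5, 1, [57, 677, 234]⟩, ⟨triple 1 3 5, 2, [57,
    347, 234]⟩, ⟨triple 1 3 5, 4, [25, 267, 226, 137]⟩, ⟨triple 1 3 5, 7, [57, 25, 677, 226]⟩,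
    ⟨triple 1 3 6, 2, [33]⟩, ⟨triple 1 3 6, 7, [33]⟩, ⟨triple 1 4 5, 2, [46, 16]⟩, ⟨triple 1 4 6,
    2, [45]⟩, ⟨triple 1 5 6, 2, [11]⟩, ⟨rotation 1 2, 1, [267]⟩, ⟨rotation 1 3, 1, [247]⟩,
    ⟨rotation 1 3, 2, [477, 336]⟩, ⟨rotation 1 6, 2, [445]⟩, ⟨triple 1 2 3, 4, [446, 357]⟩]
    (by decide +kernel) r hr
  simp only [evalSum_cons, evalSum_nil, prodEval_cons, prodEval_nil, eval_index] at h
  exact CharTwo.add_eq_zero.1 (by linear_combination h)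

/-- A quotient by `[8 s]`, see `quotT2_eq`. -/
def quotT2 : Poly := lit [166, 5666, 4445, 2557, 2477, 2247, 1777, 66667, 56777, 44556, 35557,
  34666, 33356, 26666, 23457, 667777, 346777, 334477, 7777777, 5555577, 4556667, 4466677]

theorem quotT2_eq {r : ℤ} (hr : IsCoprime r (15 : ℕ)) : thetaAt 15 r 1 * eval 15 r quotT2 = eval
    15 r polyTD * thetaAt 15 r 4 * thetaAt 15 r 3 := by
  have h := evalSum_eq_zero (l := 15) (by decide) (by decide) [[[[1]], quotT2], [polyTD, [[4]],
    [[3]]]] [⟨cub 0 1 5, 2, [0, 245]⟩, ⟨rotation 1 5, 1, [0, 245, 125]⟩, ⟨rotation 1 5, 4, [0,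
    157]⟩, ⟨triple 1 2 3, 2, [0, 245, 125]⟩, ⟨triple 1 2 6, 4, [0, 555, 457, 157]⟩, ⟨cub 0 0 3, 1,
    [55, 47, 24, 12, 567, 135, 6677, 77777, 45557, 33456, 24555, 23566, 14577]⟩, ⟨cub 0 0 3, 2,
    [27, 22, 446, 116, 1566]⟩, ⟨cub 0 1 5, 1, [33, 444, 225, 111, 6777]⟩, ⟨cub 0 3 3, 1, [45]⟩,
    ⟨qua 0 1 0 12, 1, [7]⟩, ⟨rotation 1 2, 1, [3, 336, 177]⟩, ⟨rotation 1 3, 1, [7, 2, 367]⟩,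
    ⟨rotation 1 3, 2, [2, 334]⟩, ⟨rotation 1 3, 4, [2, 367, 236]⟩, ⟨rotation 1 3, 7, [7, 2, 35,
    133]⟩, ⟨triple 1 3 5, 1, [3, 336, 122]⟩, ⟨triple 1 3 5, 4, [3]⟩, ⟨triple 1 3 6, 1, [5, 67,
    356]⟩, ⟨triple 1 3 6, 4, [5, 67, 26]⟩, ⟨triple 1 4 6, 2, [6]⟩, ⟨cub 0 1 11, 1, [277]⟩, ⟨cub 0
    1 11, 2, [455, 155, 124]⟩, ⟨rotation 1 4, 2, [66, 145]⟩, ⟨rotation 1 5, 7, [33, 666]⟩,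
    ⟨rotation 1 6, 7, [16]⟩, ⟨triple 1 2 3, 4, [33, 225, 114]⟩, ⟨triple 1 2 4, 1, [17, 345, 135]⟩,
    ⟨triple 1 2 4, 2, [27, 22, 357, 235, 146]⟩, ⟨triple 1 2 4, 4, [55, 47, 12, 345]⟩, ⟨triple 1 2
    4, 7, [22, 235, 116]⟩, ⟨triple 1 2 5, 1, [25, 355, 234, 123]⟩, ⟨triple 1 3 4, 2, [33, 666,
    444]⟩, ⟨triple 1 4 5, 2, [44, 11, 456, 156]⟩, ⟨triple 1 5 6, 2, [66]⟩, ⟨triple 1 5 6, 7,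
    [66]⟩, ⟨triple 3 5 6, 1, [35]⟩, ⟨rotation 1 2, 4, [557, 477, 336, 255, 177, 122]⟩, ⟨rotation 1
    5, 2, [666]⟩, ⟨rotation 1 6, 2, [566]⟩, ⟨rotation 3 5, 2, [356]⟩, ⟨triple 1 2 3, 1, [666, 577,
    114, 111]⟩, ⟨triple 1 2 3, 7, [245]⟩, ⟨triple 1 2 5, 2, [137]⟩, ⟨triple 1 2 5, 4, [347, 137]⟩,
    ⟨triple 1 2 5, 7, [677, 234, 226]⟩, ⟨triple 1 2 6, 1, [555, 457, 245, 157]⟩, ⟨triple 1 2 6, 2,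
    [444]⟩, ⟨triple 1 2 6, 7, [225, 144, 114]⟩, ⟨triple 1 3 4, 1, [555]⟩, ⟨triple 1 3 5, 2, [336,
    255]⟩] (by decide +kernel) r hr
  simp only [evalSum_cons, evalSum_nil, prodEval_cons, prodEval_nil, eval_index] at h
  exact CharTwo.add_eq_zero.1 (by linear_combination h)

/-- A quotient by `[8 s]`, see `quotT3_eq`. -/
def quotT3 : Poly := lit [46, 16, 337, 4455, 2666, 2577, 2225, 1455, 1366, 67777, 45556, 44567,
  35666, 34777, 33334, 23477, 366667, 344556, 334577, 5555777, 4566677, 4557777, 4455555, 4445557,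
  3445667, 56666666, 46666777, 45555556]

theorem quotT3_eq {r : ℤ} (hr : IsCoprime r (15 : ℕ)) : thetaAt 15 r 1 * eval 15 r quotT3 = eval
    15 r quotT2 * thetaAt 15 r 4 * thetaAt 15 r 3 := by
  have h := evalSum_eq_zero (l := 15) (by decide) (by decide) [[[[1]], quotT3], [quotT2, [[4]],
    [[3]]]] [⟨cub 0 1 11, 1, [6, 455, 155, 124, 112, 1135]⟩, ⟨triple 1 5 6, 4, [0, 36, 1355,
    1267]⟩, ⟨triple 1 4 6, 2, [0, 125, 3447, 1347]⟩, ⟨cub 0 3 3, 2, [45, 15, 467, 344, 3377,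
    2566]⟩, ⟨cub 0 1 5, 1, [66, 777, 115]⟩, ⟨cub 0 3 3, 1, [24, 17, 567, 256, 3467, 2667]⟩, ⟨cub 0
    1 11, 2, [36, 2467, 2246, 1677, 1226]⟩, ⟨cub 0 0 3, 2, [11, 456, 237, 2335, 24445, 344447]⟩,
    ⟨qua 0 0 1 9, 2, [5]⟩, ⟨qua 0 1 3 9, 2, [2]⟩, ⟨qua 0 0 1 9, 4, [1, 4457]⟩, ⟨triple 1 3 6, 4,
    [7, 334, 2457]⟩, ⟨triple 1 2 3, 7, [3, 224, 177, 4446, 1146]⟩, ⟨rotation 1 6, 1, [5]⟩,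
    ⟨rotation 1 4, 2, [6, 447, 366, 155, 4567, 3777]⟩, ⟨triple 1 3 6, 1, [7, 2, 5557, 2245, 1577,
    1444]⟩, ⟨triple 1 2 6, 4, [3, 477, 336]⟩, ⟨rotation 1 5, 4, [3, 336, 247, 2567]⟩, ⟨rotation 1
    6, 7, [4]⟩, ⟨triple 1 2 3, 2, [3, 477, 255, 247, 5677]⟩, ⟨triple 1 5 6, 2, [6, 455, 447, 244,
    155]⟩, ⟨triple 1 5 6, 7, [6, 447, 155, 147, 3445, 2237]⟩, ⟨cub 0 1 5, 2, [477, 255, 224, 5677,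
    2345, 1116, 12367]⟩, ⟨cub 0 0 3, 1, [677, 355, 226, 2356]⟩, ⟨triple 1 3 5, 1, [33, 666, 144,
    111, 1156]⟩, ⟨rotation 1 3, 4, [37, 23, 166, 5577, 1445, 1115]⟩, ⟨rotation 1 3, 2, [23, 1227,
    1222, 1145]⟩, ⟨rotation 1 2, 2, [33, 2347, 1456, 1223, 1156]⟩, ⟨rotation 3 5, 2, [35]⟩,
    ⟨triple 3 5 6, 1, [23, 4777, 4445]⟩, ⟨triple 1 2 4, 1, [25, 355, 267]⟩, ⟨triple 1 2 6, 7, [66,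
    777, 445, 277]⟩, ⟨rotation 1 2, 7, [33, 666]⟩, ⟨triple 1 4 5, 1, [55, 47, 24, 12]⟩, ⟨triple 1
    2 5, 4, [77, 27, 22, 446, 2367]⟩, ⟨triple 1 2 4, 7, [11, 156, 3357]⟩, ⟨rotation 1 5, 7, [66,
    333, 115, 4556]⟩, ⟨triple 1 2 4, 2, [44, 11, 456, 377, 2466]⟩, ⟨rotation 3 6, 1, [27, 446]⟩,
    ⟨rotation 1 6, 4, [13, 2455, 1477]⟩, ⟨triple 1 3 5, 7, [33, 111, 4456, 2267, 2234]⟩, ⟨triple 1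
    2 5, 2, [22]⟩, ⟨triple 1 2 5, 7, [22, 2334]⟩, ⟨triple 1 2 4, 4, [57, 677, 226, 3567]⟩,
    ⟨rotation 1 4, 1, [36, 5567, 3455]⟩, ⟨triple 1 4 5, 2, [45]⟩, ⟨triple 1 3 6, 2, [46, 337,
    2225, 1112]⟩, ⟨triple 1 3 5, 4, [33, 666, 577, 257, 111, 3477]⟩, ⟨rotation 3 5, 1, [46, 5777,
    2577, 1447]⟩, ⟨triple 1 2 5, 1, [22, 3355]⟩, ⟨triple 1 2 3, 4, [66, 777, 445, 222, 115, 4467,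
    1556]⟩, ⟨triple 1 5 6, 1, [36, 245, 125, 3455, 2344]⟩, ⟨triple 1 3 6, 7, [16, 337, 2577,
    1124]⟩, ⟨rotation 1 2, 1, [114, 3477, 1223]⟩, ⟨rotation 1 5, 1, [177, 122, 1235]⟩, ⟨rotation 1
    2, 4, [111]⟩, ⟨triple 1 3 5, 2, [577, 114, 2226]⟩, ⟨triple 1 4 6, 1, [155, 4567, 1567, 1135]⟩,
    ⟨triple 1 2 6, 2, [445, 277, 227, 3577, 1467]⟩, ⟨triple 1 2 3, 1, [445, 115]⟩, ⟨rotation 1 5,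
    2, [115, 3444]⟩, ⟨triple 1 3 4, 1, [477, 247, 127, 122, 3457]⟩, ⟨rotation 1 3, 7, [166,
    5666]⟩, ⟨triple 1 2 6, 1, [477]⟩, ⟨triple 1 3 4, 2, [3444, 1467, 1344, 1113]⟩]
    (by decide +kernel) r hr
  simp only [evalSum_cons, evalSum_nil, prodEval_cons, prodEval_nil, eval_index] at h
  exact CharTwo.add_eq_zero.1 (by linear_combination h)

/-- A quotient by `[8 s]`, see `quotEg_eq`. -/
def quotEg : Poly := lit [2, 35, 334, 236, 4666, 4577, 3356, 2555, 2457, 1577, 1444, 1111]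

/-- The square of this quotient is E²G/a, because aG = k²f². -/
theorem quotEg_eq {r : ℤ} (hr : IsCoprime r (15 : ℕ)) : thetaAt 15 r 1 * eval 15 r quotEg = eval
    15 r polyE * thetaAt 15 r 6 * thetaAt 15 r 5 := by
  have h := evalSum_eq_zero (l := 15) (by decide) (by decide) [[[[1]], quotEg], [polyE, [[6]],
    [[5]]]] [⟨cub 0 1 5, 1, [3, 557, 255, 127, 3555]⟩, ⟨cub 0 1 5, 2, [6, 455]⟩, ⟨rotation 1 2, 7,
    [0]⟩, ⟨triple 1 3 5, 2, [0]⟩, ⟨triple 1 3 5, 4, [0]⟩, ⟨cub 0 0 3, 1, [45, 15, 556, 344, 126,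
    3377, 2566, 1356]⟩, ⟨cub 0 0 3, 2, [57, 25, 355, 234, 137]⟩, ⟨cub 0 1 11, 2, [66, 445]⟩, ⟨cub
    0 3 3, 1, [14]⟩, ⟨cub 0 3 3, 2, [77]⟩, ⟨qua 0 1 3 9, 2, [4]⟩, ⟨rotation 1 3, 7, [5]⟩,
    ⟨rotation 1 5, 2, [3]⟩, ⟨triple 1 2 3, 7, [6]⟩, ⟨triple 1 2 6, 4, [6]⟩, ⟨triple 1 2 6, 7,
    [3]⟩, ⟨triple 1 3 6, 1, [4, 1]⟩, ⟨triple 1 3 6, 4, [1]⟩, ⟨triple 3 5 6, 1, [5]⟩, ⟨cub 0 1 11,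
    1, [577, 257, 225, 144, 3557, 3477]⟩, ⟨rotation 1 3, 2, [34]⟩, ⟨rotation 3 5, 2, [56]⟩,
    ⟨triple 1 2 4, 2, [25]⟩, ⟨triple 1 2 4, 4, [45]⟩, ⟨triple 1 2 4, 7, [25]⟩, ⟨triple 1 2 5, 1,
    [12]⟩, ⟨triple 1 2 5, 2, [24]⟩, ⟨triple 1 2 5, 4, [55]⟩, ⟨triple 1 2 5, 7, [24]⟩, ⟨triple 1 3
    6, 2, [35]⟩, ⟨triple 1 3 6, 7, [35]⟩, ⟨triple 1 4 6, 2, [66]⟩, ⟨triple 1 5 6, 1, [66]⟩,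
    ⟨triple 1 5 6, 2, [33]⟩] (by decide +kernel) r hr
  simp only [evalSum_cons, evalSum_nil, prodEval_cons, prodEval_nil, eval_index] at h
  exact CharTwo.add_eq_zero.1 (by linear_combination h)

/-- A quotient by `[8 s]`, see `rootX_eq`. -/
def rootX : Poly := lit [25, 347, 234, 1466, 1335, 55557, 45666, 44777, 25555, 23346]

theorem rootX_eq {r : ℤ} (hr : IsCoprime r (15 : ℕ)) : thetaAt 15 r 1 * eval 15 r rootX = thetaAt
    15 r 6 * thetaAt 15 r 2 * thetaAt 15 r 1 * thetaAt 15 r 2 + thetaAt 15 r 4 ^ 2 * thetaAt 15 r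
    6 ^ 2 * thetaAt 15 r 5 * thetaAt 15 r 6 + thetaAt 15 r 4 ^ 2 * thetaAt 15 r 7 ^ 3 * thetaAt 15
    r 4 + thetaAt 15 r 2 ^ 2 * thetaAt 15 r 6 ^ 2 * thetaAt 15 r 3 * thetaAt 15 r 4 + thetaAt 15 r
    2 ^ 2 * thetaAt 15 r 7 ^ 2 * thetaAt 15 r 5 * thetaAt 15 r 2 + thetaAt 15 r 7 * thetaAt 15 r 4
    ^ 2 * thetaAt 15 r 3 := by
  have h := evalSum_eq_zero (l := 15) (by decide) (by decide) [[[[1]], rootX], [[[6]], [[2]],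
    [[1]], [[2]]], [[[4]], [[4]], [[6]], [[6]], [[5]], [[6]]], [[[4]], [[4]], [[7]], [[7]], [[7]],
    [[4]]], [[[2]], [[2]], [[6]], [[6]], [[3]], [[4]]], [[[2]], [[2]], [[7]], [[7]], [[5]],
    [[2]]], [[[7]], [[4]], [[4]], [[3]]]] [⟨cub 0 1 5, 1, [7, 236]⟩, ⟨cub 0 1 5, 2, [4, 667, 346,
    266]⟩, ⟨triple 1 2 5, 1, [0]⟩, ⟨triple 1 2 5, 2, [0]⟩, ⟨triple 1 2 5, 4, [0]⟩, ⟨triple 1 2 5,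
    7, [0]⟩, ⟨cub 0 1 11, 1, [23, 166]⟩, ⟨cub 0 1 11, 2, [46]⟩, ⟨rotation 1 2, 4, [5]⟩, ⟨rotation
    1 5, 4, [1]⟩, ⟨triple 1 2 3, 2, [1]⟩, ⟨triple 1 2 4, 1, [6]⟩, ⟨triple 1 2 4, 4, [6]⟩, ⟨triple
    1 2 6, 2, [7, 2]⟩, ⟨triple 1 2 6, 7, [2]⟩, ⟨triple 1 3 5, 1, [5]⟩, ⟨triple 1 3 5, 4, [5]⟩,
    ⟨cub 0 0 3, 1, [455, 447, 366, 244]⟩, ⟨cub 0 0 3, 2, [336, 255]⟩, ⟨cub 0 3 3, 1, [777]⟩, ⟨qua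
    0 0 0 5, 1, [47]⟩] (by decide +kernel) r hr
  simp only [evalSum_cons, evalSum_nil, prodEval_cons, prodEval_nil, eval_index] at h
  exact CharTwo.add_eq_zero.1 (by linear_combination h)

/-- A quotient by `[8 s]`, see `rootJ_eq`. -/
def rootJ : Poly := lit [347, 4466, 1466, 45666, 45577, 44777, 33556, 33467, 23667, 23346, 22447,
  466667, 456777, 333456]

theorem rootJ_eq {r : ℤ} (hr : IsCoprime r (15 : ℕ)) : thetaAt 15 r 1 * eval 15 r rootJ = thetaAt
    15 r 7 * thetaAt 15 r 4 ^ 2 * thetaAt 15 r 3 + thetaAt 15 r 3 * thetaAt 15 r 4 ^ 6 := by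
  have h := evalSum_eq_zero (l := 15) (by decide) (by decide) [[[[1]], rootJ], [[[7]], [[4]],
    [[4]], [[3]]], [[[3]], [[4]], [[4]], [[4]], [[4]], [[4]], [[4]]]] [⟨triple 1 2 5, 7, [0]⟩,
    ⟨triple 1 2 5, 2, [0]⟩, ⟨triple 1 2 5, 4, [0]⟩, ⟨cub 0 1 5, 2, [56, 667, 346, 7777, 3337,
    2222]⟩, ⟨cub 0 1 11, 2, [46, 16, 566, 337, 233, 4447, 2444, 2257, 1155]⟩, ⟨triple 1 2 4, 2,
    [3]⟩, ⟨triple 1 2 6, 1, [4]⟩, ⟨triple 1 3 4, 2, [7, 2]⟩, ⟨triple 1 3 5, 4, [5, 26]⟩, ⟨triple 1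
    2 6, 2, [7, 2]⟩, ⟨triple 1 2 6, 4, [1]⟩, ⟨rotation 1 5, 2, [7, 2]⟩, ⟨triple 1 2 3, 2, [1]⟩,
    ⟨triple 1 3 5, 2, [5]⟩, ⟨rotation 1 5, 1, [4]⟩, ⟨triple 1 2 3, 7, [4, 56]⟩, ⟨triple 1 3 4, 1,
    [4, 1]⟩, ⟨triple 1 2 6, 7, [2]⟩, ⟨rotation 1 5, 7, [2, 35]⟩, ⟨rotation 1 2, 4, [5]⟩, ⟨cub 0 3
    3, 2, [257, 114, 2355, 2267, 2226, 1456]⟩, ⟨cub 0 0 3, 2, [477, 255, 177, 127, 122]⟩, ⟨cub 0 0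
    3, 1, [455, 147, 117, 2377, 2237]⟩, ⟨cub 0 3 3, 1, [445, 145, 3577, 3444]⟩, ⟨cub 0 1 5, 1,
    [334, 4577, 1577]⟩, ⟨qua 0 1 0 12, 7, [12]⟩, ⟨rotation 1 6, 2, [77]⟩, ⟨rotation 1 6, 4, [44,
    14, 11]⟩, ⟨triple 3 5 6, 1, [55, 47, 24]⟩, ⟨triple 1 3 6, 1, [45]⟩, ⟨rotation 1 3, 4, [47, 24,
    17, 12]⟩, ⟨triple 1 4 5, 1, [66]⟩, ⟨triple 1 4 6, 1, [37, 23]⟩, ⟨triple 1 3 6, 2, [57]⟩,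
    ⟨rotation 1 3, 7, [17]⟩, ⟨rotation 1 6, 7, [27]⟩, ⟨triple 1 3 5, 1, [34, 26]⟩, ⟨rotation 1 3,
    2, [24]⟩, ⟨rotation 3 5, 2, [15]⟩, ⟨triple 1 5 6, 7, [23]⟩, ⟨triple 1 4 6, 2, [16]⟩]
    (by decide +kernel) r hr
  simp only [evalSum_cons, evalSum_nil, prodEval_cons, prodEval_nil, eval_index] at h
  exact CharTwo.add_eq_zero.1 (by linear_combination h)

/-- A quotient by `[8 s]`, see `rootR_eq`. -/
def rootR : Poly := lit [57, 267, 4466, 3345, 55557, 45666, 44777, 33556, 33467, 33344, 24477,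
  23667, 23346, 555677, 444556, 344666, 344577, 333456, 5666667, 5566777, 4667777]

theorem rootR_eq {r : ℤ} (hr : IsCoprime r (15 : ℕ)) : thetaAt 15 r 1 * eval 15 r rootR = thetaAt
    15 r 7 ^ 2 * thetaAt 15 r 4 ^ 4 * thetaAt 15 r 3 ^ 2 := by
  have h := evalSum_eq_zero (l := 15) (by decide) (by decide) [[[[1]], rootR], [[[7]], [[7]],
    [[4]], [[4]], [[4]], [[4]], [[3]], [[3]]]] [⟨cub 0 0 3, 1, [6, 455, 366, 244, 155, 147, 117,
    5556, 3445, 3333, 1256, 34556, 24667, 13556, 13467]⟩, ⟨cub 0 1 5, 1, [7, 2, 35, 334, 236, 133,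
    5557, 4577, 4444, 3356, 1666, 34557]⟩, ⟨rotation 3 6, 1, [0, 36]⟩, ⟨triple 1 2 5, 1, [0, 36]⟩,
    ⟨triple 1 2 5, 4, [0, 36]⟩, ⟨triple 1 2 5, 7, [0]⟩, ⟨cub 0 1 11, 1, [37, 466]⟩, ⟨cub 0 1 11,
    2, [16]⟩, ⟨rotation 1 2, 2, [5, 67, 26, 13]⟩, ⟨rotation 1 5, 2, [7]⟩, ⟨rotation 1 5, 4, [1,
    136]⟩, ⟨triple 1 2 3, 2, [1, 56, 667]⟩, ⟨triple 1 2 3, 7, [4, 1, 56, 667]⟩, ⟨triple 1 2 4, 4,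
    [6, 366, 244, 117, 112]⟩, ⟨triple 1 2 6, 1, [4, 56]⟩, ⟨triple 1 2 6, 2, [2, 35]⟩, ⟨triple 1 2
    6, 4, [1, 56, 346, 266]⟩, ⟨triple 1 2 6, 7, [7, 35, 133]⟩, ⟨triple 1 3 5, 4, [5, 34]⟩, ⟨cub 0
    0 3, 2, [477, 255, 127, 6666, 4446, 2256, 1446, 1146, 23556]⟩, ⟨cub 0 1 5, 2, [667, 266,
    2777]⟩, ⟨qua 0 0 0 5, 1, [47]⟩, ⟨rotation 1 2, 1, [67]⟩, ⟨rotation 1 2, 4, [13, 356]⟩,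
    ⟨rotation 1 2, 7, [26]⟩, ⟨rotation 1 3, 1, [12]⟩, ⟨rotation 1 3, 2, [17]⟩, ⟨rotation 1 3, 4,
    [55]⟩, ⟨rotation 1 3, 7, [17, 12, 567]⟩, ⟨rotation 1 5, 1, [56]⟩, ⟨triple 1 2 5, 2, [36]⟩,
    ⟨triple 1 3 5, 1, [26]⟩, ⟨triple 1 3 5, 2, [67, 34, 26]⟩, ⟨triple 1 3 5, 7, [67]⟩, ⟨triple 1 3
    6, 2, [57, 137]⟩, ⟨triple 1 4 6, 2, [46, 16]⟩, ⟨rotation 1 4, 1, [233]⟩, ⟨rotation 1 4, 2,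
    [166]⟩, ⟨rotation 1 6, 1, [237, 223]⟩, ⟨rotation 1 6, 7, [116]⟩, ⟨rotation 3 5, 1, [355]⟩,
    ⟨rotation 3 5, 2, [556]⟩, ⟨triple 1 2 3, 1, [367, 236, 133]⟩, ⟨triple 1 2 3, 4, [334]⟩,
    ⟨triple 1 2 4, 1, [366, 147]⟩, ⟨triple 1 2 4, 2, [557, 477, 122]⟩, ⟨triple 1 2 4, 7, [122]⟩,
    ⟨triple 1 3 6, 1, [556, 467, 246]⟩, ⟨triple 1 4 5, 1, [777, 333]⟩, ⟨triple 1 4 5, 2, [666]⟩,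
    ⟨triple 1 5 6, 1, [337]⟩] (by decide +kernel) r hr
  simp only [evalSum_cons, evalSum_nil, prodEval_cons, prodEval_nil, eval_index] at h
  exact CharTwo.add_eq_zero.1 (by linear_combination h)

/-- A quotient by `[8 s]`, see `rootK_eq`. -/
def rootK : Poly := lit [37, 466, 335, 5666, 4777, 4445, 3334, 2336, 2247, 2224, 1333, 56777,
  34666, 33356, 23457, 455566, 445667, 356666]

theorem rootK_eq {r : ℤ} (hr : IsCoprime r (15 : ℕ)) : thetaAt 15 r 1 * eval 15 r rootK = thetaAt
    15 r 7 * thetaAt 15 r 4 * thetaAt 15 r 3 + eval 15 r rootR := by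
  have h := evalSum_eq_zero (l := 15) (by decide) (by decide) [[[[1]], rootK], [[[7]], [[4]],
    [[3]]], [rootR]] [⟨triple 1 2 3, 7, [0]⟩, ⟨triple 1 2 6, 1, [0]⟩, ⟨triple 1 2 6, 4, [0, 36]⟩,
    ⟨triple 1 3 4, 1, [0]⟩, ⟨cub 0 0 3, 1, [47, 24, 12, 567, 6677, 1367]⟩, ⟨cub 0 3 3, 1, [45,
    15]⟩, ⟨cub 0 3 3, 2, [44]⟩, ⟨qua 0 0 0 5, 1, [7]⟩, ⟨qua 0 1 0 12, 1, [7]⟩, ⟨rotation 1 2, 4,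
    [3]⟩, ⟨triple 1 3 5, 1, [3]⟩, ⟨triple 1 3 5, 2, [3]⟩, ⟨triple 1 3 6, 1, [5, 34, 13]⟩, ⟨triple
    1 3 6, 4, [5, 67, 13]⟩, ⟨triple 1 4 6, 2, [6]⟩, ⟨cub 0 0 3, 2, [446, 357, 3677, 3347, 2334,
    1566]⟩, ⟨cub 0 1 5, 1, [577, 444, 257, 144, 3557, 3336]⟩, ⟨cub 0 1 11, 1, [777, 445, 277,
    3577]⟩, ⟨cub 0 1 11, 2, [455, 447, 366, 244, 4567]⟩, ⟨rotation 1 4, 2, [66]⟩, ⟨rotation 1 5,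
    2, [33]⟩, ⟨rotation 1 5, 4, [36]⟩, ⟨rotation 1 6, 2, [46, 16]⟩, ⟨rotation 1 6, 4, [56]⟩,
    ⟨triple 1 2 4, 1, [24]⟩, ⟨triple 1 2 4, 4, [47, 24]⟩, ⟨triple 1 2 5, 1, [57]⟩, ⟨triple 1 2 5,
    2, [57]⟩, ⟨triple 1 2 5, 4, [57]⟩, ⟨triple 1 2 5, 7, [25]⟩, ⟨triple 1 2 6, 2, [33]⟩, ⟨triple 1
    2 6, 7, [33]⟩, ⟨triple 1 3 4, 2, [33]⟩, ⟨triple 1 4 5, 2, [44, 11]⟩, ⟨triple 1 5 6, 7, [66]⟩,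
    ⟨cub 0 1 5, 2, [4677, 3455]⟩] (by decide +kernel) r hr
  simp only [evalSum_cons, evalSum_nil, prodEval_cons, prodEval_nil, eval_index] at h
  exact CharTwo.add_eq_zero.1 (by linear_combination h)

/-- A quotient by `[8 s]`, see `rootC_eq`. -/
def rootC : Poly := lit [2444]

/-- For l = 15 the series [7s] coincides with a = [8s], so the division is formal and the
certificate is empty. -/
theorem rootC_eq {r : ℤ} (hr : IsCoprime r (15 : ℕ)) : thetaAt 15 r 1 * eval 15 r rootC = thetaAt
    15 r 4 ^ 3 * thetaAt 15 r 1 * thetaAt 15 r 2 := by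
  have h := evalSum_eq_zero (l := 15) (by decide) (by decide) [[[[1]], rootC], [[[4]], [[4]],
    [[4]], [[1]], [[2]]]] [] (by decide +kernel) r hr
  simp only [evalSum_cons, evalSum_nil, prodEval_cons, prodEval_nil, eval_index] at h
  exact CharTwo.add_eq_zero.1 (by linear_combination h)

/-- A quotient by `[8 s]`, see `quotL_eq`. -/
def quotL : Poly := lit [4557, 3667, 2455, 2447, 2366, 2244, 1557, 55567, 23445, 23333, 466777,
  345567]

/-- The right side is (f⁴ + td)cG. This quotient serves the class-1 component modulo 4 of dc⁶/a, as
G is not given here as a multiple of a. -/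
theorem quotL_eq {r : ℤ} (hr : IsCoprime r (15 : ℕ)) : thetaAt 15 r 1 * eval 15 r quotL = thetaAt
    15 r 6 ^ 4 * thetaAt 15 r 4 * eval 15 r polyG + eval 15 r mul3 * thetaAt 15 r 4 * eval 15 r
    polyG := by
  have h := evalSum_eq_zero (l := 15) (by decide) (by decide) [[[[1]], quotL], [[[6]], [[6]],
    [[6]], [[6]], [[4]], polyG], [mul3, [[4]], polyG]] [⟨rotation 1 5, 2, [0, 157, 5567, 4677,
    3366]⟩, ⟨triple 1 2 3, 1, [0, 245, 157, 1355]⟩, ⟨triple 1 3 4, 2, [0, 555]⟩, ⟨cub 0 0 3, 1,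
    [44, 14, 11, 456, 377, 223, 3446, 2335, 1346, 47777, 44457, 34566, 23367, 14555, 14457,
    666677, 346667]⟩, ⟨cub 0 0 3, 2, [55, 17, 345, 2667, 1367]⟩, ⟨cub 0 1 5, 2, [66, 777, 445,
    333, 277, 227, 222, 3577, 2357]⟩, ⟨cub 0 1 11, 2, [33, 577, 225, 114]⟩, ⟨cub 0 3 3, 1, [77]⟩,
    ⟨qua 0 0 0 5, 1, [4]⟩, ⟨qua 0 0 1 9, 1, [7]⟩, ⟨rotation 1 2, 2, [6, 366, 147, 117, 5556, 4567,
    3333, 1345]⟩, ⟨rotation 1 2, 4, [6, 447, 117, 3777, 3445, 3333]⟩, ⟨rotation 1 2, 7, [6, 124,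
    3445, 1135]⟩, ⟨rotation 1 3, 1, [4, 1, 56, 667, 266, 4555, 4457, 2777, 2445, 2227]⟩, ⟨rotation
    1 3, 2, [4, 136, 7777, 3337, 2333, 1457, 1245]⟩, ⟨rotation 1 3, 4, [4, 1, 346, 7777, 4555,
    4457, 2277, 1157]⟩, ⟨rotation 1 3, 7, [1, 346, 7777, 2227, 2222, 1125]⟩, ⟨rotation 3 5, 1, [5,
    356]⟩, ⟨triple 1 3 5, 1, [6, 447, 155, 124, 117, 112, 3777]⟩, ⟨triple 1 3 5, 4, [6]⟩, ⟨triple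
    1 3 5, 7, [6]⟩, ⟨triple 1 3 6, 2, [5, 34, 13]⟩, ⟨triple 1 4 6, 1, [3]⟩, ⟨triple 1 5 6, 2,
    [3]⟩, ⟨triple 1 5 6, 7, [3]⟩, ⟨cub 0 1 5, 1, [555, 245, 125, 2467, 2246]⟩, ⟨cub 0 1 11, 1,
    [336, 3457]⟩, ⟨rotation 1 4, 1, [33, 577]⟩, ⟨rotation 1 5, 1, [66, 445, 145, 4556, 4467, 2446,
    1113]⟩, ⟨rotation 1 6, 1, [37, 23]⟩, ⟨triple 1 2 3, 2, [66, 777, 445, 333, 145, 115, 4556,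
    1344]⟩, ⟨triple 1 2 4, 1, [44, 14, 237, 223, 156, 3357, 2466, 2335, 1667, 1266]⟩, ⟨triple 1 2
    4, 2, [47, 567, 6677, 3467, 3344, 1334, 1133]⟩, ⟨triple 1 2 4, 4, [44, 223, 156, 5566, 1667,
    1136]⟩, ⟨triple 1 2 4, 7, [55, 256, 1334]⟩, ⟨triple 1 2 5, 1, [45, 15, 556, 246, 126, 3377]⟩,
    ⟨triple 1 2 5, 2, [45, 15, 556, 467, 344, 167, 134, 113, 2337, 2233]⟩, ⟨triple 1 2 5, 4, [45,
    15, 467, 167, 126, 3377, 2566, 2337, 2233]⟩, ⟨triple 1 2 5, 7, [15, 556, 126, 5667, 3377,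
    2566]⟩, ⟨triple 1 2 6, 2, [36, 555, 125]⟩, ⟨triple 1 2 6, 4, [66, 445, 333, 277, 227, 222]⟩,
    ⟨triple 1 2 6, 7, [36, 245, 157, 125]⟩, ⟨triple 1 3 6, 1, [46]⟩, ⟨triple 1 3 6, 4, [16]⟩,
    ⟨triple 1 4 5, 1, [77]⟩, ⟨triple 1 5 6, 1, [33]⟩, ⟨triple 1 5 6, 4, [33]⟩, ⟨rotation 1 2, 1,
    [366, 155, 112, 3333, 1345]⟩, ⟨rotation 1 5, 4, [115]⟩, ⟨rotation 1 6, 7, [133]⟩, ⟨triple 1 2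
    3, 4, [555, 245, 5567, 1267]⟩, ⟨triple 1 2 3, 7, [115, 2446, 1167]⟩, ⟨triple 1 2 6, 1, [777,
    145, 3577, 2446, 2357]⟩, ⟨triple 1 3 4, 1, [333, 222]⟩, ⟨triple 1 3 5, 2, [455, 447, 366, 147,
    4567]⟩, ⟨rotation 1 5, 7, [3366]⟩, ⟨rotation 1 6, 2, [4666, 1144]⟩, ⟨rotation 1 6, 4, [3367]⟩]
    (by decide +kernel) r hr
  simp only [evalSum_cons, evalSum_nil, prodEval_cons, prodEval_nil, eval_index] at h
  exact CharTwo.add_eq_zero.1 (by linear_combination h)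

/-- A quotient by `[8 s]`, see `quot345_eq`. -/
def quot345 : Poly := lit [35, 334, 4666, 4577, 3356, 2555, 1444, 56666, 44456, 34477, 33667,
  33346, 23455, 22246, 13336]

theorem quot345_eq {r : ℤ} (hr : IsCoprime r (15 : ℕ)) : thetaAt 15 r 1 * eval 15 r quot345 =
    thetaAt 15 r 3 * thetaAt 15 r 4 * thetaAt 15 r 5 := by
  have h := evalSum_eq_zero (l := 15) (by decide) (by decide) [[[[1]], quot345], [[[3]], [[4]],
    [[5]]]] [⟨cub 0 1 5, 1, [3, 557, 224, 1146]⟩, ⟨triple 1 3 5, 4, [0, 36]⟩, ⟨triple 1 3 5, 1,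
    [0, 36]⟩, ⟨cub 0 0 3, 2, [25, 677, 267, 137, 1335, 1166]⟩, ⟨cub 0 3 3, 2, [27, 235, 3347,
    2236, 1566]⟩, ⟨cub 0 3 3, 1, [14, 156, 2335]⟩, ⟨qua 0 1 0 12, 1, [5]⟩, ⟨triple 1 2 3, 4, [3]⟩,
    ⟨triple 1 2 3, 1, [3]⟩, ⟨triple 1 3 6, 4, [4, 56]⟩, ⟨rotation 3 5, 2, [1]⟩, ⟨triple 1 2 6, 7,
    [3]⟩, ⟨rotation 1 5, 1, [6]⟩, ⟨triple 1 2 6, 2, [3]⟩, ⟨triple 1 3 4, 1, [6]⟩, ⟨triple 1 2 6,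
    1, [6]⟩, ⟨rotation 1 3, 4, [5, 67]⟩, ⟨rotation 1 3, 1, [5]⟩, ⟨triple 3 5 6, 1, [5, 13]⟩, ⟨cub
    0 0 3, 1, [556]⟩, ⟨cub 0 1 5, 2, [244, 155, 2377]⟩, ⟨cub 0 1 11, 2, [445, 333, 3666]⟩, ⟨cub 0
    1 11, 1, [257]⟩, ⟨triple 1 2 4, 1, [15]⟩, ⟨triple 1 5 6, 7, [33]⟩, ⟨triple 1 5 6, 2, [33]⟩,
    ⟨triple 1 3 6, 7, [35]⟩, ⟨triple 1 2 5, 2, [12]⟩, ⟨triple 1 2 5, 7, [55, 12]⟩, ⟨triple 1 5 6,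
    4, [66]⟩, ⟨rotation 1 6, 2, [37]⟩, ⟨triple 1 2 5, 1, [47, 24]⟩, ⟨rotation 1 4, 1, [66]⟩,
    ⟨triple 1 2 4, 2, [57]⟩, ⟨rotation 1 3, 2, [13]⟩] (by decide +kernel) r hr
  simp only [evalSum_cons, evalSum_nil, prodEval_cons, prodEval_nil, eval_index] at h
  exact CharTwo.add_eq_zero.1 (by linear_combination h)

/-- A quotient by `[8 s]`, see `quotU1_eq`. -/
def quotU1 : Poly := lit [147, 4567, 3445, 2377, 55667, 34467, 33666, 33577, 24667, 23446, 23357,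
  22466, 16677, 666666, 566677, 445557, 444577, 345667]

/-- First of three divisions producing t²(k + k⁴)/a; the eight factors b of t² = b⁸/a² are supplied
as 3 + 3 + 2. -/
theorem quotU1_eq {r : ℤ} (hr : IsCoprime r (15 : ℕ)) : thetaAt 15 r 1 * eval 15 r quotU1 =
    thetaAt 15 r 7 ^ 3 * thetaAt 15 r 5 + thetaAt 15 r 7 ^ 3 * thetaAt 15 r 5 ^ 4 := by
  have h := evalSum_eq_zero (l := 15) (by decide) (by decide) [[[[1]], quotU1], [[[7]], [[7]],
    [[7]], [[5]]], [[[7]], [[7]], [[7]], [[5]], [[5]], [[5]], [[5]]]] [⟨cub 0 3 3, 1, [7, 2]⟩,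
    ⟨cub 0 0 3, 1, [37, 23, 5577, 3334, 2336, 2247, 1777, 1145]⟩, ⟨cub 0 1 5, 1, [15, 556, 344,
    246, 126, 113, 1356]⟩, ⟨cub 0 1 5, 2, [77, 27]⟩, ⟨cub 0 1 11, 1, [24, 17, 12, 345]⟩, ⟨cub 0 3
    3, 2, [34]⟩, ⟨triple 1 2 4, 2, [4, 1]⟩, ⟨triple 1 2 4, 7, [4]⟩, ⟨triple 1 3 6, 7, [6]⟩,
    ⟨triple 1 4 5, 2, [5]⟩, ⟨cub 0 1 11, 2, [355, 347, 123]⟩, ⟨rotation 1 2, 2, [14]⟩, ⟨rotation 1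
    2, 4, [44]⟩, ⟨rotation 1 2, 7, [44]⟩, ⟨rotation 1 3, 1, [66]⟩, ⟨rotation 1 3, 4, [66]⟩,
    ⟨rotation 1 3, 7, [66]⟩, ⟨rotation 1 4, 1, [57, 25]⟩, ⟨rotation 1 5, 1, [27, 22]⟩, ⟨rotation 1
    5, 7, [15]⟩, ⟨rotation 1 6, 2, [36]⟩, ⟨triple 1 2 3, 1, [45]⟩, ⟨triple 1 2 3, 2, [77, 27]⟩,
    ⟨triple 1 2 3, 4, [45]⟩, ⟨triple 1 2 4, 1, [37, 23]⟩, ⟨triple 1 2 5, 1, [46]⟩, ⟨triple 1 2 5,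
    2, [46]⟩, ⟨triple 1 2 5, 4, [46]⟩, ⟨triple 1 2 5, 7, [16]⟩, ⟨triple 1 2 6, 1, [77, 27, 22]⟩,
    ⟨triple 1 2 6, 2, [45]⟩, ⟨triple 1 2 6, 4, [77]⟩, ⟨triple 1 3 4, 1, [27]⟩, ⟨triple 1 3 4, 2,
    [45]⟩, ⟨triple 1 3 5, 2, [11]⟩, ⟨triple 1 3 5, 4, [44, 14, 11]⟩, ⟨triple 1 3 5, 7, [14, 11]⟩,
    ⟨triple 1 3 6, 4, [33]⟩, ⟨triple 1 4 5, 1, [35]⟩, ⟨triple 1 4 6, 1, [55]⟩, ⟨triple 1 5 6, 1,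
    [25]⟩, ⟨triple 1 5 6, 2, [55]⟩, ⟨triple 1 5 6, 4, [57]⟩, ⟨triple 3 5 6, 1, [66]⟩, ⟨cub 0 0 3,
    2, [4457, 3566, 2777]⟩, ⟨qua 0 0 0 5, 1, [777]⟩] (by decide +kernel) r hr
  simp only [evalSum_cons, evalSum_nil, prodEval_cons, prodEval_nil, eval_index] at h
  exact CharTwo.add_eq_zero.1 (by linear_combination h)

/-- A quotient by `[8 s]`, see `quotU2_eq`. -/
def quotU2 : Poly := lit [14, 456, 377, 223, 5566, 3446, 3357, 2466, 1667, 56667, 55777, 47777,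
  44555, 22557, 567777, 445567, 444677, 346667, 345777, 5555566, 4456677, 3566667, 55556667,
  55555777, 44666777, 44455557]

theorem quotU2_eq {r : ℤ} (hr : IsCoprime r (15 : ℕ)) : thetaAt 15 r 1 * eval 15 r quotU2 = eval
    15 r quotU1 * thetaAt 15 r 7 ^ 3 := by
  have h := evalSum_eq_zero (l := 15) (by decide) (by decide) [[[[1]], quotU2], [quotU1, [[7]],
    [[7]], [[7]]]] [⟨cub 0 3 3, 1, [0, 157, 1137]⟩, ⟨cub 0 1 11, 2, [5, 67, 26, 13, 3346, 2447,
    1247]⟩, ⟨cub 0 3 3, 2, [6, 447, 147, 124, 117, 3445]⟩, ⟨cub 0 1 5, 2, [7, 35, 2245]⟩, ⟨cub 0 0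
    3, 1, [3, 477, 255, 247, 122, 1357]⟩, ⟨triple 1 2 3, 7, [7, 2, 133, 5557, 4577, 4444]⟩,
    ⟨triple 1 5 6, 2, [4, 667, 3337, 2277, 2222, 1125]⟩, ⟨triple 1 4 6, 2, [5, 34, 13, 1336, 1247,
    1177, 1127]⟩, ⟨triple 1 5 6, 4, [5, 34, 4557, 2244, 1177]⟩, ⟨rotation 1 5, 1, [2, 35, 133]⟩,
    ⟨triple 1 2 3, 2, [7, 367, 5557, 4577, 1666, 1444]⟩, ⟨rotation 1 4, 1, [5, 3667, 1336]⟩,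
    ⟨triple 1 2 4, 1, [3, 255, 247, 177, 122]⟩, ⟨triple 1 4 6, 1, [4, 667, 2277]⟩, ⟨triple 1 2 6,
    4, [2, 133, 2555, 1144]⟩, ⟨rotation 1 4, 2, [4, 56, 667, 266, 1555]⟩, ⟨triple 1 3 4, 1, [2,
    334, 236, 2245, 1144]⟩, ⟨triple 1 2 4, 4, [3, 177]⟩, ⟨rotation 1 5, 4, [2, 5557, 1577, 1225]⟩,
    ⟨triple 1 5 6, 1, [5, 67, 5555, 2447, 1557]⟩, ⟨cub 0 1 5, 1, [566, 337, 233, 4455, 2444, 1447,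
    22234]⟩, ⟨cub 0 1 11, 1, [346, 266, 3566, 2333, 2227, 2222, 1157]⟩, ⟨cub 0 0 3, 2, [777, 227,
    1134, 1126]⟩, ⟨qua 0 0 1 9, 7, [55]⟩, ⟨qua 0 1 0 12, 1, [22]⟩, ⟨triple 1 3 5, 7, [37, 166,
    5666, 5577, 2336, 2247, 1333]⟩, ⟨rotation 1 3, 4, [77, 446, 116]⟩, ⟨triple 1 3 4, 2, [46, 337,
    4447, 2257]⟩, ⟨triple 1 3 6, 1, [57, 25, 355, 1166]⟩, ⟨rotation 1 6, 1, [24, 17, 3556]⟩,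
    ⟨rotation 3 5, 1, [11, 156, 4667, 1667]⟩, ⟨rotation 1 2, 1, [23, 4777, 3367, 2477]⟩, ⟨triple 1
    2 6, 2, [16, 1112]⟩, ⟨triple 1 2 5, 1, [33, 444, 225, 3557, 3477, 2226]⟩, ⟨rotation 1 3, 1,
    [77, 146, 2236]⟩, ⟨triple 3 5 6, 1, [22, 3677, 2367, 2334]⟩, ⟨rotation 1 3, 2, [77, 446, 116,
    3347]⟩, ⟨triple 1 5 6, 7, [56]⟩, ⟨rotation 1 2, 7, [37, 5577, 4445]⟩, ⟨rotation 1 6, 7, [15]⟩,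
    ⟨triple 1 2 5, 2, [33, 225, 144, 114, 3336, 1456]⟩, ⟨triple 1 2 4, 7, [66, 777, 115, 3666,
    2235, 1167]⟩, ⟨triple 1 3 6, 4, [25, 234, 226, 4466, 3345, 2356, 1335]⟩, ⟨rotation 1 6, 2,
    [45, 556, 467, 134, 126]⟩, ⟨triple 1 2 4, 2, [66, 333, 277, 222, 4467, 1246, 1134]⟩, ⟨triple 1
    3 5, 4, [37, 466, 335, 166, 4445, 2255, 2224, 1277, 1222]⟩, ⟨rotation 1 3, 7, [22, 357]⟩,
    ⟨triple 1 2 6, 7, [16, 6667, 2444, 1147, 1117]⟩, ⟨triple 1 2 5, 7, [577, 444, 144, 6777,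
    3557]⟩, ⟨triple 1 4 5, 2, [155, 4567]⟩, ⟨rotation 3 6, 1, [444, 111, 1223]⟩, ⟨triple 1 2 3, 1,
    [566, 4455, 2666, 1366, 1244, 1147]⟩, ⟨rotation 1 2, 2, [335, 166, 1445]⟩, ⟨triple 1 3 6, 2,
    [237, 2335]⟩, ⟨rotation 1 5, 7, [233, 4447, 2257, 2225, 1112]⟩, ⟨triple 1 3 5, 2, [166, 5666,
    2557, 2477, 2247, 2224, 1115]⟩, ⟨triple 1 3 6, 7, [223, 5566, 1346]⟩, ⟨triple 1 2 5, 4, [114,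
    2677, 2355, 2226]⟩, ⟨rotation 1 5, 2, [233, 4447]⟩, ⟨triple 1 2 6, 1, [133, 1144]⟩, ⟨triple 1
    2 3, 4, [6667, 2225, 1124]⟩, ⟨rotation 1 2, 4, [4445, 2557]⟩, ⟨triple 1 4 5, 1, [1226, 1123]⟩,
    ⟨triple 1 3 5, 1, [5577, 3367, 2557, 2477, 2255, 1777, 1227]⟩, ⟨rotation 1 6, 4, [3467]⟩]
    (by decide +kernel) r hr
  simp only [evalSum_cons, evalSum_nil, prodEval_cons, prodEval_nil, eval_index] at h
  exact CharTwo.add_eq_zero.1 (by linear_combination h)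

/-- A quotient by `[8 s]`, see `quotU3_eq`. -/
def quotU3 : Poly := lit [557, 477, 336, 255, 224, 177, 127, 4446, 3555, 2567, 2345, 1446, 34677,
  33366, 22667, 11233, 777777, 555557, 455666, 445777, 5556666, 4556777, 3445666, 3445577,
  55666667, 55566777, 45667777, 34556666, 34466667, 556667777, 555777777, 555555557, 455555577,
  444666666]

theorem quotU3_eq {r : ℤ} (hr : IsCoprime r (15 : ℕ)) : thetaAt 15 r 1 * eval 15 r quotU3 = eval
    15 r quotU2 * thetaAt 15 r 7 ^ 2 := by
  have h := evalSum_eq_zero (l := 15) (by decide) (by decide) [[[[1]], quotU3], [quotU2, [[7]],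
    [[7]]]] [⟨cub 0 0 3, 1, [4, 56, 346, 266, 2445, 2333, 2227, 14677]⟩, ⟨cub 0 0 3, 2, [2, 5557,
    3356, 2457, 1257, 1225]⟩, ⟨rotation 1 3, 2, [0, 457, 157, 125, 1355, 1347, 33333]⟩, ⟨rotation
    1 3, 1, [0, 245, 2556, 2344, 1234, 1226, 35556, 22566, 22233, 12356]⟩, ⟨cub 0 3 3, 1, [46,
    233, 6667, 2666, 2577]⟩, ⟨cub 0 3 3, 2, [23, 335, 4445, 2336, 1777, 1277, 12235]⟩, ⟨cub 0 1
    11, 1, [22, 357, 23356]⟩, ⟨cub 0 1 5, 1, [57, 677, 347, 234, 36677]⟩, ⟨cub 0 1 11, 2, [11,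
    156]⟩, ⟨triple 1 2 4, 7, [7, 2, 3356, 1666, 56666, 23455, 13557, 13477]⟩, ⟨rotation 3 5, 1,
    [3, 336, 177, 122, 2345, 1235, 33366, 13347, 11337]⟩, ⟨triple 1 2 4, 4, [1, 346, 136, 4555,
    3566, 2333, 2227, 1555, 1245, 45567, 15567]⟩, ⟨triple 1 3 6, 4, [6, 447, 147, 4567, 3333,
    34467, 13344]⟩, ⟨triple 1 2 4, 2, [2, 133, 5557, 2245, 1257, 1114, 1111, 12347]⟩, ⟨triple 1 2
    5, 4, [5, 4557, 3346, 34457, 33337, 23445, 14446, 13555, 12567, 11446, 11235]⟩, ⟨cub 0 1 5, 2,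
    [467, 246, 167, 113, 2233, 35566, 33357]⟩, ⟨triple 1 3 5, 7, [55, 12, 567, 2667, 1236, 24457,
    22777, 22277, 22227]⟩, ⟨rotation 1 2, 2, [55, 567, 135, 3556, 1367, 11114]⟩, ⟨triple 1 4 6, 1,
    [27, 22, 446, 146, 116, 2367, 2334]⟩, ⟨triple 1 2 5, 7, [34, 26, 1255, 1247, 11357, 11235]⟩,
    ⟨rotation 1 2, 4, [24, 17, 2266, 33456, 23566, 22222, 15557, 13356, 12555, 12457]⟩, ⟨triple 1
    3 5, 1, [55, 47, 567, 345, 256, 6677, 3556, 1334, 1133, 33456, 22777, 14666, 13356]⟩,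
    ⟨rotation 1 2, 1, [55, 256, 135, 33377, 23337]⟩, ⟨triple 1 3 4, 2, [25, 677, 347, 22455]⟩,
    ⟨triple 1 2 5, 2, [26, 13, 16666]⟩, ⟨rotation 1 5, 4, [15, 134, 113, 33446]⟩, ⟨triple 1 2 5,
    1, [13, 5555, 4477, 2244, 1557, 33566, 22456, 22237]⟩, ⟨triple 3 5 6, 1, [36, 555, 457, 125,
    5567, 4677, 3366, 1226, 66666, 35556]⟩, ⟨rotation 1 5, 7, [25, 677, 347, 226, 3345, 2356,
    55557, 12477]⟩, ⟨rotation 1 6, 1, [66, 777, 33557]⟩, ⟨triple 1 5 6, 2, [77, 446, 116, 3355,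
    33345, 25557, 15777]⟩, ⟨rotation 1 2, 7, [47, 17, 2346, 44666, 11577]⟩, ⟨rotation 1 5, 1, [45,
    15, 467, 134, 3456, 1356, 44477, 26667, 11557]⟩, ⟨triple 1 2 6, 2, [25, 234, 44445, 33344,
    12255]⟩, ⟨triple 1 3 4, 1, [45, 15, 126, 5667, 2337, 57777, 44557, 11177]⟩, ⟨triple 1 3 5, 4,
    [12, 135, 1334, 11444]⟩, ⟨rotation 1 4, 1, [11, 456, 22255, 12777, 12227, 11555, 11157]⟩,
    ⟨triple 1 2 6, 7, [57, 25, 234, 226, 123, 4466, 3345, 45666, 45577, 44777, 22447, 22244]⟩,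
    ⟨triple 1 2 6, 4, [45, 15, 246, 167, 126, 12447]⟩, ⟨triple 1 4 6, 2, [44, 14, 11, 156, 1667,
    22557, 12222]⟩, ⟨rotation 1 3, 7, [36, 14466]⟩, ⟨rotation 1 5, 2, [57, 347, 226, 45577, 36677,
    11445, 11277]⟩, ⟨triple 1 2 3, 7, [15, 45555, 25777, 23335, 12366, 11557]⟩, ⟨triple 1 3 5, 2,
    [47, 567, 2667, 1133, 11444]⟩, ⟨triple 1 4 5, 2, [37, 2224, 1445, 1333, 1277, 1222, 26666]⟩,
    ⟨rotation 1 6, 2, [33, 114, 4456, 1456]⟩, ⟨triple 1 5 6, 7, [22, 446, 357, 1566, 1337, 24666,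
    11455]⟩, ⟨triple 1 5 6, 1, [11, 44457, 12333]⟩, ⟨rotation 3 6, 1, [67, 356, 1336, 33566,
    12256, 11146]⟩, ⟨qua 0 0 1 9, 7, [777]⟩, ⟨triple 1 2 3, 1, [355, 123, 3345, 1166, 22455,
    12224]⟩, ⟨rotation 1 6, 4, [277, 227, 4467, 1467, 12566]⟩, ⟨triple 1 3 6, 7, [336, 247, 6666,
    4446, 66777, 33447, 23467, 13677, 11566]⟩, ⟨rotation 1 6, 7, [444, 144, 3336, 2267, 1456,
    1156, 33457, 11266]⟩, ⟨rotation 3 5, 2, [244, 2223, 1256, 13344, 12667]⟩, ⟨triple 1 3 6, 2,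
    [336, 255, 224, 177, 127, 122, 1146, 1116, 33447, 33366, 22346, 12334]⟩, ⟨triple 1 2 3, 4,
    [267, 137, 4466, 3345, 44777, 22455]⟩, ⟨triple 1 2 3, 2, [556, 167, 113, 2566, 2233, 66677,
    24447, 22577, 22444, 11177]⟩, ⟨triple 1 3 6, 1, [244, 124, 2237, 2223, 1256, 55667, 34467,
    13467, 11133]⟩, ⟨rotation 1 3, 4, [555, 245, 5567, 3447, 3366, 2246, 34567, 33445, 22337]⟩,
    ⟨triple 1 5 6, 4, [377, 3357, 33677, 13337]⟩, ⟨triple 1 4 5, 1, [5777, 2666, 2577, 67777,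
    33334, 26777, 23336]⟩, ⟨triple 1 2 6, 1, [5667, 2337, 45555, 24455, 24447, 23466, 22666,
    22257, 13346, 11247]⟩, ⟨rotation 1 4, 2, [2334, 44455, 24444, 12257]⟩, ⟨triple 1 2 4, 1,
    [33335, 23444]⟩, ⟨qua 0 1 0 12, 7, [111222]⟩] (by decide +kernel) r hr
  simp only [evalSum_cons, evalSum_nil, prodEval_cons, prodEval_nil, eval_index] at h
  exact CharTwo.add_eq_zero.1 (by linear_combination h)

/-- A quotient by `[8 s]`, see `quotA1_eq`. -/
def quotA1 : Poly := lit [56, 346, 266, 4457, 3566, 3337, 2222, 1457, 55556, 45567, 44677, 36667,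
  33466, 23666, 11123]

/-- First of four divisions producing t³ec/a, each supplying b³. -/
theorem quotA1_eq {r : ℤ} (hr : IsCoprime r (15 : ℕ)) : thetaAt 15 r 1 * eval 15 r quotA1 =
    thetaAt 15 r 2 * thetaAt 15 r 4 * thetaAt 15 r 7 ^ 3 := by
  have h := evalSum_eq_zero (l := 15) (by decide) (by decide) [[[[1]], quotA1], [[[2]], [[4]],
    [[7]], [[7]], [[7]]]] [⟨cub 0 1 11, 2, [3, 557, 477, 247, 224]⟩, ⟨triple 1 4 6, 1, [0]⟩,
    ⟨triple 1 5 6, 2, [0]⟩, ⟨cub 0 0 3, 1, [22, 446, 116, 3355]⟩, ⟨cub 0 0 3, 2, [45, 15, 467,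
    167]⟩, ⟨cub 0 1 11, 1, [36, 555, 457, 245]⟩, ⟨cub 0 3 3, 1, [57]⟩, ⟨cub 0 3 3, 2, [24, 17,
    12]⟩, ⟨rotation 1 6, 1, [2]⟩, ⟨triple 1 2 3, 1, [6]⟩, ⟨triple 1 2 3, 4, [6]⟩, ⟨triple 1 2 6,
    2, [6]⟩, ⟨triple 1 3 4, 2, [6]⟩, ⟨triple 1 5 6, 4, [3]⟩, ⟨cub 0 1 5, 1, [455, 366, 147]⟩,
    ⟨rotation 1 2, 4, [66]⟩, ⟨rotation 1 3, 7, [16]⟩, ⟨rotation 1 5, 1, [33]⟩, ⟨rotation 1 5, 4,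
    [33]⟩, ⟨rotation 1 6, 7, [13]⟩, ⟨triple 1 2 3, 7, [33]⟩, ⟨triple 1 2 4, 4, [77, 22]⟩, ⟨triple
    1 2 5, 1, [11]⟩, ⟨triple 1 2 5, 4, [44]⟩, ⟨triple 1 2 5, 7, [44, 11]⟩, ⟨triple 1 2 6, 1,
    [33]⟩, ⟨triple 1 3 4, 1, [33]⟩, ⟨triple 1 3 5, 2, [66]⟩, ⟨triple 1 3 5, 4, [66]⟩]
    (by decide +kernel) r hr
  simp only [evalSum_cons, evalSum_nil, prodEval_cons, prodEval_nil, eval_index] at h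
  exact CharTwo.add_eq_zero.1 (by linear_combination h)

/-- A quotient by `[8 s]`, see `quotA2_eq`. -/
def quotA2 : Poly := lit [222, 4467, 2357, 1113, 33557, 23677, 23347, 555777, 466677]

theorem quotA2_eq {r : ℤ} (hr : IsCoprime r (15 : ℕ)) : thetaAt 15 r 1 * eval 15 r quotA2 = eval
    15 r quotA1 * thetaAt 15 r 7 ^ 3 := by
  have h := evalSum_eq_zero (l := 15) (by decide) (by decide) [[[[1]], quotA2], [quotA1, [[7]],
    [[7]], [[7]]]] [⟨cub 0 3 3, 2, [4]⟩, ⟨cub 0 0 3, 1, [35, 236, 133, 5557, 4666, 4577, 4444,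
    3356, 2555, 1666, 1577, 1144, 1114, 23447]⟩, ⟨cub 0 0 3, 2, [46, 16, 566, 337, 6667, 5777,
    4447, 3466, 3335, 2666, 2577, 1366]⟩, ⟨cub 0 1 5, 1, [44, 14, 377, 237, 3446, 3357]⟩, ⟨cub 0 1
    11, 2, [24, 17]⟩, ⟨cub 0 3 3, 1, [67]⟩, ⟨rotation 1 6, 7, [6]⟩, ⟨rotation 3 5, 2, [3]⟩,
    ⟨triple 1 2 4, 1, [7]⟩, ⟨triple 1 2 4, 4, [7, 35, 334]⟩, ⟨triple 1 3 6, 4, [3]⟩, ⟨triple 1 4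
    5, 1, [5]⟩, ⟨triple 1 4 5, 2, [1, 56]⟩, ⟨cub 0 1 5, 2, [677, 355, 347, 267, 3567, 3345,
    2356]⟩, ⟨cub 0 1 11, 1, [467, 344, 167]⟩, ⟨rotation 1 2, 1, [77, 116]⟩, ⟨rotation 1 2, 2, [27,
    116]⟩, ⟨rotation 1 2, 7, [22]⟩, ⟨rotation 1 3, 2, [33, 444, 114]⟩, ⟨rotation 1 3, 7, [33, 577,
    111]⟩, ⟨rotation 1 4, 1, [55]⟩, ⟨rotation 1 4, 2, [45]⟩, ⟨rotation 1 5, 2, [14, 11]⟩,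
    ⟨rotation 1 6, 1, [36]⟩, ⟨rotation 1 6, 4, [36]⟩, ⟨rotation 3 5, 1, [66]⟩, ⟨triple 1 2 3, 1,
    [14, 223]⟩, ⟨triple 1 2 3, 4, [14, 377, 237]⟩, ⟨triple 1 2 3, 7, [57, 355, 234, 226]⟩, ⟨triple
    1 2 5, 1, [23, 466]⟩, ⟨triple 1 2 5, 2, [37, 335]⟩, ⟨triple 1 2 6, 1, [57, 25, 347, 234, 226,
    123]⟩, ⟨triple 1 2 6, 2, [14, 11]⟩, ⟨triple 1 2 6, 4, [57, 25, 677, 226]⟩, ⟨triple 1 3 4, 1,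
    [25, 267]⟩, ⟨triple 1 3 4, 2, [11]⟩, ⟨triple 1 3 5, 1, [27]⟩, ⟨triple 1 3 5, 2, [77, 22]⟩,
    ⟨triple 1 3 5, 4, [27]⟩, ⟨triple 1 3 5, 7, [77, 22]⟩, ⟨triple 1 3 6, 2, [66]⟩, ⟨triple 1 3 6,
    7, [66]⟩, ⟨triple 1 5 6, 1, [55]⟩, ⟨triple 1 5 6, 2, [45, 15]⟩, ⟨triple 1 5 6, 4, [55]⟩,
    ⟨triple 1 5 6, 7, [15]⟩, ⟨triple 3 5 6, 1, [33]⟩, ⟨rotation 1 2, 4, [357]⟩, ⟨rotation 1 3, 1,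
    [666, 114]⟩, ⟨rotation 1 3, 4, [577, 114]⟩, ⟨rotation 1 5, 4, [677, 137]⟩, ⟨rotation 1 6, 2,
    [155]⟩, ⟨triple 1 2 3, 2, [677]⟩, ⟨triple 1 2 4, 2, [233]⟩, ⟨triple 1 2 4, 7, [233]⟩, ⟨triple
    1 2 5, 7, [166]⟩, ⟨triple 1 2 6, 7, [377, 237]⟩, ⟨triple 1 3 6, 1, [477, 336]⟩]
    (by decide +kernel) r hr
  simp only [evalSum_cons, evalSum_nil, prodEval_cons, prodEval_nil, eval_index] at h
  exact CharTwo.add_eq_zero.1 (by linear_combination h)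

/-- A quotient by `[8 s]`, see `quotA3_eq`. -/
def quotA3 : Poly := lit [22, 446, 4566, 3677, 3355, 2367, 55577, 46667, 44455, 33567, 25557,
  11112, 556777, 467777, 345577, 333556, 6666677, 4446677, 3466667, 55555577, 45556667]

theorem quotA3_eq {r : ℤ} (hr : IsCoprime r (15 : ℕ)) : thetaAt 15 r 1 * eval 15 r quotA3 = eval
    15 r quotA2 * thetaAt 15 r 7 ^ 3 := by
  have h := evalSum_eq_zero (l := 15) (by decide) (by decide) [[[[1]], quotA3], [quotA2, [[7]],
    [[7]], [[7]]]] [⟨cub 0 1 11, 2, [4, 56, 346, 2777, 2333, 1157, 24467]⟩, ⟨cub 0 3 3, 1, [6,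
    244, 124, 117, 112]⟩, ⟨triple 1 2 4, 1, [0, 1267]⟩, ⟨cub 0 3 3, 2, [66, 445, 222, 3577, 3444,
    1113]⟩, ⟨cub 0 1 5, 2, [67, 34, 1336]⟩, ⟨cub 0 1 5, 1, [23, 3367, 2255, 2247]⟩, ⟨cub 0 0 3, 2,
    [33, 444, 225, 144]⟩, ⟨cub 0 1 11, 1, [16, 566, 5777, 3335, 1117, 26777, 123446]⟩, ⟨triple 1 3
    4, 1, [5, 67, 34, 26, 1336, 1247, 1127]⟩, ⟨triple 1 3 5, 4, [7, 1577, 1144, 1114]⟩, ⟨triple 1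
    3 5, 2, [2, 35]⟩, ⟨triple 1 4 6, 2, [4, 4457, 2777, 1457]⟩, ⟨triple 1 2 6, 4, [5, 67, 34, 26,
    356, 2244, 1336, 1177]⟩, ⟨triple 1 3 5, 7, [2, 367, 5557, 4444, 1577]⟩, ⟨rotation 1 2, 7, [2,
    1257]⟩, ⟨triple 1 5 6, 1, [4, 1, 667, 346]⟩, ⟨triple 1 4 5, 1, [6, 244, 155]⟩, ⟨rotation 1 2,
    1, [7]⟩, ⟨triple 1 2 5, 7, [3, 557, 247, 127, 122, 4446, 2345]⟩, ⟨rotation 1 4, 1, [4, 4555,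
    4457, 1125]⟩, ⟨triple 1 2 3, 2, [5, 26]⟩, ⟨cub 0 0 3, 1, [457, 245, 157, 125]⟩, ⟨qua 0 1 3 9,
    1, [22]⟩, ⟨qua 0 3 3 8, 2, [15]⟩, ⟨qua 0 1 3 9, 2, [12]⟩, ⟨rotation 1 6, 7, [44, 14, 4667,
    3446]⟩, ⟨rotation 1 5, 4, [34, 13, 2447]⟩, ⟨triple 1 3 6, 1, [55, 47, 12]⟩, ⟨triple 1 3 6, 2,
    [22, 116]⟩, ⟨rotation 3 5, 1, [77, 22, 446, 116]⟩, ⟨triple 1 2 3, 7, [67, 26, 5555, 4477,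
    2455, 1177]⟩, ⟨triple 1 2 6, 1, [34, 26, 356, 2455]⟩, ⟨triple 1 2 4, 7, [33, 2267]⟩, ⟨rotation
    1 5, 1, [13, 2244, 1477]⟩, ⟨rotation 1 3, 7, [57, 226]⟩, ⟨triple 1 3 6, 4, [17, 12, 6677]⟩,
    ⟨triple 1 2 6, 7, [23, 2255, 1227]⟩, ⟨triple 1 2 3, 4, [37, 466, 5666]⟩, ⟨triple 3 5 6, 1,
    [57, 2356]⟩, ⟨rotation 3 5, 2, [47, 135, 3344]⟩, ⟨triple 1 2 6, 2, [23, 466, 335, 2557]⟩,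
    ⟨rotation 1 3, 1, [25, 355, 267, 1466]⟩, ⟨triple 1 3 4, 2, [37, 166, 2336, 1227]⟩, ⟨triple 1 5
    6, 7, [566, 233, 4447, 2444]⟩, ⟨rotation 1 3, 4, [355, 137]⟩, ⟨triple 1 5 6, 4, [667, 136,
    3337, 1157]⟩, ⟨triple 1 4 5, 2, [333, 227, 145, 1167]⟩, ⟨triple 1 4 6, 1, [566, 337, 233,
    2444, 1447, 1124]⟩, ⟨triple 1 2 5, 2, [255, 177, 122]⟩, ⟨triple 1 2 3, 1, [466, 166, 3367,
    2255, 1777]⟩, ⟨rotation 1 5, 7, [166, 2336]⟩, ⟨rotation 1 4, 2, [233, 1147]⟩, ⟨triple 1 2 4,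
    4, [157, 125, 2556, 1226]⟩, ⟨triple 1 2 5, 4, [127, 1357]⟩, ⟨triple 1 2 4, 2, [577, 3557]⟩,
    ⟨rotation 1 5, 2, [335, 166]⟩, ⟨rotation 1 2, 4, [133, 5557, 1144]⟩, ⟨triple 1 3 5, 1, [367,
    4577, 3356, 1111]⟩, ⟨rotation 1 6, 4, [167, 113]⟩, ⟨rotation 3 6, 1, [224]⟩, ⟨rotation 1 3, 2,
    [137, 3345]⟩, ⟨triple 1 3 6, 7, [3355, 3347, 2334]⟩, ⟨rotation 1 2, 2, [1666]⟩, ⟨triple 1 5 6,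
    2, [6667, 2577]⟩] (by decide +kernel) r hr
  simp only [evalSum_cons, evalSum_nil, prodEval_cons, prodEval_nil, eval_index] at h
  exact CharTwo.add_eq_zero.1 (by linear_combination h)

/-- A quotient by `[8 s]`, see `quotA4_eq`. -/
def quotA4 : Poly := lit [2, 35, 334, 236, 5557, 4666, 3356, 2555, 2457, 2245, 1111, 46777, 34477,
  33667, 16777, 666667, 566777, 346666, 6667777, 5777777, 4555666, 67777777, 55556666, 44666677,
  44567777, 44455556, 555666667, 555566777, 466666666, 456666677, 455667777, 5555555557,
  4555555666]

theorem quotA4_eq {r : ℤ} (hr : IsCoprime r (15 : ℕ)) : thetaAt 15 r 1 * eval 15 r quotA4 = eval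
    15 r quotA3 * thetaAt 15 r 7 ^ 3 := by
  have h := evalSum_eq_zero (l := 15) (by decide) (by decide) [[[[1]], quotA4], [quotA3, [[7]],
    [[7]], [[7]]]] [⟨cub 0 1 5, 2, [6, 447, 55667, 12266]⟩, ⟨cub 0 1 5, 1, [3, 247, 3555]⟩,
    ⟨rotation 1 2, 7, [0, 1355]⟩, ⟨cub 0 1 11, 1, [33, 444, 257, 144, 111, 33457]⟩, ⟨cub 0 0 3, 1,
    [45, 15, 556, 467, 1356, 23466]⟩, ⟨cub 0 3 3, 1, [44, 11, 156, 4667, 23367, 12333, 111123]⟩,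
    ⟨cub 0 3 3, 2, [22, 357, 116, 3677]⟩, ⟨qua 0 1 3 9, 2, [1]⟩, ⟨qua 0 1 0 12, 7, [5]⟩, ⟨rotation
    3 5, 1, [7, 2, 35, 1225, 1144, 56666, 13557, 11237, 11156, 145566]⟩, ⟨triple 1 2 6, 2, [3,
    33447, 22346, 22266]⟩, ⟨triple 1 2 3, 2, [6, 366, 3445, 3333, 2377, 1345, 55667, 11334]⟩,
    ⟨rotation 1 5, 4, [6, 155, 117, 2237, 22335, 13556]⟩, ⟨rotation 3 5, 2, [1, 667, 14677, 13366,
    11123]⟩, ⟨triple 1 3 6, 7, [2, 367, 5557, 4577, 44456, 23447, 12677]⟩, ⟨triple 1 2 6, 7, [3,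
    127, 6666, 1357, 1116, 33447]⟩, ⟨triple 1 3 4, 2, [3, 336, 255, 127, 1146, 33366]⟩, ⟨triple 3
    5 6, 1, [5, 67, 34, 23445, 16666, 12345]⟩, ⟨triple 1 3 6, 1, [1, 56, 136, 11677]⟩, ⟨triple 1 3
    6, 4, [1, 136, 2445, 2277, 14677]⟩, ⟨triple 1 2 6, 1, [6, 147, 124, 24667, 12346]⟩, ⟨triple 1
    3 4, 1, [6, 455, 366, 155, 117, 112, 3777, 3445, 1567, 22466]⟩, ⟨cub 0 1 11, 2, [777, 445,
    333, 4556, 2235, 1126]⟩, ⟨cub 0 0 3, 2, [677, 355, 123, 3345, 1466, 23667]⟩, ⟨triple 1 3 5, 4,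
    [36, 555, 157, 1137, 1123, 33445]⟩, ⟨rotation 1 4, 2, [33, 577, 111, 11136, 555666]⟩,
    ⟨rotation 1 4, 1, [66, 222, 4467]⟩, ⟨rotation 1 3, 2, [34, 26, 13, 2244, 1557]⟩, ⟨rotation 1
    3, 7, [67, 26, 2447, 2244, 1127, 1122, 46666]⟩, ⟨triple 1 4 5, 2, [77, 27, 116, 4566, 55577]⟩,
    ⟨triple 1 2 5, 4, [47, 6677, 3344, 1133, 45557, 13356, 12555, 12457, 11666, 11225]⟩, ⟨triple 1
    2 5, 7, [55, 24, 12, 567, 6677, 1367, 1133]⟩, ⟨rotation 1 3, 4, [34, 26, 2447, 1177]⟩, ⟨triple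
    1 5 6, 4, [66, 333, 115, 3666, 1167, 12566]⟩, ⟨triple 1 2 5, 2, [55, 47, 12, 256, 14666]⟩,
    ⟨triple 1 2 5, 1, [17, 45557, 23337]⟩, ⟨rotation 1 2, 1, [36, 1137, 1123]⟩, ⟨rotation 1 6, 4,
    [46, 566, 337, 5777, 1455, 1112, 23477, 22355, 15556, 12237]⟩, ⟨triple 1 5 6, 1, [66, 445,
    222, 3444, 2235, 1556, 1344, 23347, 13456]⟩, ⟨rotation 3 6, 1, [55, 135, 6677, 22222, 11111]⟩,
    ⟨triple 1 4 5, 1, [44, 11, 377, 4667, 2466, 1266, 11125]⟩, ⟨triple 1 3 5, 7, [36, 555, 3447,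
    3366, 1355]⟩, ⟨rotation 1 3, 1, [26, 22223]⟩, ⟨triple 1 3 5, 2, [36, 457, 245, 1347, 22337]⟩,
    ⟨triple 1 2 3, 1, [557, 224, 6666, 22667, 11566]⟩, ⟨rotation 1 2, 4, [555, 3455, 3366, 1677,
    12356]⟩, ⟨rotation 1 5, 7, [477, 177, 5677, 1235, 22667, 12367, 555557]⟩, ⟨triple 1 2 4, 1,
    [556, 467, 246, 167, 113, 2233, 23466, 12455]⟩, ⟨rotation 1 6, 7, [466, 335, 166, 4777, 44556,
    22567, 11556, 11113]⟩, ⟨triple 1 5 6, 7, [577, 114, 34446]⟩, ⟨triple 1 2 6, 4, [455, 147, 112,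
    3777]⟩, ⟨triple 1 2 3, 4, [477, 336, 177, 122, 3555, 2567, 2256, 1235, 13677]⟩, ⟨triple 1 2 4,
    4, [556, 3377, 2566, 66677, 44477, 23466, 13667]⟩, ⟨triple 1 5 6, 2, [444, 144, 1456, 1156]⟩,
    ⟨triple 1 4 6, 2, [277, 4556, 2235, 1556, 45667, 13377]⟩, ⟨triple 1 2 4, 7, [347, 24557,
    23346, 15577]⟩, ⟨rotation 1 5, 1, [447, 366, 2223, 24667]⟩, ⟨triple 1 2 4, 2, [347, 137, 3345,
    55557, 45666, 22455, 12557]⟩, ⟨rotation 1 6, 2, [466, 155566]⟩, ⟨triple 1 2 3, 7, [447, 147,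
    117, 3445, 3333, 2223, 34467, 16677]⟩, ⟨triple 1 4 6, 1, [577, 15566, 13357, 11667]⟩, ⟨triple
    1 3 6, 2, [334, 236, 4666, 2555, 1577, 22467]⟩, ⟨triple 1 3 5, 1, [3366, 2556, 1355, 33445]⟩,
    ⟨rotation 1 6, 1, [5777, 2577, 1155, 1147]⟩, ⟨rotation 1 2, 2, [3366, 1123]⟩, ⟨rotation 1 5,
    2, [11337]⟩] (by decide +kernel) r hr
  simp only [evalSum_cons, evalSum_nil, prodEval_cons, prodEval_nil, eval_index] at h
  exact CharTwo.add_eq_zero.1 (by linear_combination h)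

/-- Grouped as k²(k + k⁴), multiples of ec, k·dck and k²·ad, this reduces t³W/a to quotients
established separately. -/
theorem polyW_expand {r : ℤ} (hr : IsCoprime r (15 : ℕ)) : eval 15 r polyW = thetaAt 15 r 5 ^ 3 +
    thetaAt 15 r 2 * thetaAt 15 r 4 * thetaAt 15 r 5 + thetaAt 15 r 3 * thetaAt 15 r 4 * thetaAt
    15 r 5 ^ 2 + thetaAt 15 r 2 * thetaAt 15 r 4 * thetaAt 15 r 6 * thetaAt 15 r 7 + thetaAt 15 r
    2 * thetaAt 15 r 3 * thetaAt 15 r 4 ^ 2 + thetaAt 15 r 2 ^ 2 * thetaAt 15 r 4 * thetaAt 15 r 6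
    + thetaAt 15 r 1 * thetaAt 15 r 3 * thetaAt 15 r 5 ^ 2 + thetaAt 15 r 5 ^ 6 := by
  have h := evalSum_eq_zero (l := 15) (by decide) (by decide) [[polyW], [[[5]], [[5]], [[5]]],
    [[[2]], [[4]], [[5]]], [[[3]], [[4]], [[5]], [[5]]], [[[2]], [[4]], [[6]], [[7]]], [[[2]],
    [[3]], [[4]], [[4]]], [[[2]], [[2]], [[4]], [[6]]], [[[1]], [[3]], [[5]], [[5]]], [[[5]],
    [[5]], [[5]], [[5]], [[5]], [[5]]]] [] (by decide +kernel) r hr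
  simp only [evalSum_cons, evalSum_nil, prodEval_cons, prodEval_nil, eval_index] at h
  exact CharTwo.add_eq_zero.1 (by linear_combination h)

end Fifteen

/-! ### Ideals of S stable under multiplication by t, and the deepest projections. -/

noncomputable section

/-! ### Membership in `S` -/

/-- The `S`-module generated by the theta series with indices in `g`. -/
def idealSpan (l : ℕ) (r : ℤ) (g : List ℕ) : Submodule (S l) L :=
  Submodule.span (S l) {x | ∃ i ∈ g, x = thetaAt l r i}

theorem thetaAt_mem (l : ℕ) (r : ℤ) (i : ℕ) : thetaAt l r i ∈ S l := thetaL_mem l _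

theorem mul_mem_idealSpan {l : ℕ} {r : ℤ} {g : List ℕ} {s x : L} (hs : s ∈ S l)
    (hx : x ∈ idealSpan l r g) : s * x ∈ idealSpan l r g :=
  (idealSpan l r g).smul_mem (⟨s, hs⟩ : S l) hx

theorem mem_of_mem_idealSpan {l : ℕ} {r : ℤ} {g : List ℕ} {x : L}
    (hx : x ∈ idealSpan l r g) : x ∈ S l := by
  induction hx using Submodule.span_induction with
  | mem x hx =>
    obtain ⟨i, _, rfl⟩ := hx
    exact thetaAt_mem l r i
  | zero => exact zero_mem _
  | add x y _ _ hx hy => exact add_mem hx hy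
  | smul s x _ hx => exact mul_mem s.2 hx

theorem thetaAt_mem_idealSpan {l : ℕ} {r : ℤ} {g : List ℕ} {i : ℕ} (hi : i ∈ g) :
    thetaAt l r i ∈ idealSpan l r g := Submodule.subset_span ⟨i, hi, rfl⟩

theorem evalMon_mem (l : ℕ) (r : ℤ) (m : List ℕ) : evalMon l r m ∈ S l := by
  refine list_prod_mem fun y hy => ?_
  obtain ⟨i, _, rfl⟩ := List.mem_map.1 hy
  exact thetaL_mem l _

/-- A monomial containing an index from g is an S-multiple of that generator, so membership can be
decided by inspecting monomials. -/
theorem eval_mem_idealSpan {l : ℕ} {r : ℤ} {g : List ℕ} {p : Poly}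
    (hp : ∀ m ∈ p, ∃ i ∈ m, i ∈ g) : eval l r p ∈ idealSpan l r g := by
  refine list_sum_mem fun x hx => ?_
  obtain ⟨m, hm, rfl⟩ := List.mem_map.1 hx
  obtain ⟨i, hi, hg⟩ := hp m hm
  obtain ⟨s, u, rfl⟩ := List.append_of_mem hi
  have e : evalMon l r (s ++ i :: u) = evalMon l r s * evalMon l r u * thetaAt l r i := by
    simp only [evalMon, List.map_append, List.map_cons, List.prod_append, List.prod_cons, thetaAt]
    ring
  rw [e]
  exact mul_mem_idealSpan (mul_mem (evalMon_mem l r s) (evalMon_mem l r u))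
    (thetaAt_mem_idealSpan hg)

/-- By S-linearity it suffices to test generators. This lets powers of t be applied without assuming
t ∈ S. -/
theorem mul_mem_idealSpan_of_stable {l : ℕ} {r : ℤ} {g : List ℕ} {t x : L}
    (ht : ∀ i ∈ g, t * thetaAt l r i ∈ idealSpan l r g) (hx : x ∈ idealSpan l r g) :
    t * x ∈ idealSpan l r g := by
  induction hx using Submodule.span_induction with
  | mem x hx =>
    obtain ⟨i, hi, rfl⟩ := hx
    exact ht i hi
  | zero => rw [mul_zero]; exact zero_mem _
  | add x y _ _ hx hy => rw [mul_add]; exact add_mem hx hy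
  | smul s x _ hx => rw [mul_smul_comm]; exact Submodule.smul_mem _ s hx

namespace Tower

variable {a b c d e g₃ g₅ g₇ t : L}

/-- The even part of ab equals b⁴c⁴ + (a+b⁴)(b+c⁴) = ab + ac⁴ + b⁵, and by rotation it equals (cd)²;
finally b⁵ = a·tb. -/
theorem mul_quartic (h : Tower a b c d e g₃ g₅ g₇) (ht : a * t = b ^ 4) :
    a * (c ^ 4 + t * b + b) = c ^ 2 * d ^ 2 := by
  have h1 := even_part_mul ((homog_pow_four b).mono (by decide)) (h.homog_a.mono (by decide))
    ((homog_pow_four c).mono (by decide)) (h.homog_b.mono (by decide))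
  rw [h.even_ab] at h1
  rw [← mul_pow, h1, mul_add, mul_add, ← mul_assoc, ht]
  grind

/-- Modulo S, `numer`/a is congruent to bc²d/a (by X) and hence to dc⁶/a (by J). The even part of
dc⁶/a is C², and its class-1 part modulo 4 is in S by assumption. The odd part of bcd/a is bcd/a
plus the square of `numer`/a; the squares of bc²d/a, both equal to R/a, cancel and leave K + X². -/
theorem mem_of_root {l : ℕ} (hl : Odd l) (h : Tower a b c d e g₃ g₅ g₇) {X J R K C : L}
    (mX : X ∈ S l) (mJ : J ∈ S l) (mK : K ∈ S l) (mC : C ∈ S l)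
    (hX : a * X = numer b c d e g₃ g₅ g₇ + b * c ^ 2 * d) (hJ : a * J = b * c ^ 2 * d + d * c ^ 6)
    (hR : a * R = b ^ 2 * c ^ 4 * d ^ 2) (hK : a * K = b * c * d + R)
    (hC : a * C = c ^ 3 * g₇ * e) (h41 : proj 4 1 (d * c ^ 6 / a) ∈ S l) :
    proj 16 8 (1 / a) ∈ S l ∧ proj 32 0 (1 / a) ∈ S l ∧ proj 64 16 (1 / a) ∈ S l := by
  have ha := h.ne_zero
  have hU : numer b c d e g₃ g₅ g₇ / a = X + J + d * c ^ 6 / a := by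
    rw [div_eq_iff ha, add_mul, div_mul_cancel₀ _ ha]
    linear_combination -hX - hJ - (b * c ^ 2 * d + d * c ^ 6) * CharTwo.two_eq_zero (R := L)
  refine ⟨?_, ?_, ?_⟩
  · have e1 : b * c * d / a + (numer b c d e g₃ g₅ g₇ / a) ^ 2 = K + X ^ 2 := by
      have e2 : numer b c d e g₃ g₅ g₇ / a = X + b * c ^ 2 * d / a := by
        rw [div_eq_iff ha, add_mul, div_mul_cancel₀ _ ha]
        linear_combination -hX - (b * c ^ 2 * d) * CharTwo.two_eq_zero (R := L)
      have e3 : (b * c ^ 2 * d / a) ^ 2 = R / a := by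
        rw [div_pow, div_eq_div_iff (pow_ne_zero _ ha) ha]
        linear_combination -a * hR
      have e4 : b * c * d / a = K + R / a := by
        rw [div_eq_iff ha, add_mul, div_mul_cancel₀ _ ha]
        linear_combination -hK - R * CharTwo.two_eq_zero (R := L)
      rw [e2, CharTwo.add_sq, e3, e4]
      linear_combination (R / a) * CharTwo.two_eq_zero (R := L)
    have := (h.proj_inv_eight 2 1 : proj 16 8 (1 / a) = _)
    rw [this, h.proj_prod_odd, e1]
    exact pow_mem (add_mem mK (pow_mem mX 2)) 8
  · have := (h.proj_inv_sixteen 2 0 : proj 32 0 (1 / a) = _)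
    rw [this, hU, proj_add, h.even_part_mul_div, ← hC, mul_div_cancel_left₀ _ ha]
    exact pow_mem (add_mem (proj_two_mem hl (add_mem mX mJ)) (pow_mem mC 2)) 16
  · have := (h.proj_inv_sixteen 4 1 : proj 64 16 (1 / a) = _)
    rw [this, hU, proj_add]
    exact pow_mem (add_mem (proj_four_mem hl (add_mem mX mJ) 1) h41) 16

/-! The remaining projections, in terms of quotients by `a`. -/

theorem proj_eight_two (h : Tower a b c d e g₃ g₅ g₇) (ht : a * t = b ^ 4) :
    proj 8 2 (1 / a) = ((1 + t) * (c ^ 4 + t * b + b) ^ 2 / a) ^ 2 := by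
  rw [← (h.proj_four_sq ht).1]
  exact h.proj_inv_even 4 1

theorem proj_eight_six (h : Tower a b c d e g₃ g₅ g₇) (ht : a * t = b ^ 4) :
    proj 8 6 (1 / a) = ((1 + t) * (c ^ 4 + t * b) ^ 2 / a) ^ 2 := by
  rw [← (h.proj_four_sq ht).2]
  exact h.proj_inv_even 4 3

theorem proj_sixteen_four (h : Tower a b c d e g₃ g₅ g₇) (ht : a * t = b ^ 4) :
    proj 16 4 (1 / a) = ((c ^ 4 + t * b) * (c ^ 4 + t * b + b) ^ 2 / a) ^ 4 := by
  rw [← (h.proj_four_cube ht).1]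
  exact h.proj_inv_four 4 1

theorem proj_sixteen_six (h : Tower a b c d e g₃ g₅ g₇) (ht : a * t = b ^ 4) :
    proj 16 6 (1 / a) = (t ^ 4 * (1 + t) * (c ^ 4 + t * b) ^ 2 / a) ^ 2 := by
  rw [← (h.proj_sq_three ht).1]
  exact h.proj_inv_even 8 3

theorem proj_sixteen_ten (h : Tower a b c d e g₃ g₅ g₇) (ht : a * t = b ^ 4) :
    proj 16 10 (1 / a) = ((1 + t) ^ 3 * t ^ 2 * (c ^ 4 + t * b) ^ 2 / a) ^ 2 := by
  rw [← h.proj_sq_five ht]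
  exact h.proj_inv_even 8 5

theorem proj_sixteen_fourteen (h : Tower a b c d e g₃ g₅ g₇) (ht : a * t = b ^ 4) :
    proj 16 14 (1 / a) = ((1 + t) ^ 5 * (c ^ 4 + t * b) ^ 2 / a) ^ 2 := by
  rw [← (h.proj_sq_three ht).2]
  exact h.proj_inv_even 8 7

theorem proj_thirtytwo_twelve (h : Tower a b c d e g₃ g₅ g₇) (ht : a * t = b ^ 4) :
    proj 32 12 (1 / a) = ((c ^ 4 + t * b) ^ 2 * ((1 + t) * (c + e ^ 4 + t * c) ^ 4 +
      (b + c ^ 4) * (c ^ 4 + t * b + b) ^ 4 / a) / a) ^ 4 := by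
  rw [← h.proj_cube_three ht]
  exact h.proj_inv_four 8 3

end Tower

theorem thetaL_eq_of_add {l : ℕ} {x y : ℤ} (z : ℤ) (h : x + y = l * z) :
    thetaL l x = thetaL l y := by
  rw [← thetaL_neg l y]
  exact thetaL_eq_of_sub z (by rw [← h]; ring)

theorem mul_eq_of_mul_eq {a t u f P : L} (ha : a ≠ 0) (ht : a * t = u) (h : a * P = u * f) :
    t * f = P := mul_left_cancel₀ ha (by rw [h, ← ht, mul_assoc])

end

/-! ### The nine projections for l = 11. -/

namespace Eleven

/-- Take s = 7r: then 8s ≡ r modulo 11, and the other multiples of s are reduced up to sign. -/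
theorem tower_eleven (r : ℤ) : Tower (thetaAt 11 r 1) (thetaAt 11 r 5) (thetaAt 11 r 3)
    (thetaAt 11 r 2) (thetaAt 11 r 4) (thetaAt 11 r 1) (thetaAt 11 r 2) (thetaAt 11 r 5) := by
  have h := tower (by decide : Odd 11) (7 * r)
  have e8 : thetaL 11 (8 * (7 * r)) = thetaAt 11 r 1 :=
    thetaL_eq_of_sub (5 * r) (by push_cast; ring)
  have e4 : thetaL 11 (4 * (7 * r)) = thetaAt 11 r 5 :=
    thetaL_eq_of_add (3 * r) (by push_cast; ring)
  have e2 : thetaL 11 (2 * (7 * r)) = thetaAt 11 r 3 :=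
    thetaL_eq_of_sub r (by push_cast; ring)
  have e6 : thetaL 11 (6 * (7 * r)) = thetaAt 11 r 2 :=
    thetaL_eq_of_add (4 * r) (by push_cast; ring)
  have e1 : thetaL 11 (7 * r) = thetaAt 11 r 4 := thetaL_eq_of_add r (by push_cast; ring)
  have e3 : thetaL 11 (3 * (7 * r)) = thetaAt 11 r 1 :=
    thetaL_eq_of_add (2 * r) (by push_cast; ring)
  have e5 : thetaL 11 (5 * (7 * r)) = thetaAt 11 r 2 :=
    thetaL_eq_of_sub (3 * r) (by push_cast; ring)
  have e7 : thetaL 11 (7 * (7 * r)) = thetaAt 11 r 5 :=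
    thetaL_eq_of_sub (4 * r) (by push_cast; ring)
  rwa [e8, e4, e2, e6, e3, e5, e7, e1] at h

theorem proj_inv_mem {r : ℤ} (hr : IsCoprime r (11 : ℕ)) :
    ∀ qj ∈ ([(8, 1), (8, 3), (8, 6), (16, 4), (16, 8), (16, 10), (32, 0), (32, 12), (64, 16)] :
      List (ℕ × ℕ)), proj qj.1 qj.2 (1 / thetaAt 11 r 1) ∈ S 11 := by
  have h := tower_eleven r
  have ha := h.ne_zero
  have hQ2 := mul2_eq hr
  have hQ3 := mul3_eq hr
  have hQ4 := mul4_eq hr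
  have hQ5 := mul5_eq hr
  have hW := polyW_eq hr
  have hV := polyV_eq hr
  have hY := polyY_eq hr
  have hE := polyE_eq hr
  have hG := polyG_eq hr
  have hG' := polyG_factor hr
  have hE1 := quotE1_eq hr
  have hE2 := quotE2_eq hr
  have hTE := polyTE_eq hr
  have hTE1 := quotTE1_eq hr
  have hTE2 := quotTE2_eq hr
  have hX := rootX_eq hr
  have hJ := rootJ_eq hr
  have hR := rootR_eq hr
  have hK := rootK_eq hr
  have hC := rootC_eq hr
  have mQ : ∀ p, eval 11 r p ∈ S 11 := eval_mem 11 r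
  have mf : ∀ i, thetaAt 11 r i ∈ S 11 := thetaAt_mem 11 r
  obtain ⟨t, ht⟩ : ∃ t, thetaAt 11 r 1 * t = thetaAt 11 r 5 ^ 4 :=
    ⟨thetaAt 11 r 5 ^ 4 / thetaAt 11 r 1, mul_div_cancel₀ _ ha⟩
  have q2 := mul_eq_of_mul_eq ha ht hQ2
  have q3 := mul_eq_of_mul_eq ha ht hQ3
  have q4 := mul_eq_of_mul_eq ha ht hQ4
  have q5 := mul_eq_of_mul_eq ha ht (hQ5.trans (by ring))
  -- For the generator a the product is ta = b⁴; the others are the certified quotients, all of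
  -- whose monomials contain a generator.
  have stable : ∀ x ∈ idealSpan 11 r [1, 2, 3, 4, 5], t * x ∈ idealSpan 11 r [1, 2, 3, 4, 5] := by
    refine fun x hx => mul_mem_idealSpan_of_stable ?_ hx
    intro i hi
    fin_cases hi
    · rw [mul_comm, ht, pow_succ]
      exact mul_mem_idealSpan (pow_mem (mf 5) 3) (thetaAt_mem_idealSpan (by decide))
    · rw [q2]; exact eval_mem_idealSpan (by decide +kernel)
    · rw [q3]; exact eval_mem_idealSpan (by decide +kernel)
    · rw [q4]; exact eval_mem_idealSpan (by decide +kernel)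
    · rw [q5]; exact eval_mem_idealSpan (by decide +kernel)
  have mY : eval 11 r polyY ∈ idealSpan 11 r [1, 2, 3, 4, 5] := eval_mem_idealSpan (by decide +kernel)
  have mT : eval 11 r quotTE2 ∈ idealSpan 11 r [1, 2, 3, 4, 5] :=
    eval_mem_idealSpan (by decide +kernel)
  have mTE := mQ quotTE1
  have mE2 := mQ quotE2
  have mW := mQ polyW
  have mE := mQ polyE
  have mG := mQ polyG
  have mQd := mQ mul2
  have mb := mf 5
  have mc := mf 3
  have md := mf 2
  have me := mf 4
  have m1 := mf 1
  have root := h.mem_of_root (by decide : Odd 11) (mQ rootX) (mQ rootJ) (mQ rootK) (mQ rootC)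
    (R := eval 11 r rootR)
  generalize eval 11 r mul2 = Q2 at *
  generalize eval 11 r mul3 = Q3 at *
  generalize eval 11 r mul4 = Q4 at *
  generalize eval 11 r mul5 = Q5 at *
  generalize eval 11 r polyW = W at *
  generalize eval 11 r polyV = V at *
  generalize eval 11 r polyY = Y at *
  generalize eval 11 r polyE = E at *
  generalize eval 11 r polyG = G at *
  generalize eval 11 r quotE1 = E1 at *
  generalize eval 11 r quotE2 = E2 at *
  generalize eval 11 r polyTE = TE at *
  generalize eval 11 r quotTE1 = P1 at *
  generalize eval 11 r quotTE2 = P2 at *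
  generalize thetaAt 11 r 1 = a at *
  generalize thetaAt 11 r 2 = d at *
  generalize thetaAt 11 r 3 = c at *
  generalize thetaAt 11 r 4 = e at *
  generalize thetaAt 11 r 5 = b at *
  clear hQ2 hQ3 hQ4 hQ5
  rw [← q5] at hE hTE hW
  rw [← q3] at hG hTE
  have two : (2 : L) = 0 := CharTwo.two_eq_zero
  have hD := h.mul_quartic ht
  have hD' : E + b = c ^ 2 * d ^ 2 / a := by rw [eq_div_iff ha, mul_comm, hE, hD]
  have hWt : W = t ^ 2 + t := mul_left_cancel₀ ha (by rw [hW]; linear_combination (-t - 1) * ht)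
  have hVt : V = t * W := mul_left_cancel₀ ha (by rw [hV]; linear_combination (-W) * ht)
  have hYt : Y = t ^ 3 * (1 + t) / a := by
    rw [eq_div_iff ha, mul_comm, hY, hVt, hWt]
    linear_combination (t ^ 2 + t ^ 3) * two
  have hTEt : TE = (1 + t) * E := by
    rw [hTE, hE]
    linear_combination b * hWt + t * b * two
  have hED : E2 * d ^ 2 = E * (E + b) / a := by
    have h2 : E2 = E * c ^ 2 / a ^ 2 := by
      rw [eq_div_iff (pow_ne_zero 2 ha)]
      linear_combination a * hE2 + c * hE1
    rw [hD', h2]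
    field_simp
  have mED : E * (E + b) / a ∈ S 11 := hED ▸ mul_mem mE2 (pow_mem md 2)
  -- One factor E is expanded as c³·c + t·b, matching the certified quotients of (1+t)Ec and
  -- (1+t)Eb.
  have hTEE : P1 * c ^ 3 + t * P2 = (1 + t) * E ^ 2 / a := by
    rw [eq_div_iff ha]
    linear_combination c ^ 3 * hTE1 + t * hTE2 + (c ^ 4 + t * b) * hTEt - (1 + t) * E * hE
  have mTEE : (1 + t) * E ^ 2 / a ∈ S 11 :=
    hTEE ▸ add_mem (mul_mem mTE (pow_mem mc 3)) (mem_of_mem_idealSpan (stable _ mT))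
  have mD : E + b ∈ S 11 := add_mem mE mb
  have h41 : proj 4 1 (d * c ^ 6 / a) ∈ S 11 := by
    rw [h.proj_four_mul_div ht, ← hG, q2,
      show (a ^ 4 + Q2) * G ^ 2 / a = (a ^ 4 + Q2) * d ^ 2 * G by
        rw [div_eq_iff ha]; linear_combination (a ^ 4 + Q2) * G * hG']
    exact mul_mem (pow_mem mc 4)
      (mul_mem (mul_mem (add_mem (pow_mem m1 4) mQd) (pow_mem md 2)) mG)
  have root := root (by rw [Tower.numer]; linear_combination hX) (by linear_combination hJ)
    (by linear_combination hR) (by linear_combination hK) (by linear_combination hC) h41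
  intro qj hqj
  fin_cases hqj
  · change proj 8 1 (1 / a) ∈ S 11
    rw [(h.proj_eight_inv ht).1, show t ^ 6 * (1 + t) / a = t * (t * (t * Y)) by rw [hYt]; ring]
    exact mem_of_mem_idealSpan (stable _ (stable _ (stable _ mY)))
  · change proj 8 3 (1 / a) ∈ S 11
    rw [(h.proj_eight_inv ht).2.2,
      -- In characteristic 2, (1+t)³ = (1+t)(1+t²), and Y = t³(1+t)/a.
      show t ^ 4 * (1 + t) ^ 3 / a = t * Y + t * (t * (t * Y)) by
        rw [hYt]; linear_combination (t ^ 5 * (1 + t) / a) * two]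
    exact mem_of_mem_idealSpan (add_mem (stable _ mY) (stable _ (stable _ (stable _ mY))))
  · change proj 8 6 (1 / a) ∈ S 11
    rw [h.proj_eight_six ht, ← hE]
    exact pow_mem mTEE 2
  · change proj 16 4 (1 / a) ∈ S 11
    rw [h.proj_sixteen_four ht, ← hE,
      show E * (E + b) ^ 2 / a = E * (E + b) / a * (E + b) by ring]
    exact pow_mem (mul_mem mED mD) 4
  · exact root.1
  · change proj 16 10 (1 / a) ∈ S 11
    rw [h.proj_sixteen_ten ht, ← hE,
      show (1 + t) ^ 3 * t ^ 2 * E ^ 2 / a = (1 + t) * E ^ 2 / a * W ^ 2 by rw [hWt]; ring]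
    exact pow_mem (mul_mem mTEE (pow_mem mW 2)) 2
  · exact root.2.1
  · change proj 32 12 (1 / a) ∈ S 11
    rw [h.proj_thirtytwo_twelve ht, ← hE, ← hG,
      show E ^ 2 * ((1 + t) * G ^ 4 + (b + c ^ 4) * (E + b) ^ 4 / a) / a =
        (1 + t) * E ^ 2 / a * G ^ 4 + (E * (E + b) / a) ^ 2 * (E + b) ^ 2 * (b + c ^ 4) by
          field_simp]
    exact pow_mem (add_mem (mul_mem mTEE (pow_mem mG 4)) (mul_mem (mul_mem (pow_mem mED 2)
      (pow_mem mD 2)) (add_mem mb (pow_mem mc 4)))) 4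
  · exact root.2.2

end Eleven

/-! ### The nine projections for l = 13. -/

namespace Thirteen

/-- Take s = 5r, as 8 · 5 = 40 ≡ 1 modulo 13. -/
theorem tower_thirteen (r : ℤ) : Tower (thetaAt 13 r 1) (thetaAt 13 r 6) (thetaAt 13 r 3)
    (thetaAt 13 r 4) (thetaAt 13 r 5) (thetaAt 13 r 2) (thetaAt 13 r 1) (thetaAt 13 r 4) := by
  have h := tower (by decide : Odd 13) (5 * r)
  have e8 : thetaL 13 (8 * (5 * r)) = thetaAt 13 r 1 :=
    thetaL_eq_of_sub (3 * r) (by push_cast; ring)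
  have e4 : thetaL 13 (4 * (5 * r)) = thetaAt 13 r 6 :=
    thetaL_eq_of_add (2 * r) (by push_cast; ring)
  have e2 : thetaL 13 (2 * (5 * r)) = thetaAt 13 r 3 :=
    thetaL_eq_of_add (1 * r) (by push_cast; ring)
  have e6 : thetaL 13 (6 * (5 * r)) = thetaAt 13 r 4 :=
    thetaL_eq_of_sub (2 * r) (by push_cast; ring)
  have e1 : thetaL 13 (5 * r) = thetaAt 13 r 5 :=
    thetaL_eq_of_sub (0 * r) (by push_cast; ring)
  have e3 : thetaL 13 (3 * (5 * r)) = thetaAt 13 r 2 :=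
    thetaL_eq_of_sub (1 * r) (by push_cast; ring)
  have e5 : thetaL 13 (5 * (5 * r)) = thetaAt 13 r 1 :=
    thetaL_eq_of_add (2 * r) (by push_cast; ring)
  have e7 : thetaL 13 (7 * (5 * r)) = thetaAt 13 r 4 :=
    thetaL_eq_of_add (3 * r) (by push_cast; ring)
  rwa [e8, e4, e2, e6, e3, e5, e7, e1] at h

theorem proj_inv_mem {r : ℤ} (hr : IsCoprime r (13 : ℕ)) :
    ∀ qj ∈ ([(8, 2), (8, 3), (8, 5), (16, 4), (16, 8), (16, 14), (32, 0), (32, 12), (64, 16)] :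
      List (ℕ × ℕ)), proj qj.1 qj.2 (1 / thetaAt 13 r 1) ∈ S 13 := by
  have h := tower_thirteen r
  have ha := h.ne_zero
  have hQ2 := mul2_eq hr
  have hQ3 := mul3_eq hr
  have hQ4 := mul4_eq hr
  have hQ5 := mul5_eq hr
  have hQ6 := mul6_eq hr
  have hW := polyW_eq hr
  have hE := polyE_eq hr
  have hG := polyG_eq hr
  have hX := rootX_eq hr
  have hJ := rootJ_eq hr
  have hR := rootR_eq hr
  have hK := rootK_eq hr
  have hC := rootC_eq hr
  have hV := polyV_eq hr
  have hY := polyY_eq hr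
  have hG' := polyG_factor hr
  have hE1 := quotE1_eq hr
  have hE2 := quotE2_eq hr
  have hE3 := quotE3_eq hr
  have hT1 := quotT1_eq hr
  have hT2 := quotT2_eq hr
  have hT3 := quotT3_eq hr
  have hTb := quotTb_eq hr
  have mQ : ∀ p, eval 13 r p ∈ S 13 := eval_mem 13 r
  have mth : ∀ i, thetaAt 13 r i ∈ S 13 := thetaAt_mem 13 r
  obtain ⟨t, ht⟩ : ∃ t, thetaAt 13 r 1 * t = thetaAt 13 r 6 ^ 4 :=
    ⟨thetaAt 13 r 6 ^ 4 / thetaAt 13 r 1, mul_div_cancel₀ _ ha⟩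
  have q2 := mul_eq_of_mul_eq ha ht hQ2
  have q3 := mul_eq_of_mul_eq ha ht hQ3
  have q4 := mul_eq_of_mul_eq ha ht hQ4
  have q5 := mul_eq_of_mul_eq ha ht hQ5
  have q6 := mul_eq_of_mul_eq ha ht (hQ6.trans (by ring))
  have stable : ∀ x ∈ idealSpan 13 r [1, 2, 3, 4, 5, 6], t * x ∈ idealSpan 13 r [1, 2, 3, 4, 5, 6] := by
    refine fun x hx => mul_mem_idealSpan_of_stable ?_ hx
    intro i hi
    fin_cases hi
    · rw [mul_comm, ht, pow_succ]
      exact mul_mem_idealSpan (pow_mem (mth 6) 3) (thetaAt_mem_idealSpan (by decide))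
    · rw [q2]; exact eval_mem_idealSpan (by decide +kernel)
    · rw [q3]; exact eval_mem_idealSpan (by decide +kernel)
    · rw [q4]; exact eval_mem_idealSpan (by decide +kernel)
    · rw [q5]; exact eval_mem_idealSpan (by decide +kernel)
    · rw [q6]; exact eval_mem_idealSpan (by decide +kernel)
  have mY : eval 13 r polyY ∈ idealSpan 13 r [1, 2, 3, 4, 5, 6] :=
    eval_mem_idealSpan (by decide +kernel)
  have mT3 : eval 13 r quotT3 ∈ idealSpan 13 r [1, 2, 3, 4, 5, 6] :=
    eval_mem_idealSpan (by decide +kernel)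
  have mTb : eval 13 r quotTb ∈ idealSpan 13 r [1, 2, 3, 4, 5, 6] :=
    eval_mem_idealSpan (by decide +kernel)
  have mG' : eval 13 r polyG ∈ idealSpan 13 r [1, 2, 3, 4, 5, 6] :=
    eval_mem_idealSpan (by decide +kernel)
  have mE := mQ polyE
  have mG := mQ polyG
  have mE3 := mQ quotE3
  have mQd := mQ mul4
  have mb := mth 6
  have mc := mth 3
  have md := mth 4
  have me := mth 5
  have mf := mth 2
  have ma := mth 1
  have root := h.mem_of_root (by decide : Odd 13) (mQ rootX) (mQ rootJ) (mQ rootK) (mQ rootC)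
    (R := eval 13 r rootR)
  generalize eval 13 r mul2 = Q2 at *
  generalize eval 13 r mul3 = Q3 at *
  generalize eval 13 r mul4 = Q4 at *
  generalize eval 13 r mul5 = Q5 at *
  generalize eval 13 r mul6 = Q6 at *
  generalize eval 13 r polyW = W at *
  generalize eval 13 r polyE = E at *
  generalize eval 13 r polyG = G at *
  generalize eval 13 r polyV = V at *
  generalize eval 13 r polyY = Y at *
  generalize eval 13 r quotE1 = E1 at *
  generalize eval 13 r quotE2 = E2 at *
  generalize eval 13 r quotE3 = E3 at *
  generalize eval 13 r quotT1 = T1 at *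
  generalize eval 13 r quotT2 = T2 at *
  generalize eval 13 r quotT3 = T3 at *
  generalize eval 13 r quotTb = Tb at *
  generalize thetaAt 13 r 1 = a at *
  generalize thetaAt 13 r 6 = b at *
  generalize thetaAt 13 r 3 = c at *
  generalize thetaAt 13 r 4 = d at *
  generalize thetaAt 13 r 5 = e at *
  generalize thetaAt 13 r 2 = f at *
  clear hQ2 hQ3 hQ4 hQ5 hQ6
  rw [← q6] at hE hW hTb
  rw [← q3] at hG
  rw [← q4] at hT1
  have two : (2 : L) = 0 := CharTwo.two_eq_zero
  have hD := h.mul_quartic ht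
  have hD' : E + b = c ^ 2 * d ^ 2 / a := by rw [eq_div_iff ha, mul_comm, hE, hD]
  have hWt : W = t ^ 2 + t := mul_left_cancel₀ ha (by rw [hW]; linear_combination (-t - 1) * ht)
  have mD : E + b ∈ S 13 := add_mem mE mb
  have hVt : V = t * W := mul_left_cancel₀ ha (by rw [hV]; linear_combination (-W) * ht)
  have hYt : Y = t * (1 + t) ^ 3 / a := by
    rw [eq_div_iff ha, mul_comm, hY, hVt, hWt]
    ring
  have hED : E3 * d ^ 2 = E * (E + b) ^ 2 / a := by
    have h3 : E3 = E * c ^ 4 * d ^ 2 / a ^ 3 := by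
      rw [eq_div_iff (pow_ne_zero 3 ha)]
      linear_combination a ^ 2 * hE3 + a * c * d * hE2 + c ^ 3 * d * hE1
    rw [hD', h3]
    field_simp
  have mED : E * (E + b) ^ 2 / a ∈ S 13 := hED ▸ mul_mem mE3 (pow_mem md 2)
  have hTD : d * (d * T3) = (1 + t) * (E + b) ^ 2 / a := by
    have h3 : T3 = (1 + t) * c ^ 4 * d ^ 2 / a ^ 3 := by
      rw [eq_div_iff (pow_ne_zero 3 ha)]
      linear_combination a ^ 2 * hT3 + a * d * hT2 + c ^ 3 * d * hT1
    rw [hD', h3]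
    field_simp
  have mTD : (1 + t) * (E + b) ^ 2 / a ∈ idealSpan 13 r [1, 2, 3, 4, 5, 6] :=
    hTD ▸ mul_mem_idealSpan md (mul_mem_idealSpan md mT3)
  have hTbt : Tb = (1 + t) ^ 2 * b ^ 2 / a := by
    rw [eq_div_iff ha]
    linear_combination hTb - t * b ^ 2 * two
  have stable' : ∀ x ∈ idealSpan 13 r [1, 2, 3, 4, 5, 6],
      (1 + t) * x ∈ idealSpan 13 r [1, 2, 3, 4, 5, 6] := by
    intro x hx
    rw [add_mul, one_mul]
    exact add_mem hx (stable x hx)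
  have h41 : proj 4 1 (d * c ^ 6 / a) ∈ S 13 := by
    rw [h.proj_four_mul_div ht, ← hG, q4,
      show (f ^ 4 + Q4) * G ^ 2 / a = (f ^ 4 + Q4) * f ^ 2 * G by
        rw [div_eq_iff ha]; linear_combination (f ^ 4 + Q4) * G * hG']
    exact mul_mem (pow_mem mc 4)
      (mul_mem (mul_mem (add_mem (pow_mem mf 4) mQd) (pow_mem mf 2)) mG)
  have root := root (by rw [Tower.numer]; linear_combination hX) (by linear_combination hJ)
    (by linear_combination hR) (by linear_combination hK) (by linear_combination hC) h41
  intro qj hqj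
  fin_cases hqj
  · change proj 8 2 (1 / a) ∈ S 13
    rw [h.proj_eight_two ht, ← hE]
    exact pow_mem (mem_of_mem_idealSpan mTD) 2
  · change proj 8 3 (1 / a) ∈ S 13
    rw [(h.proj_eight_inv ht).2.2,
      show t ^ 4 * (1 + t) ^ 3 / a = t * (t * (t * Y)) by rw [hYt]; ring]
    exact mem_of_mem_idealSpan (stable _ (stable _ (stable _ mY)))
  · change proj 8 5 (1 / a) ∈ S 13
    rw [(h.proj_eight_inv ht).2.1,
      show t ^ 2 * (1 + t) ^ 5 / a = (1 + t) * ((1 + t) * (t * Y)) by rw [hYt]; ring]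
    exact mem_of_mem_idealSpan (stable' _ (stable' _ (stable _ mY)))
  · change proj 16 4 (1 / a) ∈ S 13
    rw [h.proj_sixteen_four ht, ← hE]
    exact pow_mem mED 4
  · exact root.1
  · change proj 16 14 (1 / a) ∈ S 13
    rw [h.proj_sixteen_fourteen ht, ← hE,
      -- E² = (E + b)² + b², and both (1+t)(E + b)²/a and (1+t)²b²/a lie in the ideal, which is
      -- stable under 1 + t.
      show (1 + t) ^ 5 * E ^ 2 / a = (1 + t) * ((1 + t) * ((1 + t) * ((1 + t) *
        ((1 + t) * (E + b) ^ 2 / a) + Tb))) by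
          rw [hTbt]; linear_combination (-(1 + t) ^ 5 * (E * b + b ^ 2) / a) * two]
    exact pow_mem (mem_of_mem_idealSpan (stable' _ (stable' _ (stable' _
      (add_mem (stable' _ mTD) mTb))))) 2
  · exact root.2.1
  · change proj 32 12 (1 / a) ∈ S 13
    rw [h.proj_thirtytwo_twelve ht, ← hE, ← hG,
      show E ^ 2 * ((1 + t) * G ^ 4 + (b + c ^ 4) * (E + b) ^ 4 / a) / a =
        E ^ 2 * ((1 + t) * G) * (G ^ 2 * f ^ 2) + (E * (E + b) ^ 2 / a) ^ 2 * (b + c ^ 4) by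
          rw [hG']; field_simp]
    exact pow_mem (add_mem (mul_mem (mul_mem (pow_mem mE 2) (mem_of_mem_idealSpan
      (stable' _ mG'))) (mul_mem (pow_mem mG 2) (pow_mem mf 2))) (mul_mem (pow_mem mED 2)
        (add_mem mb (pow_mem mc 4)))) 4
  · exact root.2.2

end Thirteen

/-! ### The nine projections for l = 15. -/

namespace Fifteen

/-- Take s = 2r, as 8 · 2 = 16 ≡ 1 modulo 15. -/
theorem tower_fifteen (r : ℤ) : Tower (thetaAt 15 r 1) (thetaAt 15 r 7) (thetaAt 15 r 4)
    (thetaAt 15 r 3) (thetaAt 15 r 2) (thetaAt 15 r 6) (thetaAt 15 r 5) (thetaAt 15 r 1) := by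
  have h := tower (by decide : Odd 15) (2 * r)
  have e8 : thetaL 15 (8 * (2 * r)) = thetaAt 15 r 1 :=
    thetaL_eq_of_sub (1 * r) (by push_cast; ring)
  have e4 : thetaL 15 (4 * (2 * r)) = thetaAt 15 r 7 :=
    thetaL_eq_of_add (1 * r) (by push_cast; ring)
  have e2 : thetaL 15 (2 * (2 * r)) = thetaAt 15 r 4 :=
    thetaL_eq_of_sub (0 * r) (by push_cast; ring)
  have e6 : thetaL 15 (6 * (2 * r)) = thetaAt 15 r 3 :=
    thetaL_eq_of_add (1 * r) (by push_cast; ring)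
  have e1 : thetaL 15 (2 * r) = thetaAt 15 r 2 :=
    thetaL_eq_of_sub (0 * r) (by push_cast; ring)
  have e3 : thetaL 15 (3 * (2 * r)) = thetaAt 15 r 6 :=
    thetaL_eq_of_sub (0 * r) (by push_cast; ring)
  have e5 : thetaL 15 (5 * (2 * r)) = thetaAt 15 r 5 :=
    thetaL_eq_of_add (1 * r) (by push_cast; ring)
  have e7 : thetaL 15 (7 * (2 * r)) = thetaAt 15 r 1 :=
    thetaL_eq_of_add (1 * r) (by push_cast; ring)
  rwa [e8, e4, e2, e6, e3, e5, e7, e1] at h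

theorem proj_inv_mem {r : ℤ} (hr : IsCoprime r (15 : ℕ)) :
    ∀ qj ∈ ([(8, 1), (8, 2), (8, 3), (16, 4), (16, 6), (16, 8), (32, 0), (32, 12), (64, 16)] :
      List (ℕ × ℕ)), proj qj.1 qj.2 (1 / thetaAt 15 r 1) ∈ S 15 := by
  have h := tower_fifteen r
  have ha := h.ne_zero
  have hQ2 := mul2_eq hr
  have hQ3 := mul3_eq hr
  have hQ4 := mul4_eq hr
  have hQ6 := mul6_eq hr
  have hQ7 := mul7_eq hr
  have hW := polyW_eq hr
  have hE := polyE_eq hr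
  have hG := polyG_eq hr
  have hX := rootX_eq hr
  have hJ := rootJ_eq hr
  have hR := rootR_eq hr
  have hK := rootK_eq hr
  have hC := rootC_eq hr
  have hW' := polyW_expand hr
  have hE1 := quotE1_eq hr
  have hE2 := quotE2_eq hr
  have hE3 := quotE3_eq hr
  have hTD := polyTD_eq hr
  have hT2 := quotT2_eq hr
  have hT3 := quotT3_eq hr
  have hEg := quotEg_eq hr
  have hL := quotL_eq hr
  have hP := quot345_eq hr
  have hU1 := quotU1_eq hr
  have hU2 := quotU2_eq hr
  have hU3 := quotU3_eq hr
  have hA1 := quotA1_eq hr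
  have hA2 := quotA2_eq hr
  have hA3 := quotA3_eq hr
  have hA4 := quotA4_eq hr
  have mQ : ∀ p, eval 15 r p ∈ S 15 := eval_mem 15 r
  have mth : ∀ i, thetaAt 15 r i ∈ S 15 := thetaAt_mem 15 r
  obtain ⟨t, ht⟩ : ∃ t, thetaAt 15 r 1 * t = thetaAt 15 r 7 ^ 4 :=
    ⟨thetaAt 15 r 7 ^ 4 / thetaAt 15 r 1, mul_div_cancel₀ _ ha⟩
  have q2 := mul_eq_of_mul_eq ha ht hQ2
  have q3 := mul_eq_of_mul_eq ha ht hQ3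
  have q4 := mul_eq_of_mul_eq ha ht hQ4
  have q6 := mul_eq_of_mul_eq ha ht hQ6
  have q7 := mul_eq_of_mul_eq ha ht (hQ7.trans (by ring))
  -- The index 5 is left out of the generators, so no formula for t[5r] is needed.
  have stable : ∀ x ∈ idealSpan 15 r [1, 2, 3, 4, 6, 7], t * x ∈ idealSpan 15 r [1, 2, 3, 4, 6, 7] := by
    refine fun x hx => mul_mem_idealSpan_of_stable ?_ hx
    intro i hi
    fin_cases hi
    · rw [mul_comm, ht, pow_succ]
      exact mul_mem_idealSpan (pow_mem (mth 7) 3) (thetaAt_mem_idealSpan (by decide))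
    · rw [q2]; exact eval_mem_idealSpan (by decide +kernel)
    · rw [q3]; exact eval_mem_idealSpan (by decide +kernel)
    · rw [q4]; exact eval_mem_idealSpan (by decide +kernel)
    · rw [q6]; exact eval_mem_idealSpan (by decide +kernel)
    · rw [q7]; exact eval_mem_idealSpan (by decide +kernel)
  have mT3 : eval 15 r quotT3 ∈ idealSpan 15 r [1, 2, 3, 4, 6, 7] :=
    eval_mem_idealSpan (by decide +kernel)
  have mU3 : eval 15 r quotU3 ∈ idealSpan 15 r [1, 2, 3, 4, 6, 7] :=
    eval_mem_idealSpan (by decide +kernel)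
  have mP : eval 15 r quot345 ∈ idealSpan 15 r [1, 2, 3, 4, 6, 7] :=
    eval_mem_idealSpan (by decide +kernel)
  have mA4 : eval 15 r quotA4 ∈ idealSpan 15 r [1, 2, 3, 4, 6, 7] :=
    eval_mem_idealSpan (by decide +kernel)
  have mG' : eval 15 r polyG ∈ idealSpan 15 r [1, 2, 3, 4, 6, 7] :=
    eval_mem_idealSpan (by decide +kernel)
  have mE := mQ polyE
  have mG := mQ polyG
  have mE3 := mQ quotE3
  have mEg := mQ quotEg
  have mL := mQ quotL
  have mb := mth 7
  have mc := mth 4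
  have md := mth 3
  have me := mth 2
  have mf := mth 6
  have mk := mth 5
  have ma := mth 1
  have md' : thetaAt 15 r 3 ∈ idealSpan 15 r [1, 2, 3, 4, 6, 7] :=
    thetaAt_mem_idealSpan (by decide)
  have root := h.mem_of_root (by decide : Odd 15) (mQ rootX) (mQ rootJ) (mQ rootK) (mQ rootC)
    (R := eval 15 r rootR)
  generalize eval 15 r mul2 = Q2 at *
  generalize eval 15 r mul3 = Q3 at *
  generalize eval 15 r mul4 = Q4 at *
  generalize eval 15 r mul6 = Q6 at *
  generalize eval 15 r mul7 = Q7 at *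
  generalize eval 15 r polyW = W at *
  generalize eval 15 r polyE = E at *
  generalize eval 15 r polyG = G at *
  generalize eval 15 r quotE1 = E1 at *
  generalize eval 15 r quotE2 = E2 at *
  generalize eval 15 r quotE3 = E3 at *
  generalize eval 15 r polyTD = TD at *
  generalize eval 15 r quotT2 = T2 at *
  generalize eval 15 r quotT3 = T3 at *
  generalize eval 15 r quotEg = Eg at *
  generalize eval 15 r quotL = QL at *
  generalize eval 15 r quot345 = P at *
  generalize eval 15 r quotU1 = U1 at *
  generalize eval 15 r quotU2 = U2 at *
  generalize eval 15 r quotU3 = U3 at *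
  generalize eval 15 r quotA1 = A1 at *
  generalize eval 15 r quotA2 = A2 at *
  generalize eval 15 r quotA3 = A3 at *
  generalize eval 15 r quotA4 = A4 at *
  generalize thetaAt 15 r 1 = a at *
  generalize thetaAt 15 r 7 = b at *
  generalize thetaAt 15 r 4 = c at *
  generalize thetaAt 15 r 3 = d at *
  generalize thetaAt 15 r 2 = e at *
  generalize thetaAt 15 r 6 = f at *
  generalize thetaAt 15 r 5 = k at *
  clear hQ2 hQ3 hQ4 hQ6 hQ7
  rw [← q7] at hE hW hTD
  rw [← q4] at hG hTD
  rw [← q3] at hL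
  have two : (2 : L) = 0 := CharTwo.two_eq_zero
  have hD := h.mul_quartic ht
  have hD' : E + b = c ^ 2 * d ^ 2 / a := by rw [eq_div_iff ha, mul_comm, hE, hD]
  have hWt : W = t ^ 2 + t := mul_left_cancel₀ ha (by rw [hW]; linear_combination (-t - 1) * ht)
  have mD : E + b ∈ S 15 := add_mem mE mb
  -- The rotation relation for 4s and s, with b⁴ replaced by at, reads aG = [5s]²[3s]².
  have hGg : a * G = k ^ 2 * f ^ 2 := by
    rw [hG]
    linear_combination h.rotation + c * ht - (k ^ 2 * f ^ 2) * two
  have hED : E3 * c ^ 2 = E * (E + b) ^ 2 / a := by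
    have h3 : E3 = E * c ^ 2 * d ^ 4 / a ^ 3 := by
      rw [eq_div_iff (pow_ne_zero 3 ha)]
      linear_combination a ^ 2 * hE3 + a * d * hE2 + c * d ^ 3 * hE1
    rw [hD', h3]
    field_simp
  have mED : E * (E + b) ^ 2 / a ∈ S 15 := hED ▸ mul_mem mE3 (pow_mem mc 2)
  have hTDt : TD = (1 + t) * (E + b) := by
    rw [hTD, hE]
    linear_combination b * hWt + t * b * two
  have hT3t : T3 = (1 + t) * (E + b) ^ 2 / a := by
    have h3 : T3 = TD * (c ^ 2 * d ^ 2) / a ^ 2 := by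
      rw [eq_div_iff (pow_ne_zero 2 ha)]
      linear_combination a * hT3 + c * d * hT2
    rw [h3, hTDt, sq (E + b)]
    nth_rewrite 3 [hD']
    field_simp
  have hU : a * U3 = t ^ 2 * (k + k ^ 4) := by
    refine mul_left_cancel₀ (pow_ne_zero 2 ha) ?_
    linear_combination a ^ 2 * hU3 + a * b ^ 2 * hU2 + b ^ 5 * hU1 -
      (b ^ 4 + a * t) * (k + k ^ 4) * ht
  have hA : a * A4 = t ^ 3 * (e * c) := by
    refine mul_left_cancel₀ (pow_ne_zero 3 ha) ?_
    linear_combination a ^ 3 * hA4 + a ^ 2 * b ^ 3 * hA3 + a * b ^ 6 * hA2 + b ^ 9 * hA1 -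
      (b ^ 8 + b ^ 4 * (a * t) + (a * t) ^ 2) * (e * c) * ht
  -- This element is t³W/a = t⁴(1+t)/a: the four summands come from the terms of W in k²(k + k⁴), in
  -- ec, in k·dck, and in k²·ad. It takes the place of a single certified quotient.
  have mY : k ^ 2 * (t * U3) + (k + f * b + d * c + e * f) * A4 + k * (t * (t * (t * P))) +
      k ^ 2 * (t * (t * (t * d))) ∈ idealSpan 15 r [1, 2, 3, 4, 6, 7] :=
    add_mem (add_mem (add_mem (mul_mem_idealSpan (pow_mem mk 2) (stable _ mU3))
      (mul_mem_idealSpan (add_mem (add_mem (add_mem mk (mul_mem mf mb)) (mul_mem md mc))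
        (mul_mem me mf)) mA4)) (mul_mem_idealSpan mk (stable _ (stable _ (stable _ mP)))))
      (mul_mem_idealSpan (pow_mem mk 2) (stable _ (stable _ (stable _ md'))))
  have hY : k ^ 2 * (t * U3) + (k + f * b + d * c + e * f) * A4 + k * (t * (t * (t * P))) +
      k ^ 2 * (t * (t * (t * d))) = t ^ 4 * (1 + t) / a := by
    rw [eq_div_iff ha]
    linear_combination k ^ 2 * t * hU + (k + f * b + d * c + e * f) * hA + k * t ^ 3 * hP +
      t ^ 3 * hWt - t ^ 3 * hW'
  generalize k ^ 2 * (t * U3) + (k + f * b + d * c + e * f) * A4 + k * (t * (t * (t * P))) +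
      k ^ 2 * (t * (t * (t * d))) = Y at mY hY
  have h41 : proj 4 1 (d * c ^ 6 / a) ∈ S 15 := by
    rw [h.proj_four_mul_div ht, ← hG,
      show c ^ 4 * ((f ^ 4 + t * d) * G ^ 2 / a) = c ^ 3 * QL * G by
        rw [← mul_div_assoc, div_eq_iff ha]; linear_combination -c ^ 3 * G * hL]
    exact mul_mem (mul_mem (pow_mem mc 3) mL) mG
  have root := root (by rw [Tower.numer]; linear_combination hX) (by linear_combination hJ)
    (by linear_combination hR) (by linear_combination hK) (by linear_combination hC) h41
  intro qj hqj
  fin_cases hqj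
  · change proj 8 1 (1 / a) ∈ S 15
    rw [(h.proj_eight_inv ht).1, show t ^ 6 * (1 + t) / a = t * (t * Y) by rw [hY]; ring]
    exact mem_of_mem_idealSpan (stable _ (stable _ mY))
  · change proj 8 2 (1 / a) ∈ S 15
    rw [h.proj_eight_two ht, ← hE, ← hT3t]
    exact pow_mem (mem_of_mem_idealSpan mT3) 2
  · change proj 8 3 (1 / a) ∈ S 15
    rw [(h.proj_eight_inv ht).2.2,
      show t ^ 4 * (1 + t) ^ 3 / a = Y + t * (t * Y) by
        rw [hY]; linear_combination (t ^ 5 * (1 + t) / a) * two]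
    exact mem_of_mem_idealSpan (add_mem mY (stable _ (stable _ mY)))
  · change proj 16 4 (1 / a) ∈ S 15
    rw [h.proj_sixteen_four ht, ← hE]
    exact pow_mem mED 4
  · change proj 16 6 (1 / a) ∈ S 15
    rw [h.proj_sixteen_six ht, ← hE,
      -- Again E² = (E + b)² + b², with (1+t)(E + b)²/a = T3 and t⁴(1+t)/a = Y.
      show t ^ 4 * (1 + t) * E ^ 2 / a = t * (t * (t * (t * T3))) + b ^ 2 * Y by
        rw [hT3t, hY]; linear_combination (-t ^ 4 * (1 + t) * (E * b + b ^ 2) / a) * two]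
    exact pow_mem (mem_of_mem_idealSpan (add_mem (stable _ (stable _ (stable _ (stable _ mT3))))
      (mul_mem_idealSpan (pow_mem mb 2) mY))) 2
  · exact root.1
  · exact root.2.1
  · change proj 32 12 (1 / a) ∈ S 15
    rw [h.proj_thirtytwo_twelve ht, ← hE, ← hG,
      -- One factor G is spent on E²G/a = Eg², and the factor 1 + t is absorbed by another G, which
      -- lies in the ideal.
      show E ^ 2 * ((1 + t) * G ^ 4 + (b + c ^ 4) * (E + b) ^ 4 / a) / a =
        Eg ^ 2 * (G + t * G) * G ^ 2 + (E * (E + b) ^ 2 / a) ^ 2 * (b + c ^ 4) by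
          have h2 : Eg ^ 2 = E ^ 2 * G / a := by
            rw [eq_div_iff ha]
            refine mul_left_cancel₀ ha ?_
            linear_combination (a * Eg + E * f * k) * hEg - E ^ 2 * hGg
          rw [h2]
          field_simp]
    exact pow_mem (add_mem (mul_mem (mul_mem (pow_mem mEg 2) (mem_of_mem_idealSpan
      (add_mem mG' (stable _ mG')))) (pow_mem mG 2)) (mul_mem (pow_mem mED 2)
        (add_mem mb (pow_mem mc 4)))) 4
  · exact root.2.2

end Fifteen

theorem thetaAt_one (l : ℕ) (r : ℤ) : thetaAt l r 1 = thetaL l r := by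
  rw [thetaAt, Nat.cast_one, one_mul]

end ThetaTwo

theorem theorem7p2 :
    (∀ r : ℤ, IsCoprime r 11 →
      ∀ qj ∈ ([(8, 1), (8, 3), (8, 6), (16, 4), (16, 8), (16, 10), (32, 0), (32, 12),
        (64, 16)] : List (ℕ × ℕ)),
        ThetaTwo.proj qj.1 qj.2 (1 / ThetaTwo.thetaL 11 r) ∈ ThetaTwo.S 11) ∧
    (∀ r : ℤ, IsCoprime r 13 →
      ∀ qj ∈ ([(8, 2), (8, 3), (8, 5), (16, 4), (16, 8), (16, 14), (32, 0), (32, 12),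
        (64, 16)] : List (ℕ × ℕ)),
        ThetaTwo.proj qj.1 qj.2 (1 / ThetaTwo.thetaL 13 r) ∈ ThetaTwo.S 13) ∧
    (∀ r : ℤ, IsCoprime r 15 →
      ∀ qj ∈ ([(8, 1), (8, 2), (8, 3), (16, 4), (16, 6), (16, 8), (32, 0), (32, 12),
        (64, 16)] : List (ℕ × ℕ)),
        ThetaTwo.proj qj.1 qj.2 (1 / ThetaTwo.thetaL 15 r) ∈ ThetaTwo.S 15) := by
  refine ⟨fun r hr => ?_, fun r hr => ?_, fun r hr => ?_⟩
  · rw [← ThetaTwo.thetaAt_one]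
    exact ThetaTwo.Eleven.proj_inv_mem hr
  · rw [← ThetaTwo.thetaAt_one]
    exact ThetaTwo.Thirteen.proj_inv_mem hr
  · rw [← ThetaTwo.thetaAt_one]
    exact ThetaTwo.Fifteen.proj_inv_mem hr
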